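/- **Setting.** Let $\mu$ be a probability distribution of pairs $(\mathbf x,y)\in\mathbb R^d\times\mathbb R$ with $\|\mathbf x\|_2\le 1$ and $|y|\le C_y\le 1$ almost surely, and let $(\mathbf x_1,y_1),\dots,(\mathbf x_n,y_n)$, $n\ge1$, be drawn i.i.d. from $\mu$. Let $\sigma(z)=\max\{z,0\}$. Consider a network with $L_C\ge0$ convolutional layers followed by $L_F\ge0$ fully-connected layers, $L=L_C+L_F$, and layer dimensions $m_0=d,m_1,\dots,m_L=m$ (all positive): $$\mathbf z^{(0)}=\mathbf x,\qquad f(\mathbf x;\Theta)=\frac1{m^p}\sum_{k=1}^m a_kz^{(L)}_k\quad(p\ge0),\qquad \mathbf z^{(l)}=\sigma\big(\mathbf A^{(l)\top}\mathbf z^{(l-1)}\big)\quad(L_C<l\le L),$$ and, for $l\le L_C$, with a kernel $\mathbf w^{(l)}\in\mathbb R^{s_l}$, $s_l\ge1$, and $m_ls_l+s_l-1\le m_{l-1}$, $$y^{(l)}_k=\sigma\Big(\sum_{j=1}^{s_l}w^{(l)}_jz^{(l-1)}_{k+j-1}\Big)\ (1\le k\le m_ls_l),\qquad z^{(l)}_k=\text{the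 average or the maximum of } y^{(l)}_{(k-1)s_l+1},\dots,y^{(l)}_{ks_l}\ (1\le k\le m_l).$$ Let $\Theta^{(l)}$ be the vector of the $q(l)$ parameters of layer $l$ ($\mathbf w^{(l)}$, $\mathbf A^{(l)}$, or $\mathbf a$ for $l=L+1$) and $\Theta=(\Theta^{(1)},\dots,\Theta^{(L+1)})$. Put $\ell(\mathbf x,y;\Theta)=\frac12(f(\mathbf x;\Theta)-y)^2$, $\mathcal L_\mu(\Theta)=\mathbb E_\mu\,\ell(\mathbf x,y;\Theta)$, $\mathcal L_n(\Theta)=\frac1n\sum_{i=1}^n\ell(\mathbf x_i,y_i;\Theta)$ and $\mathcal E_{\rm gen}=\mathcal L_\mu-\mathcal L_n$. The initialization is independent of the data, with independent layers $\Theta^{(l)}(0)\sim\mathcal N(\mathbf 0,\frac{\kappa^2}{q(l)}\mathbf I)$, $\kappa\ne0$. A gradient flow trajectory on $[0,T]$ is an absolutely continuous solution of $\dot\Theta(t)=-\nabla\mathcal L_n(\Theta(t))$; since ReLU is not differentiable everywhere, this means $-\dot\Theta(t)\in\partial\mathcal L_n(\Theta(t))$ for almost every $t$, with the Clarke subdifferential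 $\partial$. Put $$\mathsf{CL}(T)=\int_0^T2\sqrt{2\mathcal L_n(\Theta(t))}\Big(C_y-\sqrt{2\mathcal L_n(\Theta(t))}\Big)\,\mathrm dt,$$ and $C_{L,d}=\sqrt{2(L+1)\log2}+1$ if $L_C=0$, $C_{L,d}=2\sqrt{(L+2+\log d)\,d}$ if $L_C>0$. **Theorem.** There is an absolute constant $c_0>0$, and for all $C_f>0$ and $\delta_0\in(0,1)$ there is a constant $K>0$ that depends only on $C_f$ and $\delta_0$, such that the following holds for all networks, $p$, $\kappa$, $n$, $C_y$, $\mu$ as above, all $T\ge0$ and all $\delta\in(0,\delta_0]$. With probability at least $1-\delta$ over the sample and the initialization, every gradient flow trajectory $\Theta$ on $[0,T]$ that starts from the initialization and satisfies the boundedness assumption $|f(\mathbf x;\Theta(t))|\le C_f$ for all $\|\mathbf x\|_2\le1$, $t\in[0,T]$, satisfies $R:=c_0\big(1+\log\frac{L+1}{\delta}\big)\kappa^2+\mathsf{CL}(T)\ge0$ and $$\mathcal E_{\rm gen}(\Theta(T))\le K\left(\frac{C_{L,d}}{m^p\sqrt n}\,R^{\frac{L+1}2}+\sqrt{\frac{\log(1/\delta)}n}\right).$$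 -/

import Mathlib

open MeasureTheory ProbabilityTheory Filter Topology

noncomputable section

/-- The two pooling operations. -/
inductive Pooling where
  | average
  | max

/-- Shape of a network with `numConv` convolutional layers (`Conv → ReLU → Pooling`) followed by
`numFC` fully-connected ReLU layers and a linear output layer; `numConv = 0` is a fully-connected
network. Layers are counted from `0`, so layer `l` maps the signal of dimension `width l` to the
signal of dimension `width (l + 1)`, `width 0` is the input dimension, and the last index
`numConv + numFC` is the output layer.

A convolutional layer slides one kernel of length `kernel l` over its input with stride one and
without padding, and pools its output over consecutive disjoint blocks of length `kernel l`.
The field `window_le` says that all windows used lie inside the input. Values of `width`, `kernel`,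
`pooling` beyond the last relevant layer are never used. -/
structure NetShape where
  numConv : ℕ
  numFC : ℕ
  width : ℕ → ℕ
  kernel : ℕ → ℕ
  pooling : ℕ → Pooling
  width_pos : ∀ l ≤ numConv + numFC, 0 < width l
  kernel_pos : ∀ l < numConv, 0 < kernel l
  window_le : ∀ l < numConv, width (l + 1) * kernel l + kernel l ≤ width l + 1

namespace NetShape

/-- The number `L` of hidden layers. -/
def depth (N : NetShape) : ℕ := N.numConv + N.numFC

/-- The input dimension `d`. -/
def inputDim (N : NetShape) : ℕ := N.width 0

/-- The width `m` of the last hidden layer. -/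
def outWidth (N : NetShape) : ℕ := N.width N.depth

/-- The number of parameters of layer `l`, `l = 0, …, L`. -/
def paramCount (N : NetShape) (l : ℕ) : ℕ :=
  if l < N.numConv then N.kernel l
  else if l < N.depth then N.width l * N.width (l + 1)
  else N.outWidth

/-- The input space `ℝ^d` with the Euclidean norm. -/
abbrev Input (N : NetShape) : Type := EuclideanSpace ℝ (Fin N.inputDim)

/-- The space of all parameters, the concatenation of the parameter vectors of the `L + 1` layers,
with the Euclidean norm. -/
abbrev Params (N : NetShape) : Type :=
  EuclideanSpace ℝ (Σ l : Fin (N.depth + 1), Fin (N.paramCount l))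

/-- The `i`-th parameter of layer `l` (and `0` if there is none). -/
def coef (N : NetShape) (θ : N.Params) (l i : ℕ) : ℝ :=
  if h : l < N.depth + 1 ∧ i < N.paramCount l then θ ⟨⟨l, h.1⟩, ⟨i, h.2⟩⟩ else 0

/-- The ReLU function. -/
def relu (z : ℝ) : ℝ := Max.max z 0

/-- Pooling of a block of `s` numbers. -/
def pool : Pooling → (s : ℕ) → (ℕ → ℝ) → ℝ
  | Pooling.average, s, y => (∑ j ∈ Finset.range s, y j) / s
  | Pooling.max, s, y => ⨆ j : Fin s, y j

/-- Entry `k` of the rectified convolution, with the kernel of layer `l`, of the signal `z`. -/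
def conv (N : NetShape) (θ : N.Params) (l : ℕ) (z : ℕ → ℝ) (k : ℕ) : ℝ :=
  relu (∑ j ∈ Finset.range (N.kernel l), N.coef θ l j * z (k + j))

/-- Entry `i` of a fully-connected layer `σ(Aᵀ z)`. The matrix `A` of layer `l` has
`width l` rows and `width (l + 1)` columns and is stored column after column. -/
def fullyConn (N : NetShape) (θ : N.Params) (l : ℕ) (z : ℕ → ℝ) (i : ℕ) : ℝ :=
  relu (∑ j ∈ Finset.range (N.width l), N.coef θ l (j + N.width l * i) * z j)

/-- The signal after `l` layers. It is a vector of dimension `width l`, written as a sequence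
that vanishes from index `width l` on. -/
def signal (N : NetShape) (θ : N.Params) (x : N.Input) : ℕ → ℕ → ℝ
  | 0 => fun k => if h : k < N.inputDim then x ⟨k, h⟩ else 0
  | l + 1 => fun k =>
      if k < N.width (l + 1) then
        if l < N.numConv then
          pool (N.pooling l) (N.kernel l)
            (fun j => N.conv θ l (signal N θ x l) (k * N.kernel l + j))
        else N.fullyConn θ l (signal N θ x l) k
      else 0

/-- The network function, with output scaling `1 / m ^ p`. -/
def eval (N : NetShape) (p : ℝ) (x : N.Input) (θ : N.Params) : ℝ :=
  1 / (N.outWidth : ℝ) ^ p *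
    ∑ k ∈ Finset.range N.outWidth, N.coef θ N.depth k * N.signal θ x N.depth k

/-- The quadratic loss at the data point `z = (x, y)`. -/
def loss (N : NetShape) (p : ℝ) (z : N.Input × ℝ) (θ : N.Params) : ℝ :=
  1 / 2 * (N.eval p z.1 θ - z.2) ^ 2

/-- The population risk. -/
def popRisk (N : NetShape) (p : ℝ) (μ : Measure (N.Input × ℝ)) (θ : N.Params) : ℝ :=
  ∫ z, N.loss p z θ ∂μ

/-- The empirical risk on the sample `S`. -/
def empRisk (N : NetShape) (p : ℝ) {n : ℕ} (S : Fin n → N.Input × ℝ) (θ : N.Params) : ℝ :=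
  1 / (n : ℝ) * ∑ i, N.loss p (S i) θ

/-- The generalization error. -/
def genError (N : NetShape) (p : ℝ) (μ : Measure (N.Input × ℝ)) {n : ℕ}
    (S : Fin n → N.Input × ℝ) (θ : N.Params) : ℝ :=
  N.popRisk p μ θ - N.empRisk p S θ

/-- The law of the random initialization: all parameters are independent, and those of layer `l`
are centered Gaussian with variance `κ ^ 2` divided by the number of parameters of layer `l`. -/
def initLaw (N : NetShape) (κ : ℝ) : Measure N.Params :=
  (Measure.pi fun i : Σ l : Fin (N.depth + 1), Fin (N.paramCount l) =>
    gaussianReal 0 (Real.toNNReal (κ ^ 2 / (N.paramCount i.1 : ℝ)))).map (WithLp.toLp 2)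

/-- The constant `C_{L,d}`, with its two values for fully-connected networks and for networks
that have convolutional layers. -/
def complexityConst (N : NetShape) : ℝ :=
  if N.numConv = 0 then Real.sqrt (2 * ((N.depth : ℝ) + 1) * Real.log 2) + 1
  else 2 * Real.sqrt (((N.depth : ℝ) + 2 + Real.log N.inputDim) * N.inputDim)

/-- The continuous cumulative loss at time `T` along the curve `Θ`. -/
def cumLoss (N : NetShape) (p Cy : ℝ) {n : ℕ} (S : Fin n → N.Input × ℝ) (Θ : ℝ → N.Params)
    (T : ℝ) : ℝ :=
  ∫ t in (0 : ℝ)..T,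
    2 * Real.sqrt (2 * N.empRisk p S (Θ t)) * (Cy - Real.sqrt (2 * N.empRisk p S (Θ t)))

end NetShape

/-- The Clarke subdifferential of `F` at `x`: the convex hull of all limits of gradients of `F` at
points of differentiability that tend to `x`. -/
def clarkeSubdifferential {E : Type*} [NormedAddCommGroup E] [InnerProductSpace ℝ E]
    [CompleteSpace E] (F : E → ℝ) (x : E) : Set E :=
  convexHull ℝ {g | ∃ u : ℕ → E, Tendsto u atTop (𝓝 x) ∧ (∀ k, DifferentiableAt ℝ F (u k)) ∧
    Tendsto (fun k => gradient F (u k)) atTop (𝓝 g)}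

/-- `Θ` solves the gradient flow `Θ' = -∇F(Θ)` on `[0, T]`. Networks with ReLU are not
differentiable everywhere, so the equation has its usual meaning for such losses: `Θ` is
absolutely continuous and `-Θ'(t)` lies in the Clarke subdifferential of `F` at `Θ t` for almost
every `t`. -/
def IsGradientFlow {E : Type*} [NormedAddCommGroup E] [InnerProductSpace ℝ E]
    [CompleteSpace E] (F : E → ℝ) (T : ℝ) (Θ : ℝ → E) : Prop :=
  ∃ v : ℝ → E, IntervalIntegrable v volume 0 T ∧
    (∀ᵐ t, t ∈ Set.Icc 0 T → v t ∈ clarkeSubdifferential F (Θ t)) ∧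
    ∀ t ∈ Set.Icc 0 T, Θ t = Θ 0 - ∫ s in (0 : ℝ)..t, v s

end

/-! Why the theorem is true. The network is positively homogeneous of degree one in each layer
separately, so by Euler's identity the pairing of any Clarke subgradient of the empirical risk with
its own layer is the same number for every layer, `radialRisk`. Hence along the flow all squared
layer norms have the same derivative `-2 * radialRisk`, and Cauchy–Schwarz bounds it by the
integrand of `CL` (`norm_layerVec_sq_le_add_cumLoss`). A Gaussian exponential moment bounds all
layers at time `0`. So `R` dominates every squared layer norm at time `T`, and what remains is a
generalization bound that is uniform over balls of parameters.

For layers of norm at most `ρ` the Rademacher complexity is of order `C_{L,d} ρ^(L+1) / (m^p √n)`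
(`sum_sign_mul_eval_le`). By homogeneity `ρ = 1` suffices, and it is enough to bound `E exp(λ ‖∑ εᵢ
z(xᵢ)‖)` for the hidden signal `z`. Peeling off a fully-connected layer costs only a factor `2`,
because the extremal layer is a single neuron and the exponential moment contracts under ReLU. The
convolutional block is handled by chaining over dyadically rounded kernels. A layer with kernel
length `s` multiplies squared norms by at most `overlapFactor s` (`1`, `3/2` or `2`), while pooling
divides the width by at least `s`, so the product of all kernel lengths is at most `d`. Since
`overlapFactor s < s` for `s ≥ 2`, this controls gain times number of kernel entries by `8 d`
(`netDim_mul_convGain_le`). Kernels of length one are reduced to a sign and only contribute to the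
term in `L`.

Symmetrisation, contraction for the clipped quadratic loss and McDiarmid's inequality turn
complexity into a deviation bound for one ball (`measure_exists_genError_gt_le`). As `R` depends on
the trajectory, the bound is applied to countably many balls at once, with radii for which the
complexity term is `2^j` and with confidence `δ 2^(-j-2)`. The price of the union is absorbed by the
complexity term itself.

Expected suprema are written throughout as sums over sign patterns `ε` of a quantity at an arbitrary
selection `ε ↦ t ε`; this avoids measurability and finiteness of suprema. -/

noncomputable section

/-! ### Sums over signs -/

/-- The sign `±1` encoded by a Boolean. -/
def boolSign (b : Bool) : ℝ := cond b 1 (-1)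

@[simp] lemma boolSign_true : boolSign true = 1 := rfl

@[simp] lemma boolSign_false : boolSign false = -1 := rfl

lemma boolSign_not (b : Bool) : boolSign (!b) = -boolSign b := by cases b <;> simp

lemma abs_boolSign (b : Bool) : |boolSign b| = 1 := by cases b <;> simp

section Signs

variable {ι : Type*} [Fintype ι] [DecidableEq ι]

/-- Flipping the sign at `a` is an involution of the sign patterns. This pairing plays the role of
conditioning on all signs but one. -/
lemma sum_signs_update (a : ι) (G : (ι → Bool) → ℝ) :
    ∑ ε, (G (Function.update ε a true) + G (Function.update ε a false)) = 2 * ∑ ε, G ε := by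
  let flip : (ι → Bool) → (ι → Bool) := fun ε => Function.update ε a (!ε a)
  have hinv : Function.Involutive flip := by
    intro ε
    simp [flip]
  have h1 : ∑ ε, G (flip ε) = ∑ ε, G ε := Equiv.sum_comp hinv.toPerm G
  have h2 : ∀ ε, G (Function.update ε a true) + G (Function.update ε a false)
      = G ε + G (flip ε) := by
    intro ε
    simp only [flip]
    cases h : ε a
    · rw [Bool.not_false, ← h, Function.update_eq_self, add_comm]
    · rw [Bool.not_true, ← h, Function.update_eq_self]
  rw [Finset.sum_congr rfl fun ε _ => h2 ε, Finset.sum_add_distrib, h1]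
  ring

lemma sum_signs_not (G : (ι → Bool) → ℝ) : ∑ ε : ι → Bool, G (fun i => !ε i) = ∑ ε, G ε := by
  have hinv : Function.Involutive (fun (ε : ι → Bool) i => !ε i) := by
    intro ε; simp
  exact Equiv.sum_comp hinv.toPerm G

/-- Improving a selection one coordinate at a time. -/
lemma exists_selection_of_update {α : Type*} (T : Set α) (a : ι) (F F' : (ι → Bool) → α → ℝ)
    (h : ∀ ε, ∀ t₁ ∈ T, ∀ t₀ ∈ T, ∃ c₁ ∈ T, ∃ c₀ ∈ T,
      F (Function.update ε a true) t₁ + F (Function.update ε a false) t₀ ≤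
        F' (Function.update ε a true) c₁ + F' (Function.update ε a false) c₀)
    (t : (ι → Bool) → α) (ht : ∀ ε, t ε ∈ T) :
    ∃ t' : (ι → Bool) → α, (∀ ε, t' ε ∈ T) ∧ ∑ ε, F ε (t ε) ≤ ∑ ε, F' ε (t' ε) := by
  choose c₁ hc₁ c₀ hc₀ hle using fun ε => h ε (t (Function.update ε a true)) (ht _)
    (t (Function.update ε a false)) (ht _)
  let t' : (ι → Bool) → α := fun ε =>
    if ε a then c₁ (Function.update ε a true) else c₀ (Function.update ε a true)
  refine ⟨t', fun ε => ?_, ?_⟩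
  · by_cases hε : ε a <;> simp [t', hε, hc₁, hc₀]
  · have key : 2 * ∑ ε, F ε (t ε) ≤ 2 * ∑ ε, F' ε (t' ε) := by
      rw [← sum_signs_update a, ← sum_signs_update a]
      refine Finset.sum_le_sum fun ε _ => ?_
      simpa [t'] using hle (Function.update ε a true)
    linarith

lemma sum_mul_update_sign (a : ι) (s : ι → ℝ) (ε : ι → Bool) (b : Bool) :
    ∑ i, boolSign (Function.update ε a b i) * s i
      = boolSign b * s a + ∑ i ∈ Finset.univ.erase a, boolSign (ε i) * s i := by
  rw [← Finset.add_sum_erase _ _ (Finset.mem_univ a)]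
  congr 1
  · simp
  · refine Finset.sum_congr rfl fun i hi => ?_
    rw [Function.update_of_ne (Finset.ne_of_mem_erase hi)]

/-- The contraction step for one sign. The four alternatives are the ways to reassign the two chosen
points to the signs `+` and `-`: keep, exchange, or use one of them twice. If both `s` and `t` are
negative, the left side is `exp A + exp B`, and using the larger one twice wins because `cosh ≥ 1`.
-/
lemma exp_relu_swap (A B s t : ℝ) :
    Real.exp (A + max s 0) + Real.exp (B - max t 0) ≤ Real.exp (A + s) + Real.exp (B - t) ∨
    Real.exp (A + max s 0) + Real.exp (B - max t 0) ≤ Real.exp (B + t) + Real.exp (A - s) ∨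
    Real.exp (A + max s 0) + Real.exp (B - max t 0) ≤ Real.exp (A + s) + Real.exp (A - s) ∨
    Real.exp (A + max s 0) + Real.exp (B - max t 0) ≤ Real.exp (B + t) + Real.exp (B - t) := by
  have two (x y : ℝ) : 2 * Real.exp x ≤ Real.exp (x + y) + Real.exp (x - y) := by
    have h1 : 1 ≤ Real.cosh y := Real.one_le_cosh y
    rw [Real.cosh_eq] at h1
    have : Real.exp (x + y) + Real.exp (x - y) = Real.exp x * (Real.exp y + Real.exp (-y)) := by
      rw [sub_eq_add_neg, Real.exp_add, Real.exp_add]; ring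
    rw [this]
    nlinarith [Real.exp_pos x]
  rcases le_total 0 s with hs | hs <;> rcases le_total 0 t with ht | ht
  · left; rw [max_eq_left hs, max_eq_left ht]
  · left; rw [max_eq_left hs, max_eq_right ht]
    gcongr
  · right; left; rw [max_eq_right hs, max_eq_left ht, add_comm]
    gcongr <;> linarith
  · rw [max_eq_right hs, max_eq_right ht]
    rcases le_total A B with h | h
    · right; right; right
      have := two B t
      have h2 : Real.exp A ≤ Real.exp B := Real.exp_le_exp.2 h
      simp only [add_zero, sub_zero]; linarith
    · right; right; left
      have := two A s
      have h2 : Real.exp B ≤ Real.exp A := Real.exp_le_exp.2 h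
      simp only [add_zero, sub_zero]; linarith

/-- Contraction principle for the rectifier and exponential moments, in terms of selections. -/
lemma sum_exp_relu_le (T : Set (ι → ℝ)) (lam : ℝ) (hlam : 0 ≤ lam) (M : ℝ)
    (hM : ∀ t : (ι → Bool) → (ι → ℝ), (∀ ε, t ε ∈ T) →
      ∑ ε, Real.exp (lam * ∑ i, boolSign (ε i) * t ε i) ≤ M)
    (t : (ι → Bool) → (ι → ℝ)) (ht : ∀ ε, t ε ∈ T) :
    ∑ ε, Real.exp (lam * ∑ i, boolSign (ε i) * max (t ε i) 0) ≤ M := by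
  have main : ∀ s : Finset ι, ∀ t : (ι → Bool) → (ι → ℝ), (∀ ε, t ε ∈ T) →
      ∑ ε, Real.exp (lam * ∑ i, boolSign (ε i) * (if i ∈ s then max (t ε i) 0 else t ε i))
        ≤ M := by
    intro s
    induction s using Finset.induction_on with
    | empty => simpa using hM
    | insert a s ha ih =>
      intro t ht
      obtain ⟨t', ht', hle⟩ := exists_selection_of_update T a
        (fun ε x => Real.exp (lam * ∑ i, boolSign (ε i) *
          (if i ∈ insert a s then max (x i) 0 else x i)))
        (fun ε x => Real.exp (lam * ∑ i, boolSign (ε i) * (if i ∈ s then max (x i) 0 else x i)))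
        (fun ε t₁ h₁ t₀ h₀ => by
          let U : (ι → ℝ) → ℝ := fun x => lam * ∑ i ∈ Finset.univ.erase a, boolSign (ε i) *
            (if i ∈ s then max (x i) 0 else x i)
          have e1 : ∀ x b, lam * ∑ i, boolSign (Function.update ε a b i) *
              (if i ∈ insert a s then max (x i) 0 else x i)
              = U x + boolSign b * max (lam * x a) 0 := by
            intro x b
            rw [sum_mul_update_sign a (fun i => if i ∈ insert a s then max (x i) 0 else x i)]
            have h3 : ∑ i ∈ Finset.univ.erase a, boolSign (ε i) *
                (if i ∈ insert a s then max (x i) 0 else x i) =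
                ∑ i ∈ Finset.univ.erase a, boolSign (ε i) *
                (if i ∈ s then max (x i) 0 else x i) := by
              refine Finset.sum_congr rfl fun i hi => ?_
              have : i ≠ a := Finset.ne_of_mem_erase hi
              simp [Finset.mem_insert, this]
            have h4 : max (lam * x a) 0 = lam * max (x a) 0 := by
              rw [mul_max_of_nonneg _ _ hlam, mul_zero]
            rw [h3, h4]
            simp only [Finset.mem_insert_self, if_true, U]
            ring
          have e2 : ∀ x b, lam * ∑ i, boolSign (Function.update ε a b i) *
              (if i ∈ s then max (x i) 0 else x i)
              = U x + boolSign b * (lam * x a) := by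
            intro x b
            rw [sum_mul_update_sign a (fun i => if i ∈ s then max (x i) 0 else x i)]
            simp only [ha, if_false, U]
            ring
          simp only [e1, e2, boolSign_true, boolSign_false, one_mul, neg_one_mul,
            ← sub_eq_add_neg]
          rcases exp_relu_swap (U t₁) (U t₀) (lam * t₁ a) (lam * t₀ a) with h | h | h | h
          · exact ⟨t₁, h₁, t₀, h₀, h⟩
          · exact ⟨t₀, h₀, t₁, h₁, h⟩
          · exact ⟨t₁, h₁, t₁, h₁, h⟩
          · exact ⟨t₀, h₀, t₀, h₀, h⟩) t ht
      exact hle.trans (ih t' ht')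
  simpa using main Finset.univ t ht

/-- Contraction principle for Lipschitz functions, in terms of selections. -/
lemma sum_lipschitz_le {α : Type*} (T : Set α) (f g : α → ι → ℝ)
    (hfg : ∀ i, ∀ s ∈ T, ∀ t ∈ T, |f s i - f t i| ≤ |g s i - g t i|) (M : ℝ)
    (hM : ∀ t : (ι → Bool) → α, (∀ ε, t ε ∈ T) →
      ∑ ε, ∑ i, boolSign (ε i) * g (t ε) i ≤ M)
    (t : (ι → Bool) → α) (ht : ∀ ε, t ε ∈ T) :
    ∑ ε, ∑ i, boolSign (ε i) * f (t ε) i ≤ M := by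
  have main : ∀ s : Finset ι, ∀ t : (ι → Bool) → α, (∀ ε, t ε ∈ T) →
      ∑ ε, ∑ i, boolSign (ε i) * (if i ∈ s then f (t ε) i else g (t ε) i) ≤ M := by
    intro s
    induction s using Finset.induction_on with
    | empty => simpa using hM
    | insert a s ha ih =>
      intro t ht
      obtain ⟨t', ht', hle⟩ := exists_selection_of_update T a
        (fun ε x => ∑ i, boolSign (ε i) * (if i ∈ insert a s then f x i else g x i))
        (fun ε x => ∑ i, boolSign (ε i) * (if i ∈ s then f x i else g x i))
        (fun ε t₁ h₁ t₀ h₀ => by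
          let U : α → ℝ := fun x => ∑ i ∈ Finset.univ.erase a, boolSign (ε i) *
            (if i ∈ s then f x i else g x i)
          have e1 : ∀ x b, ∑ i, boolSign (Function.update ε a b i) *
              (if i ∈ insert a s then f x i else g x i) = U x + boolSign b * f x a := by
            intro x b
            rw [sum_mul_update_sign a (fun i => if i ∈ insert a s then f x i else g x i)]
            have h3 : ∑ i ∈ Finset.univ.erase a, boolSign (ε i) *
                (if i ∈ insert a s then f x i else g x i) = U x := by
              refine Finset.sum_congr rfl fun i hi => ?_
              have : i ≠ a := Finset.ne_of_mem_erase hi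
              simp [Finset.mem_insert, this]
            rw [h3]
            simp only [Finset.mem_insert_self, if_true]
            ring
          have e2 : ∀ x b, ∑ i, boolSign (Function.update ε a b i) *
              (if i ∈ s then f x i else g x i) = U x + boolSign b * g x a := by
            intro x b
            rw [sum_mul_update_sign a (fun i => if i ∈ s then f x i else g x i)]
            simp only [ha, if_false, U]
            ring
          simp only [e1, e2, boolSign_true, boolSign_false, one_mul, neg_one_mul,
            ← sub_eq_add_neg]
          -- Coordinate `a` enters only through a difference of values at the two points, so keeping
          -- or exchanging them makes the difference of `g` equal to its modulus.
          have hl := (le_abs_self _).trans (hfg a t₁ h₁ t₀ h₀)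
          rcases le_total 0 (g t₁ a - g t₀ a) with h | h
          · rw [abs_of_nonneg h] at hl
            exact ⟨t₁, h₁, t₀, h₀, by linarith⟩
          · rw [abs_of_nonpos h] at hl
            exact ⟨t₀, h₀, t₁, h₁, by linarith⟩) t ht
      exact hle.trans (ih t' ht')
  simpa using main Finset.univ t ht

/-! ### Exponential moments of Rademacher sums in inner product spaces -/

/-- `cosh √B = ∑ B^k / (2k)!` has nonnegative coefficients, hence is convex in `B ≥ 0`, and moving
two points apart about a fixed midpoint increases the sum of a convex function. -/
lemma cosh_sqrt_add_le {A c C : ℝ} (hc : |c| ≤ C) (hC : 2 * C ≤ A) :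
    Real.cosh (√(A + 2 * c)) + Real.cosh (√(A - 2 * c)) ≤
      Real.cosh (√(A + 2 * C)) + Real.cosh (√(A - 2 * C)) := by
  obtain ⟨h1, h2⟩ := abs_le.1 hc
  have hC0 : 0 ≤ C := (abs_nonneg c).trans hc
  have hser : ∀ B : ℝ, 0 ≤ B → HasSum (fun k : ℕ => B ^ k / ((2 * k).factorial : ℝ))
      (Real.cosh (√B)) := by
    intro B hB
    have := Real.hasSum_cosh (√B)
    simpa [pow_mul, Real.sq_sqrt hB] using this
  have hl := (hser (A + 2 * c) (by linarith)).add (hser (A - 2 * c) (by linarith))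
  have hr := (hser (A + 2 * C) (by linarith)).add (hser (A - 2 * C) (by linarith))
  refine hasSum_le (fun k => ?_) hl hr
  rw [← add_div, ← add_div]
  refine div_le_div_of_nonneg_right ?_ (by positivity)
  have hconv : ConvexOn ℝ (Set.Ici 0) fun x : ℝ => x ^ k := convexOn_pow k
  rcases hC0.eq_or_lt with h0 | hpos
  · have : c = 0 := by rw [← h0] at hc; exact abs_nonpos_iff.1 hc
    simp [this, ← h0]
  · set w : ℝ := (C + c) / (2 * C)
    have hw0 : 0 ≤ w := div_nonneg (by linarith) (by linarith)
    have hw1 : 0 ≤ 1 - w := by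
      rw [sub_nonneg, div_le_one (by linarith)]; linarith
    have hwC : w * (2 * C) = C + c := by
      simp only [w]; field_simp
    have i1 := hconv.2 (x := A + 2 * C) (y := A - 2 * C) (by simp; linarith) (by simp; linarith)
      hw0 hw1 (by ring)
    have i2 := hconv.2 (x := A - 2 * C) (y := A + 2 * C) (by simp; linarith) (by simp; linarith)
      hw0 hw1 (by ring)
    simp only [smul_eq_mul] at i1 i2
    have e1 : w * (A + 2 * C) + (1 - w) * (A - 2 * C) = A + 2 * c := by linear_combination 2 * hwC
    have e2 : w * (A - 2 * C) + (1 - w) * (A + 2 * C) = A - 2 * c := by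
      linear_combination (-2) * hwC
    rw [e1] at i1
    rw [e2] at i2
    linarith

variable {V : Type*} [NormedAddCommGroup V] [InnerProductSpace ℝ V]

/-- With the norms fixed, parallel vectors are the worst case, and there it is the addition formula
of `cosh`. This makes the moment bounds free of the dimension of `V`. -/
lemma cosh_norm_add_le (a b : V) :
    Real.cosh ‖a + b‖ + Real.cosh ‖a - b‖ ≤ 2 * (Real.cosh ‖a‖ * Real.cosh ‖b‖) := by
  have h1 : ‖a + b‖ = √((‖a‖ ^ 2 + ‖b‖ ^ 2) + 2 * inner ℝ a b) := by
    rw [← Real.sqrt_sq (norm_nonneg (a + b)), norm_add_sq_real]; ring_nf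
  have h2 : ‖a - b‖ = √((‖a‖ ^ 2 + ‖b‖ ^ 2) - 2 * inner ℝ a b) := by
    rw [← Real.sqrt_sq (norm_nonneg (a - b)), norm_sub_sq_real]; ring_nf
  have h3 : √((‖a‖ ^ 2 + ‖b‖ ^ 2) + 2 * (‖a‖ * ‖b‖)) = ‖a‖ + ‖b‖ := by
    rw [← Real.sqrt_sq (add_nonneg (norm_nonneg a) (norm_nonneg b))]; ring_nf
  have h4 : √((‖a‖ ^ 2 + ‖b‖ ^ 2) - 2 * (‖a‖ * ‖b‖)) = |‖a‖ - ‖b‖| := by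
    rw [← Real.sqrt_sq_eq_abs]; ring_nf
  rw [h1, h2]
  refine (cosh_sqrt_add_le (abs_real_inner_le_norm a b)
    (by nlinarith [sq_nonneg (‖a‖ - ‖b‖)])).trans ?_
  rw [h3, h4, Real.cosh_abs, Real.cosh_add, Real.cosh_sub]
  linarith

lemma sum_cosh_norm_le (v : ι → V) :
    ∑ ε : ι → Bool, Real.cosh ‖∑ i, boolSign (ε i) • v i‖ ≤
      (Fintype.card (ι → Bool) : ℝ) * ∏ i, Real.cosh ‖v i‖ := by
  have main : ∀ s : Finset ι, ∑ ε : ι → Bool, Real.cosh ‖∑ i ∈ s, boolSign (ε i) • v i‖ ≤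
      (Fintype.card (ι → Bool) : ℝ) * ∏ i ∈ s, Real.cosh ‖v i‖ := by
    intro s
    induction s using Finset.induction_on with
    | empty => simp
    | insert a s ha ih =>
      have h1 : 2 * ∑ ε : ι → Bool, Real.cosh ‖∑ i ∈ insert a s, boolSign (ε i) • v i‖
          ≤ 2 * (Real.cosh ‖v a‖ * ∑ ε : ι → Bool,
            Real.cosh ‖∑ i ∈ s, boolSign (ε i) • v i‖) := by
        rw [← sum_signs_update a, Finset.mul_sum, Finset.mul_sum]
        refine Finset.sum_le_sum fun ε _ => ?_
        have e : ∀ b, ∑ i ∈ insert a s, boolSign (Function.update ε a b i) • v i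
            = ∑ i ∈ s, boolSign (ε i) • v i + boolSign b • v a := by
          intro b
          rw [Finset.sum_insert ha, add_comm]
          congr 1
          · refine Finset.sum_congr rfl fun i hi => ?_
            rw [Function.update_of_ne (ne_of_mem_of_not_mem hi ha)]
          · simp
        rw [e, e]
        have := cosh_norm_add_le (∑ i ∈ s, boolSign (ε i) • v i) (v a)
        simp only [boolSign_true, boolSign_false, one_smul, neg_smul, ← sub_eq_add_neg]
        linarith
      rw [Finset.prod_insert ha]
      have hpos : 0 ≤ Real.cosh ‖v a‖ := (Real.cosh_pos _).le
      nlinarith [mul_le_mul_of_nonneg_left ih hpos]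
  exact main Finset.univ

/-- A Rademacher sum of vectors of norm at most `η` is subgaussian. -/
lemma sum_exp_norm_le (v : ι → V) {η : ℝ} (hv : ∀ i, ‖v i‖ ≤ η) (lam : ℝ) (hlam : 0 ≤ lam) :
    ∑ ε : ι → Bool, Real.exp (lam * ‖∑ i, boolSign (ε i) • v i‖) ≤
      (Fintype.card (ι → Bool) : ℝ) *
        (2 * Real.exp (lam ^ 2 * Fintype.card ι * η ^ 2 / 2)) := by
  have h := sum_cosh_norm_le (fun i => lam • v i)
  have h1 : ∑ ε : ι → Bool, Real.exp (lam * ‖∑ i, boolSign (ε i) • v i‖) ≤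
      2 * ∑ ε : ι → Bool, Real.cosh ‖∑ i, boolSign (ε i) • lam • v i‖ := by
    rw [Finset.mul_sum]
    refine Finset.sum_le_sum fun ε _ => ?_
    have : ∑ i, boolSign (ε i) • lam • v i = lam • ∑ i, boolSign (ε i) • v i := by
      rw [Finset.smul_sum]
      exact Finset.sum_congr rfl fun i _ => smul_comm _ _ _
    rw [this, norm_smul, Real.norm_of_nonneg hlam, Real.cosh_eq]
    have := Real.exp_pos (-(lam * ‖∑ i, boolSign (ε i) • v i‖))
    linarith
  have h2 : ∏ i, Real.cosh ‖lam • v i‖ ≤ Real.exp (lam ^ 2 * Fintype.card ι * η ^ 2 / 2) := by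
    calc ∏ i, Real.cosh ‖lam • v i‖ ≤ ∏ _i : ι, Real.exp (lam ^ 2 * η ^ 2 / 2) := by
          refine Finset.prod_le_prod (fun i _ => (Real.cosh_pos _).le) fun i _ => ?_
          refine (Real.cosh_le_exp_half_sq _).trans (Real.exp_le_exp.2 ?_)
          rw [norm_smul, Real.norm_of_nonneg hlam, mul_pow]
          have := pow_le_pow_left₀ (norm_nonneg _) (hv i) 2
          gcongr
      _ = _ := by
          rw [Finset.prod_const, ← Real.exp_nat_mul, Finset.card_univ]
          ring_nf
  calc _ ≤ _ := h1
    _ ≤ 2 * ((Fintype.card (ι → Bool) : ℝ) * ∏ i, Real.cosh ‖lam • v i‖) := by gcongr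
    _ ≤ 2 * ((Fintype.card (ι → Bool) : ℝ) *
        Real.exp (lam ^ 2 * Fintype.card ι * η ^ 2 / 2)) := by gcongr
    _ = _ := by ring

/-- A union bound over finitely many Rademacher sums. -/
lemma sum_exp_norm_selection_le {β : Type*} [Fintype β] (u : β → ι → V) {η : ℝ}
    (b : (ι → Bool) → β) (hu : ∀ ε i, ‖u (b ε) i‖ ≤ η) (lam : ℝ) (hlam : 0 ≤ lam) :
    ∑ ε : ι → Bool, Real.exp (lam * ‖∑ i, boolSign (ε i) • u (b ε) i‖) ≤
      (Fintype.card (ι → Bool) : ℝ) * (Fintype.card β *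
        (2 * Real.exp (lam ^ 2 * Fintype.card ι * η ^ 2 / 2))) := by
  classical
  -- Only indices attained by the selection are summed, as `hu` bounds no others.
  let S : Finset β := Finset.univ.image b
  calc ∑ ε : ι → Bool, Real.exp (lam * ‖∑ i, boolSign (ε i) • u (b ε) i‖)
      ≤ ∑ ε : ι → Bool, ∑ β ∈ S, Real.exp (lam * ‖∑ i, boolSign (ε i) • u β i‖) := by
        refine Finset.sum_le_sum fun ε _ => ?_
        exact Finset.single_le_sum (f := fun β => Real.exp (lam * ‖∑ i, boolSign (ε i) • u β i‖))
          (fun _ _ => (Real.exp_pos _).le) (Finset.mem_image_of_mem b (Finset.mem_univ ε))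
    _ = ∑ β ∈ S, ∑ ε : ι → Bool, Real.exp (lam * ‖∑ i, boolSign (ε i) • u β i‖) :=
        Finset.sum_comm
    _ ≤ ∑ _β ∈ S, (Fintype.card (ι → Bool) : ℝ) *
        (2 * Real.exp (lam ^ 2 * Fintype.card ι * η ^ 2 / 2)) := by
        refine Finset.sum_le_sum fun β hβ => ?_
        obtain ⟨ε', -, rfl⟩ := Finset.mem_image.1 hβ
        exact sum_exp_norm_le _ (hu ε') lam hlam
    _ = (S.card : ℝ) * ((Fintype.card (ι → Bool) : ℝ) *
        (2 * Real.exp (lam ^ 2 * Fintype.card ι * η ^ 2 / 2))) := by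
        rw [Finset.sum_const, nsmul_eq_mul]
    _ ≤ (Fintype.card β : ℝ) * ((Fintype.card (ι → Bool) : ℝ) *
        (2 * Real.exp (lam ^ 2 * Fintype.card ι * η ^ 2 / 2))) := by
        gcongr
        exact Finset.card_le_univ S
    _ = _ := by ring

/-- Jensen's inequality for the exponential with the dyadic weights `2⁻¹, 2⁻², …`. -/
lemma exp_sum_dyadic_le (J : ℕ) (x : ℕ → ℝ) :
    Real.exp (∑ k ∈ Finset.range J, (1 / 2 : ℝ) ^ (k + 1) * x k) ≤
      ∑ k ∈ Finset.range J, (1 / 2 : ℝ) ^ (k + 1) * Real.exp (x k) + (1 / 2 : ℝ) ^ J := by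
  induction J generalizing x with
  | zero => simp
  | succ J ih =>
    have e1 : ∑ k ∈ Finset.range (J + 1), (1 / 2 : ℝ) ^ (k + 1) * x k =
        (1 / 2 : ℝ) * x 0 +
          (1 / 2 : ℝ) * ∑ k ∈ Finset.range J, (1 / 2 : ℝ) ^ (k + 1) * x (k + 1) := by
      rw [Finset.sum_range_succ', Finset.mul_sum, add_comm]
      congr 1
      · ring
      · exact Finset.sum_congr rfl fun k _ => by ring
    have e2 : ∑ k ∈ Finset.range (J + 1), (1 / 2 : ℝ) ^ (k + 1) * Real.exp (x k) =
        (1 / 2 : ℝ) * Real.exp (x 0) +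
          (1 / 2 : ℝ) * ∑ k ∈ Finset.range J, (1 / 2 : ℝ) ^ (k + 1) * Real.exp (x (k + 1)) := by
      rw [Finset.sum_range_succ', Finset.mul_sum, add_comm]
      congr 1
      · ring
      · exact Finset.sum_congr rfl fun k _ => by ring
    have hc := convexOn_exp.2 (Set.mem_univ (x 0))
      (Set.mem_univ (∑ k ∈ Finset.range J, (1 / 2 : ℝ) ^ (k + 1) * x (k + 1)))
      (by norm_num : (0 : ℝ) ≤ 1 / 2) (by norm_num : (0 : ℝ) ≤ 1 / 2) (by norm_num)
    simp only [smul_eq_mul] at hc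
    have := ih fun k => x (k + 1)
    rw [e1, e2, pow_succ]
    linarith

lemma sum_dyadic (J : ℕ) : ∑ k ∈ Finset.range J, (1 / 2 : ℝ) ^ (k + 1) = 1 - (1 / 2 : ℝ) ^ J := by
  induction J with
  | zero => simp
  | succ J ih => rw [Finset.sum_range_succ, ih]; ring

lemma sum_dyadic_mul_le (J : ℕ) : ∑ k ∈ Finset.range J, (1 / 2 : ℝ) ^ (k + 1) * k ≤ 1 := by
  have : ∀ J : ℕ, ∑ k ∈ Finset.range J, (1 / 2 : ℝ) ^ (k + 1) * k = 1 - (1 / 2 : ℝ) ^ J * (J + 1)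
      := by
    intro J
    induction J with
    | zero => simp
    | succ J ih => rw [Finset.sum_range_succ, ih]; push_cast; ring
  rw [this]
  have : (0 : ℝ) ≤ (1 / 2 : ℝ) ^ J * (J + 1) := by positivity
  linarith

/-- Chaining for exponential moments of Rademacher sums indexed by a selection. -/
lemma sum_exp_norm_chaining_le (v : (ι → Bool) → ι → V) {α : ℕ → Type*} [∀ k, Fintype (α k)]
    (u : ∀ k, α k → ι → V) (a : ∀ k, (ι → Bool) → α k) {η D : ℝ}
    (h0 : ∀ ε i, ‖u 0 (a 0 ε) i‖ ≤ η)
    (hstep : ∀ k ε i, ‖u (k + 1) (a (k + 1) ε) i - u k (a k ε) i‖ ≤ η * (1 / 2) ^ (k + 1))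
    (hlim : ∀ k ε i, ‖v ε i - u k (a k ε) i‖ ≤ D * (1 / 2) ^ k)
    {H P : ℝ} (hH : 0 ≤ H) (hP : 0 ≤ P)
    (hcard : ∀ k, (Fintype.card (α k) : ℝ) ≤ Real.exp (H + P * k)) (lam : ℝ) (hlam : 0 ≤ lam) :
    ∑ ε : ι → Bool, Real.exp (lam * ‖∑ i, boolSign (ε i) • v ε i‖) ≤
      (Fintype.card (ι → Bool) : ℝ) *
        (2 * Real.exp (2 * H + 2 * P + 2 * lam ^ 2 * Fintype.card ι * η ^ 2)) := by
  set n : ℝ := ((Fintype.card ι : ℕ) : ℝ) with hn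
  -- The links of the chain; link `0` is the coarsest approximation itself.
  set w : ∀ k, (ι → Bool) → ι → V := fun k ε i => match k with
    | 0 => u 0 (a 0 ε) i
    | k + 1 => u (k + 1) (a (k + 1) ε) i - u k (a k ε) i with hw
  have hwsum : ∀ J ε i, ∑ k ∈ Finset.range (J + 1), w k ε i = u J (a J ε) i := by
    intro J ε i
    induction J with
    | zero => simp [hw]
    | succ J ih => rw [Finset.sum_range_succ, ih]; simp [hw]
  -- exponential moments of the increments
  have hmom : ∀ k, ∑ ε : ι → Bool,
      Real.exp (lam * 2 ^ (k + 1) * ‖∑ i, boolSign (ε i) • w k ε i‖) ≤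
      (Fintype.card (ι → Bool) : ℝ) *
        (2 * Real.exp (2 * (H + P * k) + 2 * lam ^ 2 * n * η ^ 2)) := by
    intro k
    have hl : 0 ≤ lam * 2 ^ (k + 1) := by positivity
    -- The multiplier `2^(k+1)` compensates the size `η 2^(-k)` of link `k`, so the quadratic
    -- exponent is the same at all levels and only the entropy grows, linearly in `k`.
    have hexp : (lam * 2 ^ (k + 1)) ^ 2 * n * (η * (1 / 2) ^ k) ^ 2 / 2
        = 2 * lam ^ 2 * n * η ^ 2 := by
      have : ((2 : ℝ) ^ k) * (1 / 2) ^ k = 1 := by rw [← mul_pow]; norm_num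
      calc _ = 2 * lam ^ 2 * n * η ^ 2 * ((2 : ℝ) ^ k * (1 / 2) ^ k) ^ 2 := by ring
        _ = _ := by rw [this]; ring
    cases k with
    | zero =>
      have := sum_exp_norm_selection_le (u 0) (η := η * (1 / 2) ^ 0) (a 0)
        (by simpa using h0) _ hl
      refine this.trans ?_
      rw [← hn, hexp]
      refine mul_le_mul_of_nonneg_left ?_ (Nat.cast_nonneg _)
      calc _ ≤ Real.exp (H + P * (0 : ℕ)) * (2 * Real.exp (2 * lam ^ 2 * n * η ^ 2)) := by
            gcongr; exact hcard 0
        _ ≤ Real.exp (2 * (H + P * (0 : ℕ))) * (2 * Real.exp (2 * lam ^ 2 * n * η ^ 2)) := by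
            gcongr
            have : 0 ≤ H + P * ((0 : ℕ) : ℝ) := by positivity
            linarith
        _ = _ := by rw [Real.exp_add]; ring
    | succ k =>
      have := sum_exp_norm_selection_le
        (fun (b : α (k + 1) × α k) i => u (k + 1) b.1 i - u k b.2 i)
        (η := η * (1 / 2) ^ (k + 1)) (fun ε => (a (k + 1) ε, a k ε)) (hstep k) _ hl
      refine this.trans ?_
      rw [← hn, hexp]
      refine mul_le_mul_of_nonneg_left ?_ (Nat.cast_nonneg _)
      rw [Fintype.card_prod, Nat.cast_mul]
      calc _ ≤ (Real.exp (H + P * (k + 1 : ℕ)) * Real.exp (H + P * (k + 1 : ℕ))) *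
            (2 * Real.exp (2 * lam ^ 2 * n * η ^ 2)) := by
            gcongr
            · exact hcard (k + 1)
            · refine (hcard k).trans ?_
              gcongr
              simp
        _ = _ := by rw [← Real.exp_add, Real.exp_add (2 * _)]; ring_nf
  set E : ℝ := 2 * Real.exp (2 * H + 2 * P + 2 * lam ^ 2 * n * η ^ 2) with hE
  -- the chained bound at a finite level
  have hlevel : ∀ J : ℕ, ∑ ε : ι → Bool, Real.exp (lam * ‖∑ i, boolSign (ε i) • v ε i‖) ≤
      Real.exp (lam * (n * (D * (1 / 2) ^ J))) * ((Fintype.card (ι → Bool) : ℝ) * E) := by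
    intro J
    -- `exp (m k)` is the moment bound of link `k`; subtracting `m k` normalises every link to mean
    -- at most one. The weights `2^(-k-1)` undo the multipliers, so Jensen's inequality applies to
    -- the sum of the links.
    set m : ℕ → ℝ := fun k => Real.log 2 + (2 * (H + P * k) + 2 * lam ^ 2 * n * η ^ 2) with hm
    have hpt : ∀ ε : ι → Bool, Real.exp (lam * ‖∑ i, boolSign (ε i) • v ε i‖) ≤
        Real.exp (lam * (n * (D * (1 / 2) ^ J))) * (E *
          (∑ k ∈ Finset.range (J + 1), (1 / 2 : ℝ) ^ (k + 1) *
            Real.exp (lam * 2 ^ (k + 1) * ‖∑ i, boolSign (ε i) • w k ε i‖ - m k)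
            + (1 / 2) ^ (J + 1))) := by
      intro ε
      have h1 : ‖∑ i, boolSign (ε i) • v ε i‖ ≤ n * (D * (1 / 2) ^ J) +
          ∑ k ∈ Finset.range (J + 1), ‖∑ i, boolSign (ε i) • w k ε i‖ := by
        have e : ∑ i, boolSign (ε i) • v ε i = ∑ i, boolSign (ε i) • (v ε i - u J (a J ε) i)
            + ∑ k ∈ Finset.range (J + 1), ∑ i, boolSign (ε i) • w k ε i := by
          rw [Finset.sum_comm, ← Finset.sum_add_distrib]
          refine Finset.sum_congr rfl fun i _ => ?_
          rw [← Finset.smul_sum, hwsum, ← smul_add, sub_add_cancel]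
        rw [e]
        refine (norm_add_le _ _).trans (add_le_add ?_ (norm_sum_le _ _))
        refine (norm_sum_le _ _).trans ?_
        calc _ ≤ ∑ _i : ι, D * (1 / 2) ^ J := by
              refine Finset.sum_le_sum fun i _ => ?_
              rw [norm_smul, Real.norm_eq_abs, abs_boolSign, one_mul]
              exact hlim J ε i
          _ = _ := by rw [Finset.sum_const, nsmul_eq_mul, Finset.card_univ]
      have h2 : lam * ‖∑ i, boolSign (ε i) • v ε i‖ ≤ lam * (n * (D * (1 / 2) ^ J)) +
          ((∑ k ∈ Finset.range (J + 1), (1 / 2 : ℝ) ^ (k + 1) * m k) +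
          ∑ k ∈ Finset.range (J + 1), (1 / 2 : ℝ) ^ (k + 1) *
            (lam * 2 ^ (k + 1) * ‖∑ i, boolSign (ε i) • w k ε i‖ - m k)) := by
        rw [← Finset.sum_add_distrib]
        have : ∀ k ∈ Finset.range (J + 1), (1 / 2 : ℝ) ^ (k + 1) * m k + (1 / 2 : ℝ) ^ (k + 1) *
            (lam * 2 ^ (k + 1) * ‖∑ i, boolSign (ε i) • w k ε i‖ - m k)
            = lam * ‖∑ i, boolSign (ε i) • w k ε i‖ := by
          intro k _
          have : ((2 : ℝ) ^ (k + 1)) * (1 / 2) ^ (k + 1) = 1 := by rw [← mul_pow]; norm_num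
          linear_combination (lam * ‖∑ i, boolSign (ε i) • w k ε i‖) * this
        rw [Finset.sum_congr rfl this, ← Finset.mul_sum, ← mul_add]
        gcongr
      have h3 : ∑ k ∈ Finset.range (J + 1), (1 / 2 : ℝ) ^ (k + 1) * m k ≤
          Real.log 2 + (2 * H + 2 * P + 2 * lam ^ 2 * n * η ^ 2) := by
        have e : ∑ k ∈ Finset.range (J + 1), (1 / 2 : ℝ) ^ (k + 1) * m k =
            (Real.log 2 + 2 * H + 2 * lam ^ 2 * n * η ^ 2) *
              ∑ k ∈ Finset.range (J + 1), (1 / 2 : ℝ) ^ (k + 1) +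
            2 * P * ∑ k ∈ Finset.range (J + 1), (1 / 2 : ℝ) ^ (k + 1) * k := by
          rw [Finset.mul_sum, Finset.mul_sum, ← Finset.sum_add_distrib]
          exact Finset.sum_congr rfl fun k _ => by simp only [hm]; ring
        rw [e, sum_dyadic]
        have hl2 : 0 ≤ Real.log 2 := Real.log_nonneg (by norm_num)
        have hn0 : 0 ≤ n := Nat.cast_nonneg _
        have i1 : (Real.log 2 + 2 * H + 2 * lam ^ 2 * n * η ^ 2) * (1 - (1 / 2 : ℝ) ^ (J + 1)) ≤
            (Real.log 2 + 2 * H + 2 * lam ^ 2 * n * η ^ 2) * 1 := by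
          gcongr
          have : (0 : ℝ) ≤ (1 / 2) ^ (J + 1) := by positivity
          linarith
        have i2 : 2 * P * ∑ k ∈ Finset.range (J + 1), (1 / 2 : ℝ) ^ (k + 1) * k ≤ 2 * P * 1 := by
          gcongr
          exact sum_dyadic_mul_le _
        linarith
      calc _ ≤ Real.exp (lam * (n * (D * (1 / 2) ^ J)) +
          ((Real.log 2 + (2 * H + 2 * P + 2 * lam ^ 2 * n * η ^ 2)) +
          ∑ k ∈ Finset.range (J + 1), (1 / 2 : ℝ) ^ (k + 1) *
            (lam * 2 ^ (k + 1) * ‖∑ i, boolSign (ε i) • w k ε i‖ - m k))) :=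
            Real.exp_le_exp.2 (by linarith)
        _ = Real.exp (lam * (n * (D * (1 / 2) ^ J))) * (E * Real.exp (
          ∑ k ∈ Finset.range (J + 1), (1 / 2 : ℝ) ^ (k + 1) *
            (lam * 2 ^ (k + 1) * ‖∑ i, boolSign (ε i) • w k ε i‖ - m k))) := by
            rw [Real.exp_add, Real.exp_add (_ + _), Real.exp_add (Real.log 2),
              Real.exp_log (by norm_num)]
        _ ≤ _ := by
            gcongr
            exact exp_sum_dyadic_le _ _
    calc _ ≤ ∑ ε : ι → Bool, Real.exp (lam * (n * (D * (1 / 2) ^ J))) * (E *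
          (∑ k ∈ Finset.range (J + 1), (1 / 2 : ℝ) ^ (k + 1) *
            Real.exp (lam * 2 ^ (k + 1) * ‖∑ i, boolSign (ε i) • w k ε i‖ - m k)
            + (1 / 2) ^ (J + 1))) := Finset.sum_le_sum fun ε _ => hpt ε
      _ = Real.exp (lam * (n * (D * (1 / 2) ^ J))) * (E *
          (∑ k ∈ Finset.range (J + 1), (1 / 2 : ℝ) ^ (k + 1) * ∑ ε : ι → Bool,
            Real.exp (lam * 2 ^ (k + 1) * ‖∑ i, boolSign (ε i) • w k ε i‖ - m k)
            + (Fintype.card (ι → Bool) : ℝ) * (1 / 2) ^ (J + 1))) := by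
          rw [← Finset.mul_sum, ← Finset.mul_sum, Finset.sum_add_distrib, Finset.sum_comm]
          simp only [Finset.mul_sum, Finset.sum_const, Finset.card_univ, nsmul_eq_mul]
      _ ≤ Real.exp (lam * (n * (D * (1 / 2) ^ J))) * (E *
          (∑ k ∈ Finset.range (J + 1), (1 / 2 : ℝ) ^ (k + 1) * (Fintype.card (ι → Bool) : ℝ)
            + (Fintype.card (ι → Bool) : ℝ) * (1 / 2) ^ (J + 1))) := by
          gcongr with k hk
          have hmk : Real.exp (m k) = 2 * Real.exp (2 * (H + P * k) + 2 * lam ^ 2 * n * η ^ 2) := by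
            simp only [hm]
            rw [Real.exp_add, Real.exp_log (by norm_num)]
          calc _ = (∑ ε : ι → Bool, Real.exp (lam * 2 ^ (k + 1) *
                ‖∑ i, boolSign (ε i) • w k ε i‖)) / Real.exp (m k) := by
                rw [Finset.sum_div]
                exact Finset.sum_congr rfl fun ε _ => Real.exp_sub _ _
            _ ≤ _ := by
                rw [div_le_iff₀ (Real.exp_pos _), hmk]
                exact hmom k
      _ = _ := by
          rw [← Finset.sum_mul, sum_dyadic]
          ring
  -- The error of stopping the chain at level `J` is the only dependence on `J`, and it disappears
  -- in the limit.
  have ht : Tendsto (fun J : ℕ => Real.exp (lam * (n * (D * (1 / 2) ^ J))) *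
      ((Fintype.card (ι → Bool) : ℝ) * E)) atTop (𝓝 (Real.exp (lam * (n * (D * 0))) *
      ((Fintype.card (ι → Bool) : ℝ) * E))) := by
    refine Tendsto.mul_const _ ((Real.continuous_exp.tendsto _).comp ?_)
    exact ((tendsto_pow_atTop_nhds_zero_of_lt_one (by norm_num) (by norm_num)).const_mul D
      |>.const_mul n).const_mul lam
  have := ge_of_tendsto' ht hlevel
  simpa using this

end Signs

end

/-! ### Norm estimates, Lipschitz bounds and homogeneity of the layers -/

noncomputable section

/-! ### Euclidean norms of truncated sequences -/

/-- The vector of the first `m` terms of a sequence. -/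
def truncVec (m : ℕ) (z : ℕ → ℝ) : EuclideanSpace ℝ (Fin m) := WithLp.toLp 2 fun k => z k

lemma norm_truncVec_sq (m : ℕ) (z : ℕ → ℝ) :
    ‖truncVec m z‖ ^ 2 = ∑ k ∈ Finset.range m, z k ^ 2 := by
  rw [EuclideanSpace.norm_sq_eq, Finset.sum_range]
  simp [truncVec]

lemma norm_truncVec (m : ℕ) (z : ℕ → ℝ) :
    ‖truncVec m z‖ = √(∑ k ∈ Finset.range m, z k ^ 2) := by
  rw [← norm_truncVec_sq, Real.sqrt_sq (norm_nonneg _)]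

lemma truncVec_sub (m : ℕ) (z z' : ℕ → ℝ) :
    truncVec m (fun k => z k - z' k) = truncVec m z - truncVec m z' := rfl

lemma truncVec_add (m : ℕ) (z z' : ℕ → ℝ) :
    truncVec m (fun k => z k + z' k) = truncVec m z + truncVec m z' := rfl

lemma truncVec_smul (m : ℕ) (c : ℝ) (z : ℕ → ℝ) :
    truncVec m (fun k => c * z k) = c • truncVec m z := rfl

lemma norm_truncVec_le_of_abs_le {m : ℕ} {z z' : ℕ → ℝ} (h : ∀ k < m, |z k| ≤ |z' k|) :
    ‖truncVec m z‖ ≤ ‖truncVec m z'‖ := by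
  rw [norm_truncVec, norm_truncVec]
  refine Real.sqrt_le_sqrt (Finset.sum_le_sum fun k hk => ?_)
  exact sq_le_sq.2 (h k (Finset.mem_range.1 hk))

lemma abs_sum_mul_le (m : ℕ) (w z : ℕ → ℝ) :
    |∑ k ∈ Finset.range m, w k * z k| ≤ ‖truncVec m w‖ * ‖truncVec m z‖ := by
  rw [norm_truncVec, norm_truncVec, ← Real.sqrt_mul (Finset.sum_nonneg fun _ _ => sq_nonneg _),
    ← Real.sqrt_sq_eq_abs]
  exact Real.sqrt_le_sqrt (Finset.sum_mul_sq_le_sq_mul_sq _ _ _)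

lemma norm_truncVec_le_sum_abs (m : ℕ) (z : ℕ → ℝ) :
    ‖truncVec m z‖ ≤ ∑ k ∈ Finset.range m, |z k| := by
  have h0 : 0 ≤ ∑ k ∈ Finset.range m, |z k| := Finset.sum_nonneg fun _ _ => abs_nonneg _
  rw [norm_truncVec, Real.sqrt_le_left h0]
  have : ∀ k ∈ Finset.range m, z k ^ 2 = |z k| ^ 2 := fun k _ => (sq_abs _).symm
  rw [Finset.sum_congr rfl this]
  exact Finset.sum_sq_le_sq_sum_of_nonneg fun _ _ => abs_nonneg _

/-! ### Overlapping windows -/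

/-- The overlap factor of windows of length `s` chosen one per block of length `s`. -/
def overlapFactor (s : ℕ) : ℝ := if s ≤ 1 then 1 else if s = 2 then 3 / 2 else 2

lemma overlapFactor_pos (s : ℕ) : 0 < overlapFactor s := by
  unfold overlapFactor; split_ifs <;> norm_num

lemma one_le_overlapFactor (s : ℕ) : 1 ≤ overlapFactor s := by
  unfold overlapFactor; split_ifs <;> norm_num

lemma sum_range_mul_blocks (K s : ℕ) (f : ℕ → ℝ) :
    ∑ k ∈ Finset.range K, ∑ r ∈ Finset.range s, f (k * s + r)
      = ∑ r ∈ Finset.range (K * s), f r := by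
  induction K with
  | zero => simp
  | succ K ih => rw [Finset.sum_range_succ, ih, Nat.succ_mul, Finset.sum_range_add]

/-- The window that starts in block `k` is contained in blocks `k` and `k + 1`, so after
Cauchy–Schwarz every block is counted at most twice. -/
lemma sum_window_sq_le (w z : ℕ → ℝ) (s : ℕ) (K : ℕ) (j : ℕ → ℕ) (hj : ∀ k < K, j k < s) :
    ∑ k ∈ Finset.range K, (∑ q ∈ Finset.range s, w q * z (k * s + j k + q)) ^ 2 ≤
      2 * (∑ q ∈ Finset.range s, w q ^ 2) * ∑ r ∈ Finset.range (K * s + s), z r ^ 2 := by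
  set W := ∑ q ∈ Finset.range s, w q ^ 2 with hW
  have hW0 : 0 ≤ W := Finset.sum_nonneg fun _ _ => sq_nonneg _
  have h1 : ∀ k ∈ Finset.range K, (∑ q ∈ Finset.range s, w q * z (k * s + j k + q)) ^ 2 ≤
      W * (∑ r ∈ Finset.range s, z (k * s + r) ^ 2 +
        ∑ r ∈ Finset.range s, z ((k + 1) * s + r) ^ 2) := by
    intro k hk
    refine (Finset.sum_mul_sq_le_sq_mul_sq _ _ _).trans ?_
    refine mul_le_mul_of_nonneg_left ?_ hW0
    have e : ∑ r ∈ Finset.range s, z (k * s + r) ^ 2 +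
        ∑ r ∈ Finset.range s, z ((k + 1) * s + r) ^ 2
        = ∑ r ∈ Finset.range (s + s), z (k * s + r) ^ 2 := by
      rw [Finset.sum_range_add]
      congr 1
      refine Finset.sum_congr rfl fun r _ => ?_
      congr 2; ring
    have hjk := hj k (Finset.mem_range.1 hk)
    have e2 : ∑ q ∈ Finset.range s, z (k * s + j k + q) ^ 2 =
        ∑ r ∈ (Finset.range s).map (addLeftEmbedding (j k)), z (k * s + r) ^ 2 := by
      rw [Finset.sum_map]
      simp [addLeftEmbedding, add_assoc]
    rw [e, e2]
    refine Finset.sum_le_sum_of_subset_of_nonneg ?_ fun _ _ _ => sq_nonneg _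
    intro r hr
    simp only [Finset.mem_map, Finset.mem_range, addLeftEmbedding_apply] at hr ⊢
    obtain ⟨q, hq, rfl⟩ := hr
    omega
  refine (Finset.sum_le_sum h1).trans ?_
  rw [← Finset.mul_sum, Finset.sum_add_distrib]
  have h2 : ∑ k ∈ Finset.range K, ∑ r ∈ Finset.range s, z (k * s + r) ^ 2 ≤
      ∑ r ∈ Finset.range (K * s + s), z r ^ 2 := by
    rw [sum_range_mul_blocks K s fun r => z r ^ 2]
    exact Finset.sum_le_sum_of_subset_of_nonneg
      (Finset.range_subset_range.2 (Nat.le_add_right _ _)) fun _ _ _ => sq_nonneg _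
  have h3 : ∑ k ∈ Finset.range K, ∑ r ∈ Finset.range s, z ((k + 1) * s + r) ^ 2 ≤
      ∑ r ∈ Finset.range (K * s + s), z r ^ 2 := by
    have := sum_range_mul_blocks (K + 1) s fun r => z r ^ 2
    rw [Nat.succ_mul, Finset.sum_range_succ'] at this
    rw [← this]
    have : 0 ≤ ∑ r ∈ Finset.range s, z (0 * s + r) ^ 2 := Finset.sum_nonneg fun _ _ => sq_nonneg _
    linarith
  nlinarith

/-- Weighted Cauchy–Schwarz `(a x + b y)² ≤ α x² + β y²` under `a²/α + b²/β = 1`, with `β = 3W/2`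
and `α` determined by it. In a window of length two, `y` is the odd entry, which no other window
uses, so it may carry the larger weight. `weights_sum_le` then bounds the two weights that meet at
an even entry. -/
lemma add_sq_le_weighted {a b W : ℝ} (hW : W = a ^ 2 + b ^ 2) (hpos : 0 < W) (x y : ℝ) :
    (a * x + b * y) ^ 2 ≤ 3 * a ^ 2 * W / (W + 2 * a ^ 2) * x ^ 2 + 3 / 2 * W * y ^ 2 := by
  have hd : 0 < W + 2 * a ^ 2 := by positivity
  have e : 3 * a ^ 2 * W / (W + 2 * a ^ 2) * x ^ 2 + 3 / 2 * W * y ^ 2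
      = (3 * a ^ 2 * W * x ^ 2 + 3 / 2 * W * y ^ 2 * (W + 2 * a ^ 2)) / (W + 2 * a ^ 2) := by
    field_simp
  rw [e, le_div_iff₀ hd]
  have key : 3 * a ^ 2 * W * x ^ 2 + 3 / 2 * W * y ^ 2 * (W + 2 * a ^ 2)
      - (a * x + b * y) ^ 2 * (W + 2 * a ^ 2)
      = 1 / 2 * (2 * a * b * x - (3 * a ^ 2 + b ^ 2) * y) ^ 2 := by
    rw [hW]; ring
  have := sq_nonneg (2 * a * b * x - (3 * a ^ 2 + b ^ 2) * y)
  linarith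

lemma weights_sum_le {a b W : ℝ} (hW : W = a ^ 2 + b ^ 2) (hpos : 0 < W) :
    3 * a ^ 2 * W / (W + 2 * a ^ 2) + 3 * b ^ 2 * W / (W + 2 * b ^ 2) ≤ 3 / 2 * W := by
  have h1 : 0 < W + 2 * a ^ 2 := by positivity
  have h2 : 0 < W + 2 * b ^ 2 := by positivity
  rw [div_add_div _ _ h1.ne' h2.ne', div_le_iff₀ (mul_pos h1 h2)]
  have : 3 / 2 * W * ((W + 2 * a ^ 2) * (W + 2 * b ^ 2)) -
      (3 * a ^ 2 * W * (W + 2 * b ^ 2) + (W + 2 * a ^ 2) * (3 * b ^ 2 * W))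
      = 3 / 2 * W * (a ^ 2 - b ^ 2) ^ 2 := by
    rw [hW]; ring
  have : 0 ≤ 3 / 2 * W * (a ^ 2 - b ^ 2) ^ 2 := by positivity
  linarith

lemma sum_window_two_sq_le (w z : ℕ → ℝ) (K : ℕ) (j : ℕ → ℕ) (hj : ∀ k < K, j k < 2) :
    ∑ k ∈ Finset.range K, (∑ q ∈ Finset.range 2, w q * z (k * 2 + j k + q)) ^ 2 ≤
      3 / 2 * (∑ q ∈ Finset.range 2, w q ^ 2) * ∑ r ∈ Finset.range (K * 2 + 2), z r ^ 2 := by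
  set W := ∑ q ∈ Finset.range 2, w q ^ 2 with hW
  have hW' : W = w 0 ^ 2 + w 1 ^ 2 := by rw [hW]; simp [Finset.sum_range_succ]
  have hW'' : W = w 1 ^ 2 + w 0 ^ 2 := by rw [hW', add_comm]
  have hW0 : 0 ≤ W := by rw [hW']; positivity
  rcases hW0.eq_or_lt with h0 | hpos
  · have h00 : w 0 = 0 := by nlinarith [sq_nonneg (w 0), sq_nonneg (w 1)]
    have h11 : w 1 = 0 := by nlinarith [sq_nonneg (w 0), sq_nonneg (w 1)]
    simp [Finset.sum_range_succ, h00, h11, ← h0]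
  set A := 3 * w 0 ^ 2 * W / (W + 2 * w 0 ^ 2) with hA
  set C := 3 * w 1 ^ 2 * W / (W + 2 * w 1 ^ 2) with hC
  have hA0 : 0 ≤ A := by positivity
  have hC0 : 0 ≤ C := by positivity
  have hAC : A + C ≤ 3 / 2 * W := weights_sum_le hW' hpos
  have h1 : ∀ k ∈ Finset.range K, (∑ q ∈ Finset.range 2, w q * z (k * 2 + j k + q)) ^ 2 ≤
      A * z (k * 2) ^ 2 + 3 / 2 * W * z (k * 2 + 1) ^ 2 + C * z (k * 2 + 2) ^ 2 := by
    intro k hk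
    have hjk := hj k (Finset.mem_range.1 hk)
    simp only [Finset.sum_range_succ, Finset.sum_range_zero, zero_add, add_zero]
    interval_cases hjj : j k
    · have := add_sq_le_weighted hW' hpos (z (k * 2)) (z (k * 2 + 1))
      have h' : 0 ≤ C * z (k * 2 + 2) ^ 2 := by positivity
      simp only [add_zero]
      linarith
    · have := add_sq_le_weighted hW'' hpos (z (k * 2 + 2)) (z (k * 2 + 1))
      have h' : 0 ≤ A * z (k * 2) ^ 2 := by positivity
      have e : w 0 * z (k * 2 + 1) + w 1 * z (k * 2 + 1 + 1)
        = w 1 * z (k * 2 + 2) + w 0 * z (k * 2 + 1) := by ring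
      rw [e]
      linarith
  refine (Finset.sum_le_sum h1).trans ?_
  clear h1 hj
  have hz : ∀ r, 0 ≤ z r ^ 2 := fun r => sq_nonneg _
  -- The extra `A * z (K * 2) ^ 2` reserves the share of the next window in the even entry common to
  -- both, which closes the induction.
  have main : ∀ K : ℕ, ∑ k ∈ Finset.range K,
      (A * z (k * 2) ^ 2 + 3 / 2 * W * z (k * 2 + 1) ^ 2 + C * z (k * 2 + 2) ^ 2)
      + A * z (K * 2) ^ 2 ≤ 3 / 2 * W * ∑ r ∈ Finset.range (K * 2 + 1), z r ^ 2 := by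
    intro K
    induction K with
    | zero => simp; nlinarith [hz 0]
    | succ K ih =>
      rw [Finset.sum_range_succ]
      have e : (K + 1) * 2 + 1 = (K * 2 + 1) + 1 + 1 := by ring
      rw [e, Finset.sum_range_succ, Finset.sum_range_succ _ (K * 2 + 1)]
      have e' : (K + 1) * 2 = K * 2 + 2 := by ring
      have e'' : K * 2 + 1 + 1 = K * 2 + 2 := by ring
      rw [e', e'']
      nlinarith [mul_le_mul_of_nonneg_right hAC (hz (K * 2 + 2))]
  have := main K
  rw [Finset.sum_range_succ _ (K * 2 + 1)]
  nlinarith [hz (K * 2), hz (K * 2 + 1), mul_nonneg hA0 (hz (K * 2)),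
    mul_nonneg hpos.le (hz (K * 2 + 1))]

lemma sum_window_sq_le_overlapFactor (w z : ℕ → ℝ) (s : ℕ) (hs : 0 < s) (K : ℕ) (j : ℕ → ℕ)
    (hj : ∀ k < K, j k < s) :
    ∑ k ∈ Finset.range K, (∑ q ∈ Finset.range s, w q * z (k * s + j k + q)) ^ 2 ≤
      overlapFactor s * (∑ q ∈ Finset.range s, w q ^ 2) *
        ∑ r ∈ Finset.range (K * s + s), z r ^ 2 := by
  unfold overlapFactor
  split_ifs with h1 h2
  · obtain rfl : s = 1 := by omega
    have : ∀ k ∈ Finset.range K, (∑ q ∈ Finset.range 1, w q * z (k * 1 + j k + q)) ^ 2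
        = w 0 ^ 2 * z k ^ 2 := by
      intro k hk
      have : j k = 0 := by have := hj k (Finset.mem_range.1 hk); omega
      simp [this, mul_pow]
    rw [Finset.sum_congr rfl this, ← Finset.mul_sum]
    simp only [Finset.sum_range_one, one_mul, mul_one]
    refine mul_le_mul_of_nonneg_left ?_ (sq_nonneg _)
    exact Finset.sum_le_sum_of_subset_of_nonneg
      (Finset.range_subset_range.2 (Nat.le_succ _)) fun _ _ _ => sq_nonneg _
  · subst h2
    exact sum_window_two_sq_le w z K j hj
  · exact sum_window_sq_le w z s K j hj

namespace NetShape

/-! ### Pooling and the rectifier -/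

lemma abs_relu_sub_le (a b : ℝ) : |relu a - relu b| ≤ |a - b| := by
  simpa [relu] using abs_max_sub_max_le_abs a b 0

lemma relu_mul {c : ℝ} (hc : 0 ≤ c) (a : ℝ) : relu (c * a) = c * relu a := by
  simp [relu, mul_max_of_nonneg _ _ hc]

lemma continuous_relu : Continuous relu := continuous_id.max continuous_const

lemma abs_pool_sub_le (P : Pooling) (s : ℕ) (y y' : ℕ → ℝ) {M : ℝ} (hM : 0 ≤ M)
    (h : ∀ j < s, |y j - y' j| ≤ M) : |pool P s y - pool P s y'| ≤ M := by
  cases P with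
  | average =>
    simp only [pool]
    rcases Nat.eq_zero_or_pos s with rfl | hs
    · simpa
    have hs' : (0 : ℝ) < s := Nat.cast_pos.2 hs
    rw [← sub_div, ← Finset.sum_sub_distrib, abs_div, abs_of_pos hs', div_le_iff₀ hs']
    refine (Finset.abs_sum_le_sum_abs _ _).trans ?_
    calc _ ≤ ∑ _j ∈ Finset.range s, M := Finset.sum_le_sum fun j hj => h j (Finset.mem_range.1 hj)
      _ = M * s := by simp [mul_comm]
  | max =>
    simp only [pool]
    rcases Nat.eq_zero_or_pos s with rfl | hs
    · simpa
    have : Nonempty (Fin s) := ⟨⟨0, hs⟩⟩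
    have key : ∀ f g : ℕ → ℝ, (∀ j < s, |f j - g j| ≤ M) →
        (⨆ j : Fin s, f j) ≤ (⨆ j : Fin s, g j) + M := by
      intro f g hfg
      refine ciSup_le fun j => ?_
      have h1 := (abs_le.1 (hfg j j.2)).2
      have h2 : g j ≤ ⨆ j : Fin s, g j :=
        le_ciSup (f := fun j : Fin s => g j) (Set.finite_range _).bddAbove j
      linarith
    rw [abs_le]
    have h1 := key y y' h
    have h2 := key y' y fun j hj => by rw [abs_sub_comm]; exact h j hj
    constructor <;> linarith

/-- Pooling is 1-Lipschitz for the sup norm, so one entry per block controls the change of the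
pooled value. This gives one window per block, as required by `sum_window_sq_le_overlapFactor`. -/
lemma exists_abs_pool_sub_le (P : Pooling) {s : ℕ} (hs : 0 < s) (y y' : ℕ → ℝ) :
    ∃ j < s, |pool P s y - pool P s y'| ≤ |y j - y' j| := by
  obtain ⟨j, hj, hmax⟩ := Finset.exists_max_image (Finset.range s) (fun j => |y j - y' j|)
    ⟨0, Finset.mem_range.2 hs⟩
  exact ⟨j, Finset.mem_range.1 hj, abs_pool_sub_le P s y y' (abs_nonneg _)
    fun i hi => hmax i (Finset.mem_range.2 hi)⟩

lemma pool_mul (P : Pooling) (s : ℕ) {c : ℝ} (hc : 0 ≤ c) (y : ℕ → ℝ) :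
    pool P s (fun j => c * y j) = c * pool P s y := by
  cases P with
  | average => simp only [pool, ← Finset.mul_sum, mul_div_assoc]
  | max => simp only [pool, Real.mul_iSup_of_nonneg hc]

lemma pool_zero (P : Pooling) (s : ℕ) : pool P s (fun _ => 0) = 0 := by
  have := pool_mul P s le_rfl (fun _ => 0)
  simpa using this

lemma continuous_pool {X : Type*} [TopologicalSpace X] (P : Pooling) (s : ℕ) {y : X → ℕ → ℝ}
    (hy : ∀ j, Continuous fun x => y x j) : Continuous fun x => pool P s (y x) := by
  cases P with
  | average =>
    simp only [pool]
    exact (continuous_finsetSum _ fun j _ => hy j).div_const _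
  | max =>
    simp only [pool]
    rcases Nat.eq_zero_or_pos s with rfl | hs
    · simpa using continuous_const
    have : Nonempty (Fin s) := ⟨⟨0, hs⟩⟩
    simp only [← Finset.sup'_univ_eq_ciSup]
    exact Continuous.finset_sup'_apply _ fun j _ => hy j

/-! ### One convolutional layer -/

/-- Convolution, rectifier and pooling as an operation on sequences. -/
def convStep (P : Pooling) (s K : ℕ) (w z : ℕ → ℝ) (k : ℕ) : ℝ :=
  if k < K then pool P s (fun j => relu (∑ q ∈ Finset.range s, w q * z (k * s + j + q))) else 0

/-- After one window per block is selected, the difference is bilinear: `w z - w' z' = w (z - z') +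
(w - w') z'`, and the window estimate applies to both terms. -/
lemma norm_convStep_sub_le (P : Pooling) {s K m : ℕ} (hs : 0 < s) (hm : K * s + s ≤ m + 1)
    (w w' z z' : ℕ → ℝ) (hz : ∀ k ≥ m, z k = 0) (hz' : ∀ k ≥ m, z' k = 0) :
    ‖truncVec K (convStep P s K w z) - truncVec K (convStep P s K w' z')‖ ≤
      √(overlapFactor s) * (‖truncVec s w‖ * ‖truncVec m z - truncVec m z'‖
        + ‖truncVec s w - truncVec s w'‖ * ‖truncVec m z'‖) := by
  choose j hj hle using fun k => exists_abs_pool_sub_le P hs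
    (fun j => relu (∑ q ∈ Finset.range s, w q * z (k * s + j + q)))
    (fun j => relu (∑ q ∈ Finset.range s, w' q * z' (k * s + j + q)))
  have bound : ∀ w z : ℕ → ℝ, (∀ k ≥ m, z k = 0) →
      ‖truncVec K fun k => ∑ q ∈ Finset.range s, w q * z (k * s + j k + q)‖ ≤
        √(overlapFactor s) * (‖truncVec s w‖ * ‖truncVec m z‖) := by
    intro w z hz
    have h := sum_window_sq_le_overlapFactor w z s hs K j fun k _ => hj k
    -- The left range may contain the index `m`, one past the end of the signal, where `z` vanishes.
    have e : ∑ r ∈ Finset.range (K * s + s), z r ^ 2 ≤ ∑ r ∈ Finset.range m, z r ^ 2 := by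
      refine (Finset.sum_le_sum_of_subset_of_nonneg (Finset.range_subset_range.2 hm)
        fun _ _ _ => sq_nonneg _).trans ?_
      rw [Finset.sum_range_succ, hz m le_rfl]
      simp
    rw [norm_truncVec, norm_truncVec, norm_truncVec,
      ← Real.sqrt_mul (Finset.sum_nonneg fun _ _ => sq_nonneg _),
      ← Real.sqrt_mul (overlapFactor_pos s).le, ← mul_assoc]
    refine Real.sqrt_le_sqrt (h.trans ?_)
    have := overlapFactor_pos s
    gcongr
  set a : ℕ → ℝ := fun k => ∑ q ∈ Finset.range s, w q * (z (k * s + j k + q) - z' (k * s + j k + q))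
  set b : ℕ → ℝ := fun k => ∑ q ∈ Finset.range s, (w q - w' q) * z' (k * s + j k + q)
  have h1 : ‖truncVec K (convStep P s K w z) - truncVec K (convStep P s K w' z')‖ ≤
      ‖truncVec K fun k => a k + b k‖ := by
    rw [← truncVec_sub]
    refine norm_truncVec_le_of_abs_le fun k hk => ?_
    simp only [convStep, if_pos hk]
    refine (hle k).trans ((abs_relu_sub_le _ _).trans (le_of_eq ?_))
    congr 1
    simp only [a, b]
    rw [← Finset.sum_sub_distrib, ← Finset.sum_add_distrib]
    exact Finset.sum_congr rfl fun q _ => by ring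
  have h2 := bound w (fun k => z k - z' k) fun k hk => by simp [hz k hk, hz' k hk]
  have h3 := bound (fun q => w q - w' q) z' hz'
  rw [truncVec_sub] at h2 h3
  calc _ ≤ _ := h1
    _ ≤ ‖truncVec K a‖ + ‖truncVec K b‖ := by rw [truncVec_add]; exact norm_add_le _ _
    _ ≤ _ := by rw [mul_add]; exact add_le_add h2 h3

lemma norm_convStep_le (P : Pooling) {s K m : ℕ} (hs : 0 < s) (hm : K * s + s ≤ m + 1)
    (w z : ℕ → ℝ) (hz : ∀ k ≥ m, z k = 0) :
    ‖truncVec K (convStep P s K w z)‖ ≤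
      √(overlapFactor s) * (‖truncVec s w‖ * ‖truncVec m z‖) := by
  have h := norm_convStep_sub_le P hs hm w (fun _ => 0) z (fun _ => 0) hz fun _ _ => rfl
  have e : ∀ m, truncVec m (fun _ => 0) = 0 := fun m => rfl
  have e2 : truncVec K (convStep P s K (fun _ => 0) fun _ => 0) = 0 := by
    have : convStep P s K (fun _ => 0) (fun _ => 0) = fun _ => 0 := by
      funext k
      have := pool_zero P s
      simp [convStep, relu, this]
    rw [this, e]
  simpa [e, e2] using h

/-! ### Signals -/

variable (N : NetShape)

lemma signal_conv (θ : N.Params) (x : N.Input) {l : ℕ} (hl : l < N.numConv) :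
    N.signal θ x (l + 1) = convStep (N.pooling l) (N.kernel l) (N.width (l + 1))
      (N.coef θ l) (N.signal θ x l) := by
  funext k
  simp [signal, convStep, hl, conv]

lemma signal_fullyConn (θ : N.Params) (x : N.Input) {l : ℕ} (hl : N.numConv ≤ l) {k : ℕ}
    (hk : k < N.width (l + 1)) :
    N.signal θ x (l + 1) k = relu (∑ j ∈ Finset.range (N.width l),
      N.coef θ l (j + N.width l * k) * N.signal θ x l j) := by
  simp [signal, hk, not_lt.2 hl, fullyConn]

lemma signal_eq_zero (θ : N.Params) (x : N.Input) (l : ℕ) {k : ℕ} (hk : N.width l ≤ k) :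
    N.signal θ x l k = 0 := by
  cases l with
  | zero => simp [signal, inputDim, not_lt.2 hk]
  | succ l => simp [signal, not_lt.2 hk]

/-- The signal as a vector. -/
def signalVec (θ : N.Params) (x : N.Input) (l : ℕ) : EuclideanSpace ℝ (Fin (N.width l)) :=
  truncVec (N.width l) (N.signal θ x l)

/-- The vector of the parameters of layer `l`. -/
def layerVec (θ : N.Params) (l : ℕ) : EuclideanSpace ℝ (Fin (N.paramCount l)) :=
  truncVec (N.paramCount l) (N.coef θ l)

lemma norm_signalVec_zero (θ : N.Params) (x : N.Input) : ‖N.signalVec θ x 0‖ = ‖x‖ := by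
  rw [signalVec, norm_truncVec, EuclideanSpace.norm_eq, Finset.sum_range]
  congr 1
  refine Finset.sum_congr rfl fun k _ => ?_
  have : (k : ℕ) < N.inputDim := k.2
  simp [signal, this]
  rfl

lemma paramCount_conv {l : ℕ} (hl : l < N.numConv) : N.paramCount l = N.kernel l := by
  simp [paramCount, hl]

lemma paramCount_fullyConn {l : ℕ} (hl : N.numConv ≤ l) (hl' : l < N.depth) :
    N.paramCount l = N.width l * N.width (l + 1) := by
  simp [paramCount, not_lt.2 hl, hl']

lemma paramCount_depth : N.paramCount N.depth = N.outWidth := by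
  simp [paramCount, depth]

lemma norm_layerVec_conv (θ : N.Params) {l : ℕ} (hl : l < N.numConv) :
    ‖N.layerVec θ l‖ = ‖truncVec (N.kernel l) (N.coef θ l)‖ := by
  rw [layerVec, norm_truncVec, norm_truncVec, N.paramCount_conv hl]

lemma continuous_coef (l i : ℕ) : Continuous fun θ : N.Params => N.coef θ l i := by
  unfold coef
  by_cases h : l < N.depth + 1 ∧ i < N.paramCount l
  · simp only [dif_pos h]
    exact EuclideanSpace.proj (𝕜 := ℝ) _ |>.continuous
  · simp only [dif_neg h]
    exact continuous_const

lemma continuous_signal (l k : ℕ) :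
    Continuous fun q : N.Input × N.Params => N.signal q.2 q.1 l k := by
  induction l generalizing k with
  | zero =>
    simp only [signal]
    split_ifs with h
    · exact (EuclideanSpace.proj (𝕜 := ℝ) (⟨k, h⟩ : Fin N.inputDim)).continuous.comp continuous_fst
    · exact continuous_const
  | succ l ih =>
    simp only [signal]
    split_ifs
    · refine continuous_pool _ _ fun j => continuous_relu.comp ?_
      exact continuous_finsetSum _ fun i _ =>
        ((N.continuous_coef _ _).comp continuous_snd).mul (ih _)
    · refine continuous_relu.comp ?_
      exact continuous_finsetSum _ fun i _ =>
        ((N.continuous_coef _ _).comp continuous_snd).mul (ih _)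
    · exact continuous_const

lemma continuous_eval (p : ℝ) : Continuous fun q : N.Input × N.Params => N.eval p q.1 q.2 := by
  unfold eval
  exact continuous_const.mul (continuous_finsetSum _ fun i _ =>
    ((N.continuous_coef _ _).comp continuous_snd).mul (N.continuous_signal _ _))

/-! ### Homogeneity -/

/-- ReLU and both poolings commute with nonnegative factors. This serves three purposes: scaling all
layers to the unit ball, normalising kernels of length one, and Euler's identity. -/
lemma signal_of_coef_eq_mul {θ θ' : N.Params} (c : ℕ → ℝ) (hc : ∀ l, 0 ≤ c l)
    (h : ∀ l i, N.coef θ' l i = c l * N.coef θ l i) (x : N.Input) (l k : ℕ) :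
    N.signal θ' x l k = (∏ j ∈ Finset.range l, c j) * N.signal θ x l k := by
  induction l generalizing k with
  | zero => simp [signal]
  | succ l ih =>
    have h0 : 0 ≤ ∏ j ∈ Finset.range (l + 1), c j := Finset.prod_nonneg fun j _ => hc j
    have hsum : ∀ (m : ℕ) (f g : ℕ → ℕ), ∑ j ∈ Finset.range m, N.coef θ' l (f j) *
        N.signal θ' x l (g j) = (∏ j ∈ Finset.range (l + 1), c j) *
        ∑ j ∈ Finset.range m, N.coef θ l (f j) * N.signal θ x l (g j) := by
      intro m f g
      rw [Finset.mul_sum, Finset.prod_range_succ]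
      exact Finset.sum_congr rfl fun j _ => by rw [h, ih]; ring
    simp only [signal]
    split_ifs
    · rw [← pool_mul _ _ h0]
      congr 1
      funext j
      simp only [conv]
      rw [← relu_mul h0]
      congr 1
      exact hsum _ _ _
    · simp only [fullyConn]
      rw [← relu_mul h0]
      congr 1
      exact hsum _ _ fun j => j
    · simp

lemma eval_of_coef_eq_mul {θ θ' : N.Params} (c : ℕ → ℝ) (hc : ∀ l, 0 ≤ c l)
    (h : ∀ l i, N.coef θ' l i = c l * N.coef θ l i) (p : ℝ) (x : N.Input) :
    N.eval p x θ' = (∏ j ∈ Finset.range (N.depth + 1), c j) * N.eval p x θ := by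
  simp only [eval]
  rw [mul_left_comm]
  congr 1
  rw [Finset.mul_sum, Finset.prod_range_succ]
  refine Finset.sum_congr rfl fun k _ => ?_
  rw [h, N.signal_of_coef_eq_mul c hc h]
  ring

/-- The parameters with prescribed entries. -/
def ofCoef (W : ℕ → ℕ → ℝ) : N.Params := WithLp.toLp 2 fun i => W i.1 i.2

lemma coef_ofCoef (W : ℕ → ℕ → ℝ) (l i : ℕ) :
    N.coef (N.ofCoef W) l i = if l < N.depth + 1 ∧ i < N.paramCount l then W l i else 0 := by
  unfold coef ofCoef
  split_ifs <;> rfl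

lemma coef_eq_zero (θ : N.Params) {l i : ℕ} (h : ¬(l < N.depth + 1 ∧ i < N.paramCount l)) :
    N.coef θ l i = 0 := by
  simp only [coef, dif_neg h]

lemma coef_ofCoef_mul (θ : N.Params) (c : ℕ → ℝ) (l i : ℕ) :
    N.coef (N.ofCoef fun l i => c l * N.coef θ l i) l i = c l * N.coef θ l i := by
  rw [coef_ofCoef]
  split_ifs with h
  · rfl
  · rw [N.coef_eq_zero θ h, mul_zero]

end NetShape

end

/-! ### Nets of kernels and exponential moments of the hidden signals -/

noncomputable section

/-! ### Dyadic truncation -/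

/-- Truncation of `x` towards zero to a multiple of `2⁻ᵏ`. -/
def dyadicTrunc (k : ℕ) (x : ℝ) : ℝ := boolSign (decide (0 ≤ x)) * (⌊|x| * 2 ^ k⌋₊ / 2 ^ k)

/-- Rounding towards zero keeps the rounded kernels in the unit ball, where the gain bounds hold. -/
lemma abs_dyadicTrunc_le (k : ℕ) (x : ℝ) : |dyadicTrunc k x| ≤ |x| := by
  have h2 : (0 : ℝ) < 2 ^ k := by positivity
  rw [dyadicTrunc, abs_mul, abs_boolSign, one_mul, abs_of_nonneg (by positivity),
    div_le_iff₀ h2]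
  exact Nat.floor_le (by positivity)

lemma abs_sub_dyadicTrunc_le (k : ℕ) (x : ℝ) : |x - dyadicTrunc k x| ≤ (1 / 2) ^ k := by
  have h2 : (0 : ℝ) < 2 ^ k := by positivity
  have hx : x = boolSign (decide (0 ≤ x)) * |x| := by
    by_cases h : 0 ≤ x
    · simp [h, abs_of_nonneg h]
    · simp [h, abs_of_neg (not_le.1 h)]
  have e : x - dyadicTrunc k x = boolSign (decide (0 ≤ x)) * (|x| - ⌊|x| * 2 ^ k⌋₊ / 2 ^ k) := by
    rw [mul_sub, ← hx, dyadicTrunc]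
  have h1 : (⌊|x| * 2 ^ k⌋₊ : ℝ) / 2 ^ k ≤ |x| := by
    rw [div_le_iff₀ h2]; exact Nat.floor_le (by positivity)
  rw [e, abs_mul, abs_boolSign, one_mul, abs_of_nonneg (sub_nonneg.2 h1), one_div, inv_pow,
    sub_le_iff_le_add, ← one_div, ← add_div, le_div_iff₀ h2, add_comm]
  exact (Nat.lt_floor_add_one _).le

namespace NetShape

variable (N : NetShape)

/-! ### Lipschitz dependence of the convolutional part on the kernels -/

/-- The square of the norm gain of the first `l` convolutional layers. -/
def convGain (l : ℕ) : ℝ := ∏ i ∈ Finset.range l, overlapFactor (N.kernel i)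

lemma convGain_pos (l : ℕ) : 0 < N.convGain l := Finset.prod_pos fun _ _ => overlapFactor_pos _

lemma one_le_convGain (l : ℕ) : 1 ≤ N.convGain l :=
  Finset.one_le_prod fun _ _ => one_le_overlapFactor _

lemma norm_signalVec_conv_le {θ : N.Params} (hθ : ∀ l < N.numConv, ‖N.layerVec θ l‖ ≤ 1)
    {x : N.Input} (hx : ‖x‖ ≤ 1) {l : ℕ} (hl : l ≤ N.numConv) :
    ‖N.signalVec θ x l‖ ≤ √(N.convGain l) := by
  induction l with
  | zero => simpa [convGain, norm_signalVec_zero] using hx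
  | succ l ih =>
    have hl' : l < N.numConv := hl
    rw [signalVec, N.signal_conv θ x hl', convGain, Finset.prod_range_succ, mul_comm,
      Real.sqrt_mul (overlapFactor_pos _).le]
    refine (norm_convStep_le _ (N.kernel_pos l hl') (N.window_le l hl') _ _
      fun k hk => N.signal_eq_zero θ x l hk).trans ?_
    gcongr
    have h1 := hθ l hl'
    rw [N.norm_layerVec_conv θ hl'] at h1
    have h2 := ih hl'.le
    rw [signalVec] at h2
    calc _ ≤ 1 * √(N.convGain l) := mul_le_mul h1 h2 (norm_nonneg _) zero_le_one
      _ = _ := one_mul _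

/-- A perturbation of one kernel passes through the remaining layers, whose kernels have norm at
most one, so only their overlap factors multiply it; the perturbations add up over the layers. -/
lemma norm_signalVec_conv_sub_le {θ θ' : N.Params} (hθ : ∀ l < N.numConv, ‖N.layerVec θ l‖ ≤ 1)
    (hθ' : ∀ l < N.numConv, ‖N.layerVec θ' l‖ ≤ 1) {x : N.Input} (hx : ‖x‖ ≤ 1) {l : ℕ}
    (hl : l ≤ N.numConv) :
    ‖N.signalVec θ x l - N.signalVec θ' x l‖ ≤
      √(N.convGain l) * ∑ i ∈ Finset.range l,
        ‖truncVec (N.kernel i) (N.coef θ i) - truncVec (N.kernel i) (N.coef θ' i)‖ := by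
  induction l with
  | zero =>
    have : N.signalVec θ x 0 - N.signalVec θ' x 0 = 0 := sub_self _
    simp [this]
  | succ l ih =>
    have hl' : l < N.numConv := hl
    rw [signalVec, signalVec, N.signal_conv θ x hl', N.signal_conv θ' x hl', convGain,
      Finset.prod_range_succ, mul_comm (∏ i ∈ Finset.range l, overlapFactor (N.kernel i)),
      Real.sqrt_mul (overlapFactor_pos _).le, Finset.sum_range_succ, mul_assoc]
    refine (norm_convStep_sub_le _ (N.kernel_pos l hl') (N.window_le l hl') _ _ _ _
      (fun k hk => N.signal_eq_zero θ x l hk) fun k hk => N.signal_eq_zero θ' x l hk).trans ?_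
    gcongr
    have h1 := hθ l hl'
    rw [N.norm_layerVec_conv θ hl'] at h1
    have h2 := ih hl'.le
    have h3 := N.norm_signalVec_conv_le hθ' hx hl'.le
    rw [signalVec] at h2 h3
    rw [signalVec] at h2
    rw [mul_add]
    refine add_le_add ?_ ?_
    · calc _ ≤ 1 * _ := mul_le_mul h1 h2 (norm_nonneg _) zero_le_one
        _ = _ := one_mul _
    · rw [mul_comm]
      exact mul_le_mul_of_nonneg_right h3 (norm_nonneg _)

/-! ### A finite net for the convolutional kernels -/

/-- The number of entries of the kernels of length at least two. -/
def netDim (l : ℕ) : ℕ := ∑ i ∈ Finset.range l, if N.kernel i = 1 then 0 else N.kernel i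

/-- Keep the convolutional kernels of length one, truncate the entries of the others, and delete
all other layers. -/
def roundParams (K : ℕ) (θ : N.Params) : N.Params :=
  N.ofCoef fun l i => if l < N.numConv then
    if N.kernel l = 1 then N.coef θ l i else dyadicTrunc K (N.coef θ l i) else 0

lemma coef_roundParams (K : ℕ) (θ : N.Params) {l i : ℕ} (hl : l < N.numConv)
    (hi : i < N.kernel l) : N.coef (N.roundParams K θ) l i =
      if N.kernel l = 1 then N.coef θ l i else dyadicTrunc K (N.coef θ l i) := by
  rw [roundParams, coef_ofCoef, if_pos, if_pos hl]
  rw [N.paramCount_conv hl]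
  exact ⟨by unfold depth; omega, hi⟩

lemma norm_layerVec_roundParams_le (K : ℕ) {θ : N.Params}
    (hθ : ∀ l < N.numConv, ‖N.layerVec θ l‖ ≤ 1) :
    ∀ l < N.numConv, ‖N.layerVec (N.roundParams K θ) l‖ ≤ 1 := by
  intro l hl
  refine le_trans ?_ (hθ l hl)
  refine norm_truncVec_le_of_abs_le fun i hi => ?_
  rw [N.paramCount_conv hl] at hi
  rw [N.coef_roundParams K θ hl hi]
  split_ifs
  · exact le_rfl
  · exact abs_dyadicTrunc_le _ _

lemma norm_coef_sub_roundParams_le (K : ℕ) (θ : N.Params) {l : ℕ} (hl : l < N.numConv) :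
    ‖truncVec (N.kernel l) (N.coef θ l) - truncVec (N.kernel l) (N.coef (N.roundParams K θ) l)‖ ≤
      (if N.kernel l = 1 then 0 else N.kernel l : ℕ) * (1 / 2 : ℝ) ^ K := by
  rw [← truncVec_sub]
  refine (norm_truncVec_le_sum_abs _ _).trans ?_
  by_cases h1 : N.kernel l = 1
  · rw [if_pos h1, Nat.cast_zero, zero_mul]
    refine le_of_eq (Finset.sum_eq_zero fun i hi => ?_)
    rw [N.coef_roundParams K θ hl (Finset.mem_range.1 hi), if_pos h1, sub_self, abs_zero]
  · rw [if_neg h1]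
    calc _ ≤ ∑ _i ∈ Finset.range (N.kernel l), (1 / 2 : ℝ) ^ K := by
          refine Finset.sum_le_sum fun i hi => ?_
          rw [N.coef_roundParams K θ hl (Finset.mem_range.1 hi), if_neg h1]
          exact abs_sub_dyadicTrunc_le _ _
      _ = _ := by rw [Finset.sum_const, Finset.card_range, nsmul_eq_mul]

lemma sum_norm_coef_sub_roundParams_le (K : ℕ) (θ : N.Params) :
    ∑ i ∈ Finset.range N.numConv, ‖truncVec (N.kernel i) (N.coef θ i) -
      truncVec (N.kernel i) (N.coef (N.roundParams K θ) i)‖ ≤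
      N.netDim N.numConv * (1 / 2 : ℝ) ^ K := by
  rw [netDim, Nat.cast_sum, Finset.sum_mul]
  exact Finset.sum_le_sum fun l hl =>
    N.norm_coef_sub_roundParams_le K θ (Finset.mem_range.1 hl)

/-- Codes for truncated kernels: a sign and a numerator for every entry. -/
abbrev NetCode (K : ℕ) : Type :=
  (i : Σ l : Fin N.numConv, Fin (N.kernel l)) →
    Bool × Fin (if N.kernel i.1 = 1 then 1 else 2 ^ K + 1)

/-- The parameters with a given code. -/
def decode (K : ℕ) (a : N.NetCode K) : N.Params :=
  N.ofCoef fun l i => if h : l < N.numConv ∧ i < N.kernel l then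
    boolSign (a ⟨⟨l, h.1⟩, ⟨i, h.2⟩⟩).1 *
      (if N.kernel l = 1 then 1 else (((a ⟨⟨l, h.1⟩, ⟨i, h.2⟩⟩).2 : ℕ) : ℝ) / 2 ^ K) else 0

lemma exists_code (K : ℕ) {θ : N.Params} (hθ : ∀ l < N.numConv, ‖N.layerVec θ l‖ ≤ 1)
    (h1 : ∀ l < N.numConv, N.kernel l = 1 → |N.coef θ l 0| = 1) :
    ∃ a : N.NetCode K, N.decode K a = N.roundParams K θ := by
  have hsmall : ∀ l < N.numConv, ∀ i < N.kernel l, ⌊|N.coef θ l i| * 2 ^ K⌋₊ < 2 ^ K + 1 := by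
    intro l hl i hi
    have h2 := hθ l hl
    rw [N.norm_layerVec_conv θ hl, norm_truncVec, Real.sqrt_le_one] at h2
    have h3 : N.coef θ l i ^ 2 ≤ 1 := le_trans (Finset.single_le_sum
      (f := fun i => N.coef θ l i ^ 2) (fun _ _ => sq_nonneg _) (Finset.mem_range.2 hi)) h2
    have h4 : |N.coef θ l i| ≤ 1 := by rwa [sq_le_one_iff_abs_le_one] at h3
    rw [Nat.floor_lt (by positivity)]
    push_cast
    have : (0 : ℝ) < 2 ^ K := by positivity
    nlinarith
  refine ⟨fun i => (decide (0 ≤ N.coef θ i.1 i.2),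
    ⟨if N.kernel i.1 = 1 then 0 else ⌊|N.coef θ i.1 i.2| * 2 ^ K⌋₊, ?_⟩), ?_⟩
  · split_ifs
    · exact Nat.one_pos
    · exact hsmall _ i.1.2 _ i.2.2
  · unfold decode roundParams
    congr 1
    funext l i
    by_cases hl : l < N.numConv
    · by_cases hi : i < N.kernel l
      · rw [dif_pos ⟨hl, hi⟩, if_pos hl]
        by_cases hk : N.kernel l = 1
        · simp only [if_pos hk, mul_one]
          obtain rfl : i = 0 := by omega
          have := h1 l hl hk
          by_cases h0 : 0 ≤ N.coef θ l 0
          · rw [abs_of_nonneg h0] at this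
            simp [this]
          · rw [abs_of_neg (not_le.1 h0)] at this
            simp only [h0, decide_false, boolSign_false]
            linarith
        · simp only [if_neg hk, dyadicTrunc]
      · rw [dif_neg (by tauto), if_pos hl]
        have hc : N.coef θ l i = 0 := N.coef_eq_zero θ (by
          rw [N.paramCount_conv hl]; tauto)
        split_ifs <;> simp [hc, dyadicTrunc]
    · rw [dif_neg (by tauto), if_neg hl]

/-- A kernel of length one contributes just a sign, hence a factor `2 ≤ e`; any other entry has `2
(2^K + 1) ≤ e^(K+2)` codes. -/
lemma card_netCode_le (K : ℕ) :
    (Fintype.card (N.NetCode K) : ℝ) ≤ Real.exp (N.numConv + (K + 2) * N.netDim N.numConv) := by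
  have h2e : (2 : ℝ) ≤ Real.exp 1 := by have := Real.add_one_le_exp (1 : ℝ); linarith
  rw [Fintype.card_pi, Nat.cast_prod, ← Finset.univ_sigma_univ, Finset.prod_sigma]
  have h1 : ∀ l : Fin N.numConv, ∏ q : Fin (N.kernel l),
      ((Fintype.card (Bool × Fin (if N.kernel l = 1 then 1 else 2 ^ K + 1)) : ℕ) : ℝ) ≤
      Real.exp (1 + (K + 2) * (if N.kernel l = 1 then 0 else N.kernel l : ℕ)) := by
    intro l
    rw [Finset.prod_const, Finset.card_univ, Fintype.card_fin, Fintype.card_prod,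
      Fintype.card_bool, Fintype.card_fin]
    by_cases h : N.kernel l = 1
    · simp [h]; exact h2e
    · rw [if_neg h, if_neg h]
      have h3 : ((2 * (2 ^ K + 1) : ℕ) : ℝ) ≤ Real.exp (K + 2) := by
        have : (2 : ℝ) ^ (K + 2) ≤ Real.exp (K + 2) := by
          calc (2 : ℝ) ^ (K + 2) ≤ Real.exp 1 ^ (K + 2) := by gcongr
            _ = _ := by rw [← Real.exp_nat_mul]; push_cast; ring_nf
        refine le_trans ?_ this
        push_cast
        have : (1 : ℝ) ≤ 2 ^ K := one_le_pow₀ (by norm_num)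
        rw [pow_add]; nlinarith
      calc _ ≤ Real.exp (K + 2) ^ N.kernel l := by gcongr
        _ = Real.exp ((K + 2) * N.kernel l) := by rw [← Real.exp_nat_mul]; ring_nf
        _ ≤ _ := Real.exp_le_exp.2 (by linarith)
  refine (Finset.prod_le_prod (fun l _ => Finset.prod_nonneg fun _ _ => Nat.cast_nonneg _)
    fun l _ => h1 l).trans (le_of_eq ?_)
  rw [← Real.exp_sum, Finset.sum_add_distrib, ← Finset.mul_sum, netDim, Nat.cast_sum,
    Finset.sum_range]
  simp

/-- Kernels of length one can be normalised to `±1`. -/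
lemma exists_normalised {θ : N.Params} (hθ : ∀ l < N.numConv, ‖N.layerVec θ l‖ ≤ 1) :
    ∃ θ' : N.Params, (∀ l < N.numConv, ‖N.layerVec θ' l‖ ≤ 1) ∧
      (∀ l < N.numConv, N.kernel l = 1 → |N.coef θ' l 0| = 1) ∧
      ∃ c : ℝ, 0 ≤ c ∧ c ≤ 1 ∧
        ∀ x, N.signalVec θ x N.numConv = c • N.signalVec θ' x N.numConv := by
  -- The number of length-one kernels is not bounded in terms of `d`, so they must not enter the net
  -- dimension. Their moduli are pulled out as a common factor `c ≤ 1`; a sign remains.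
  set W : ℕ → ℕ → ℝ := fun l i => if l < N.numConv ∧ N.kernel l = 1 then
    boolSign (decide (0 ≤ N.coef θ l 0)) else N.coef θ l i with hW
  set c : ℕ → ℝ := fun l => if l < N.numConv ∧ N.kernel l = 1 then |N.coef θ l 0| else 1 with hc
  have hc0 : ∀ l, 0 ≤ c l := by
    intro l; simp only [hc]; split_ifs
    · exact abs_nonneg _
    · exact zero_le_one
  have hc1 : ∀ l, c l ≤ 1 := by
    intro l; simp only [hc]; split_ifs with h
    · have := hθ l h.1
      rw [N.norm_layerVec_conv θ h.1, norm_truncVec, h.2, Finset.sum_range_one,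
        Real.sqrt_sq_eq_abs] at this
      exact this
    · exact le_rfl
  have hcoef : ∀ l i, N.coef θ l i = c l * N.coef (N.ofCoef W) l i := by
    intro l i
    rw [coef_ofCoef]
    by_cases hli : l < N.depth + 1 ∧ i < N.paramCount l
    · rw [if_pos hli]
      simp only [hc, hW]
      split_ifs with h
      · have hi : i = 0 := by
          have := hli.2
          rw [N.paramCount_conv h.1, h.2] at this
          omega
        subst hi
        by_cases h0 : 0 ≤ N.coef θ l 0
        · simp [h0, abs_of_nonneg h0]
        · simp [h0, abs_of_neg (not_le.1 h0)]
      · rw [one_mul]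
    · rw [if_neg hli, N.coef_eq_zero θ hli, mul_zero]
  have habs : ∀ l < N.numConv, N.kernel l = 1 → |N.coef (N.ofCoef W) l 0| = 1 := by
    intro l hl hk
    rw [coef_ofCoef, if_pos ⟨by unfold depth; omega, by rw [N.paramCount_conv hl]; omega⟩]
    simp only [hW]
    rw [if_pos ⟨hl, hk⟩, abs_boolSign]
  refine ⟨N.ofCoef W, fun l hl => ?_, habs, ∏ j ∈ Finset.range N.numConv, c j,
    Finset.prod_nonneg fun j _ => hc0 j,
    Finset.prod_le_one (fun j _ => hc0 j) fun j _ => hc1 j, fun x => ?_⟩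
  · by_cases hk : N.kernel l = 1
    · rw [N.norm_layerVec_conv _ hl, norm_truncVec, hk, Finset.sum_range_one,
        Real.sqrt_sq_eq_abs, habs l hl hk]
    · refine le_trans (norm_truncVec_le_of_abs_le fun i hi => ?_) (hθ l hl)
      rw [hcoef l i]
      have : c l = 1 := by simp only [hc]; rw [if_neg (by tauto)]
      rw [this, one_mul]
  · rw [signalVec, signalVec, ← truncVec_smul]
    congr 1
    funext k
    exact N.signal_of_coef_eq_mul c hc0 hcoef x _ k

/-! ### Fully connected layers -/

/-- Write the columns of the matrix as `α k • u k` with `‖u k‖ ≤ 1` and `∑ (α k)² ≤ 1`. By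
homogeneity of ReLU the squared norm of the sum is `∑ (α k)² (g k)²`, at most the largest `(g k)²`.
-/
lemma exists_unit_neuron {ι : Type*} [Fintype ι] {θ : N.Params} {l : ℕ} (hl : N.numConv ≤ l) (hl' : l < N.depth)
    (hθ : ‖N.layerVec θ l‖ ≤ 1) (x : ι → N.Input) (ε : ι → Bool) :
    ∃ u : ℕ → ℝ, ‖truncVec (N.width l) u‖ ≤ 1 ∧
      ‖∑ i, boolSign (ε i) • N.signalVec θ (x i) (l + 1)‖ ≤
        |∑ i, boolSign (ε i) *
          max (∑ j ∈ Finset.range (N.width l), u j * N.signal θ (x i) l j) 0| := by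
  set m := N.width l
  set A : ℕ → ℕ → ℝ := fun k j => N.coef θ l (j + m * k) with hA
  set α : ℕ → ℝ := fun k => ‖truncVec m (A k)‖ with hα
  set u : ℕ → ℕ → ℝ := fun k j => (α k)⁻¹ * A k j with hu
  set g : ℕ → ℝ := fun k => ∑ i, boolSign (ε i) *
    max (∑ j ∈ Finset.range m, u k j * N.signal θ (x i) l j) 0 with hg
  have hu1 : ∀ k, ‖truncVec m (u k)‖ ≤ 1 := by
    intro k
    rw [hu, truncVec_smul, norm_smul, norm_inv, Real.norm_of_nonneg (norm_nonneg _)]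
    exact inv_mul_le_one
  have hAu : ∀ k, ∀ j < m, A k j = α k * u k j := by
    intro k j hj
    simp only [hu]
    -- A zero column has `α k = 0`, and both sides vanish.
    rcases (norm_nonneg (truncVec m (A k))).eq_or_lt with h0 | hpos
    · have h1 : A k j ^ 2 ≤ ‖truncVec m (A k)‖ ^ 2 := by
        rw [norm_truncVec_sq]
        exact Finset.single_le_sum (f := fun j => A k j ^ 2) (fun _ _ => sq_nonneg _)
          (Finset.mem_range.2 hj)
      rw [← h0] at h1
      have h2 : A k j = 0 := by nlinarith [sq_nonneg (A k j)]
      simp [h2]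
    · exact (mul_inv_cancel_left₀ hpos.ne' _).symm
  have hα1 : ∑ k ∈ Finset.range (N.width (l + 1)), α k ^ 2 ≤ 1 := by
    have e : ∑ k ∈ Finset.range (N.width (l + 1)), α k ^ 2 = ‖N.layerVec θ l‖ ^ 2 := by
      rw [layerVec, norm_truncVec_sq, N.paramCount_fullyConn hl hl', mul_comm,
        ← sum_range_mul_blocks _ _ fun r => N.coef θ l r ^ 2]
      refine Finset.sum_congr rfl fun k _ => ?_
      rw [hα, norm_truncVec_sq]
      refine Finset.sum_congr rfl fun j _ => ?_
      simp only [hA]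
      congr 2
      ring
    rw [e]
    exact pow_le_one₀ (norm_nonneg _) hθ
  have hcoord : ∀ k < N.width (l + 1),
      ∑ i, boolSign (ε i) * N.signal θ (x i) (l + 1) k = α k * g k := by
    intro k hk
    rw [hg, Finset.mul_sum]
    refine Finset.sum_congr rfl fun i _ => ?_
    rw [N.signal_fullyConn θ (x i) hl hk]
    have : ∑ j ∈ Finset.range m, N.coef θ l (j + m * k) * N.signal θ (x i) l j
        = α k * ∑ j ∈ Finset.range m, u k j * N.signal θ (x i) l j := by
      rw [Finset.mul_sum]
      refine Finset.sum_congr rfl fun j hj => ?_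
      have := hAu k j (Finset.mem_range.1 hj)
      simp only [hA] at this
      rw [this, mul_assoc]
    rw [this, relu_mul (norm_nonneg _), relu]
    ring
  have hpos : 0 < N.width (l + 1) := N.width_pos (l + 1) hl'
  obtain ⟨k, hk, hmax⟩ := Finset.exists_max_image (Finset.range (N.width (l + 1))) (fun k => |g k|)
    ⟨0, Finset.mem_range.2 hpos⟩
  refine ⟨u k, hu1 k, ?_⟩
  have e : ∑ i, boolSign (ε i) • N.signalVec θ (x i) (l + 1) =
      truncVec (N.width (l + 1)) fun k => ∑ i, boolSign (ε i) * N.signal θ (x i) (l + 1) k := by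
    ext k
    simp [signalVec, truncVec]
  rw [e, norm_truncVec, ← Real.sqrt_sq_eq_abs]
  refine Real.sqrt_le_sqrt ?_
  calc ∑ k ∈ Finset.range (N.width (l + 1)),
        (∑ i, boolSign (ε i) * N.signal θ (x i) (l + 1) k) ^ 2
      ≤ ∑ k' ∈ Finset.range (N.width (l + 1)), α k' ^ 2 * g k ^ 2 := by
        refine Finset.sum_le_sum fun k' hk' => ?_
        rw [hcoord k' (Finset.mem_range.1 hk'), mul_pow]
        exact mul_le_mul_of_nonneg_left (sq_le_sq.2 (hmax k' hk')) (sq_nonneg _)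
    _ = (∑ k' ∈ Finset.range (N.width (l + 1)), α k' ^ 2) * g k ^ 2 := by rw [Finset.sum_mul]
    _ ≤ 1 * g k ^ 2 := mul_le_mul_of_nonneg_right hα1 (sq_nonneg _)
    _ = _ := one_mul _

section Signs

variable {ι : Type*} [Fintype ι] [DecidableEq ι]

/-- Exponential moments of the Rademacher sums of the output of the convolutional part. -/
lemma sum_exp_norm_conv_le {x : ι → N.Input} (hx : ∀ i, ‖x i‖ ≤ 1) {k₀ : ℕ}
    (hk₀ : N.netDim N.numConv ≤ 2 ^ k₀) {lam : ℝ} (hlam : 0 ≤ lam)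
    (θ : (ι → Bool) → N.Params) (hθ : ∀ ε, ∀ l < N.numConv, ‖N.layerVec (θ ε) l‖ ≤ 1) :
    ∑ ε : ι → Bool, Real.exp (lam * ‖∑ i, boolSign (ε i) •
        N.signalVec (θ ε) (x i) N.numConv‖) ≤
      (Fintype.card (ι → Bool) : ℝ) * (2 * Real.exp (2 * N.numConv +
        2 * (k₀ + 3) * N.netDim N.numConv +
        18 * lam ^ 2 * Fintype.card ι * N.convGain N.numConv)) := by
  choose θ' hθ' h1 c hc0 hc1 hc using fun ε => N.exists_normalised (hθ ε)
  have hred : ∀ ε, ‖∑ i, boolSign (ε i) • N.signalVec (θ ε) (x i) N.numConv‖ ≤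
      ‖∑ i, boolSign (ε i) • N.signalVec (θ' ε) (x i) N.numConv‖ := by
    intro ε
    have : ∑ i, boolSign (ε i) • N.signalVec (θ ε) (x i) N.numConv =
        c ε • ∑ i, boolSign (ε i) • N.signalVec (θ' ε) (x i) N.numConv := by
      rw [Finset.smul_sum]
      exact Finset.sum_congr rfl fun i _ => by rw [hc, smul_comm]
    rw [this, norm_smul, Real.norm_of_nonneg (hc0 ε)]
    exact mul_le_of_le_one_left (norm_nonneg _) (hc1 ε)
  choose a ha using fun k ε => N.exists_code (k₀ + k) (hθ' ε) (h1 ε)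
  set B := √(N.convGain N.numConv) with hB
  have hB0 : 0 ≤ B := Real.sqrt_nonneg _
  -- The chain starts at precision `2^(-k₀)`, fine enough that the rounding errors of all entries
  -- together are at most one.
  have hP : ∀ k, (N.netDim N.numConv : ℝ) * (1 / 2) ^ (k₀ + k) ≤ (1 / 2) ^ k := by
    intro k
    have h2 : (N.netDim N.numConv : ℝ) ≤ 2 ^ k₀ := by exact_mod_cast hk₀
    have h3 : (2 : ℝ) ^ k₀ * (1 / 2) ^ k₀ = 1 := by rw [← mul_pow]; norm_num
    calc (N.netDim N.numConv : ℝ) * (1 / 2) ^ (k₀ + k) ≤ 2 ^ k₀ * (1 / 2) ^ (k₀ + k) := by gcongr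
      _ = _ := by rw [pow_add, ← mul_assoc, h3, one_mul]
  have hlim : ∀ k ε i, ‖N.signalVec (θ' ε) (x i) N.numConv -
      N.signalVec (N.decode (k₀ + k) (a k ε)) (x i) N.numConv‖ ≤ B * (1 / 2) ^ k := by
    intro k ε i
    rw [ha]
    refine (N.norm_signalVec_conv_sub_le (hθ' ε) (N.norm_layerVec_roundParams_le _ (hθ' ε)) (hx i)
      le_rfl).trans ?_
    gcongr
    exact (N.sum_norm_coef_sub_roundParams_le _ _).trans (hP k)
  -- `η = 3 B` because two successive roundings differ by at most `B 2^(-k-1) + B 2^(-k)`. The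
  -- constant `18` in the conclusion is `2 · 3²`.
  have hmain := sum_exp_norm_chaining_le (fun ε i => N.signalVec (θ' ε) (x i) N.numConv)
    (α := fun k => N.NetCode (k₀ + k))
    (fun k b i => N.signalVec (N.decode (k₀ + k) b) (x i) N.numConv) a (η := 3 * B) (D := B)
    (fun ε i => by
      rw [ha]
      have := N.norm_signalVec_conv_le (N.norm_layerVec_roundParams_le (k₀ + 0) (hθ' ε)) (hx i)
        le_rfl
      linarith)
    (fun k ε i => by
      have h2 := hlim k ε i
      have h3 := hlim (k + 1) ε i
      have := norm_sub_le_norm_sub_add_norm_sub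
        (N.signalVec (N.decode (k₀ + (k + 1)) (a (k + 1) ε)) (x i) N.numConv)
        (N.signalVec (θ' ε) (x i) N.numConv)
        (N.signalVec (N.decode (k₀ + k) (a k ε)) (x i) N.numConv)
      rw [norm_sub_rev _ (N.signalVec (θ' ε) (x i) N.numConv)] at this
      have e : B * (1 / 2) ^ (k + 1) + B * (1 / 2) ^ k = 3 * B * (1 / 2) ^ (k + 1) := by
        rw [pow_succ]; ring
      linarith)
    hlim (H := N.numConv + (k₀ + 2) * N.netDim N.numConv) (P := N.netDim N.numConv)
    (by positivity) (by positivity)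
    (fun k => by
      refine (N.card_netCode_le (k₀ + k)).trans (Real.exp_le_exp.2 (le_of_eq ?_))
      push_cast; ring)
    lam hlam
  calc _ ≤ ∑ ε : ι → Bool, Real.exp (lam * ‖∑ i, boolSign (ε i) •
        N.signalVec (θ' ε) (x i) N.numConv‖) := by
        gcongr with ε
        exact hred ε
    _ ≤ _ := hmain
    _ = _ := by
        rw [mul_pow, hB, Real.sq_sqrt (N.convGain_pos _).le]
        ring_nf

/-- Peeling off a fully connected layer. -/
lemma sum_exp_norm_fullyConn_le (x : ι → N.Input) {l : ℕ} (hl : N.numConv ≤ l)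
    (hl' : l < N.depth) {lam : ℝ} (hlam : 0 ≤ lam) {M : ℝ}
    (hM : ∀ θ : (ι → Bool) → N.Params, (∀ ε, ∀ l ≤ N.depth, ‖N.layerVec (θ ε) l‖ ≤ 1) →
      ∑ ε : ι → Bool, Real.exp (lam * ‖∑ i, boolSign (ε i) • N.signalVec (θ ε) (x i) l‖) ≤ M)
    (θ : (ι → Bool) → N.Params) (hθ : ∀ ε, ∀ l ≤ N.depth, ‖N.layerVec (θ ε) l‖ ≤ 1) :
    ∑ ε : ι → Bool, Real.exp (lam * ‖∑ i, boolSign (ε i) • N.signalVec (θ ε) (x i) (l + 1)‖)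
      ≤ 2 * M := by
  choose u hu hle using fun ε => N.exists_unit_neuron hl hl' (hθ ε l hl'.le) x ε
  set T : Set (ι → ℝ) := {t | ∃ θ : N.Params, (∀ l ≤ N.depth, ‖N.layerVec θ l‖ ≤ 1) ∧
    ∃ u : ℕ → ℝ, ‖truncVec (N.width l) u‖ ≤ 1 ∧
      t = fun i => ∑ j ∈ Finset.range (N.width l), u j * N.signal θ (x i) l j} with hT
  have hlin : ∀ t : (ι → Bool) → (ι → ℝ), (∀ ε, t ε ∈ T) →
      ∑ ε, Real.exp (lam * ∑ i, boolSign (ε i) * t ε i) ≤ M := by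
    intro t ht
    choose θ' hθ' u' hu' ht' using ht
    refine le_trans ?_ (hM θ' hθ')
    gcongr with ε
    have e : ∑ i, boolSign (ε i) * t ε i = ∑ j ∈ Finset.range (N.width l), u' ε j *
        ∑ i, boolSign (ε i) * N.signal (θ' ε) (x i) l j := by
      rw [ht' ε]
      simp only [Finset.mul_sum]
      rw [Finset.sum_comm]
      exact Finset.sum_congr rfl fun j _ => Finset.sum_congr rfl fun i _ => by ring
    have e2 : ∑ i, boolSign (ε i) • N.signalVec (θ' ε) (x i) l =
        truncVec (N.width l) fun j => ∑ i, boolSign (ε i) * N.signal (θ' ε) (x i) l j := by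
      ext k
      simp [signalVec, truncVec]
    rw [e, e2]
    refine (le_abs_self _).trans ((abs_sum_mul_le _ _ _).trans ?_)
    exact mul_le_of_le_one_left (norm_nonneg _) (hu' ε)
  have hrelu := sum_exp_relu_le T lam hlam M hlin
  set t : (ι → Bool) → (ι → ℝ) := fun ε i =>
    ∑ j ∈ Finset.range (N.width l), u ε j * N.signal (θ ε) (x i) l j with ht
  have htT : ∀ ε, t ε ∈ T := fun ε => ⟨θ ε, hθ ε, u ε, hu ε, rfl⟩
  have h1 := hrelu t htT
  -- The modulus in `hle` is removed by `exp |a| ≤ exp a + exp (-a)`. Reversing all signs turns the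
  -- second term into one of the first type, whence the factor `2`.
  have h2 := hrelu (fun ε => t fun i => !ε i) fun ε => htT _
  rw [← sum_signs_not] at h2
  simp only [Bool.not_not, boolSign_not] at h2
  calc _ ≤ ∑ ε : ι → Bool, (Real.exp (lam * ∑ i, boolSign (ε i) * max (t ε i) 0) +
        Real.exp (lam * ∑ i, -boolSign (ε i) * max (t ε i) 0)) := by
        refine Finset.sum_le_sum fun ε _ => ?_
        have e : ∑ i, -boolSign (ε i) * max (t ε i) 0 = -∑ i, boolSign (ε i) * max (t ε i) 0 := by
          simp
        rw [e]
        refine (Real.exp_le_exp.2 (mul_le_mul_of_nonneg_left (hle ε) hlam)).trans ?_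
        rcases abs_choice (∑ i, boolSign (ε i) * max (t ε i) 0) with h | h
        · rw [h]; exact le_add_of_nonneg_right (Real.exp_pos _).le
        · rw [h]; exact le_add_of_nonneg_left (Real.exp_pos _).le
    _ ≤ _ := by rw [Finset.sum_add_distrib]; linarith

end Signs

end NetShape

end

/-! ### Rademacher complexity of the network class -/

noncomputable section

namespace NetShape

variable (N : NetShape)

/-! ### The complexity budget -/

/-- Pooling over blocks of length `s` shrinks the signal at least by the factor `s`, so long kernels
use up the input dimension. -/
lemma prod_kernel_mul_width_le {l : ℕ} (hl : l ≤ N.numConv) :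
    (∏ i ∈ Finset.range l, N.kernel i) * N.width l ≤ N.inputDim := by
  induction l with
  | zero => simp [inputDim]
  | succ l ih =>
    have hl' : l < N.numConv := hl
    have h1 := N.window_le l hl'
    have h2 := N.kernel_pos l hl'
    have h3 : N.kernel l * N.width (l + 1) ≤ N.width l := by
      rw [mul_comm]; omega
    rw [Finset.prod_range_succ, mul_assoc]
    exact (Nat.mul_le_mul_left _ h3).trans (ih hl'.le)

lemma prod_kernel_le : ∏ i ∈ Finset.range N.numConv, N.kernel i ≤ N.inputDim :=
  (Nat.le_mul_of_pos_right _ (N.width_pos _ (Nat.le_add_right _ _))).trans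
    (N.prod_kernel_mul_width_le le_rfl)

lemma overlapFactor_le {s : ℕ} (hs : 0 < s) : overlapFactor s ≤ s := by
  unfold overlapFactor
  split_ifs with h1 h2
  · exact_mod_cast hs
  · subst h2; norm_num
  · have : 2 ≤ s := by omega
    exact_mod_cast this

lemma convGain_le_prod {l : ℕ} (hl : l ≤ N.numConv) :
    N.convGain l ≤ ∏ i ∈ Finset.range l, (N.kernel i : ℝ) :=
  Finset.prod_le_prod (fun _ _ => (overlapFactor_pos _).le) fun i hi =>
    overlapFactor_le (N.kernel_pos i ((Finset.mem_range.1 hi).trans_le hl))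

/-- A new layer multiplies the right side by `s` but the gain only by `overlapFactor s`. The slack
`8 (s - overlapFactor s)` pays for the `s` new entries times their gain. With overlap factor `2`
there would be no slack at `s = 2`, hence the refined value `3/2`; at `s = 1` there is none, but
such kernels do not count in `netDim`. -/
lemma netDim_mul_convGain_le_prod {l : ℕ} (hl : l ≤ N.numConv) :
    N.netDim l * N.convGain l ≤ 8 * ∏ i ∈ Finset.range l, (N.kernel i : ℝ) := by
  induction l with
  | zero => simp [netDim]
  | succ l ih =>
    have hl' : l < N.numConv := hl
    have h1 := ih hl'.le
    have h2 := N.convGain_le_prod hl'.le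
    have hg := N.convGain_pos l
    have hs := N.kernel_pos l hl'
    have e1 : N.convGain (l + 1) = N.convGain l * overlapFactor (N.kernel l) :=
      Finset.prod_range_succ _ _
    have e2 : N.netDim (l + 1) = N.netDim l + if N.kernel l = 1 then 0 else N.kernel l :=
      Finset.sum_range_succ _ _
    rw [e1, e2, Finset.prod_range_succ]
    set Q := ∏ i ∈ Finset.range l, (N.kernel i : ℝ)
    set s := N.kernel l
    set P : ℝ := (N.netDim l : ℝ)
    set g := N.convGain l
    have hc := overlapFactor_pos s
    have key : ((if s = 1 then 0 else s : ℕ) : ℝ) * overlapFactor s ≤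
        8 * (s - overlapFactor s) := by
      unfold overlapFactor
      by_cases h : s = 1
      · simp [h]
      · by_cases h' : s = 2
        · norm_num [h']
        · have h3 : 3 ≤ s := by omega
          have h3' : (3 : ℝ) ≤ s := by exact_mod_cast h3
          have : ¬ s ≤ 1 := by omega
          simp only [h, h', this, if_false]
          linarith
    have hsc : 0 ≤ (s : ℝ) - overlapFactor s := sub_nonneg.2 (overlapFactor_le hs)
    push_cast at key ⊢
    calc (P + (if s = 1 then 0 else (s : ℝ))) * (g * overlapFactor s)
        = P * g * overlapFactor s + g * ((if s = 1 then 0 else (s : ℝ)) * overlapFactor s) := by ring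
      _ ≤ 8 * Q * overlapFactor s + Q * (8 * (s - overlapFactor s)) := by
          have i1 := mul_le_mul_of_nonneg_right h1 hc.le
          have i2 := mul_le_mul_of_nonneg_left key hg.le
          have i3 := mul_le_mul_of_nonneg_right h2 (mul_nonneg (by norm_num : (0 : ℝ) ≤ 8) hsc)
          linarith
      _ = _ := by ring

lemma netDim_mul_convGain_le : N.netDim N.numConv * N.convGain N.numConv ≤ 8 * N.inputDim := by
  refine (N.netDim_mul_convGain_le_prod le_rfl).trans ?_
  have := N.prod_kernel_le
  have h : (∏ i ∈ Finset.range N.numConv, (N.kernel i : ℝ)) ≤ N.inputDim := by exact_mod_cast this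
  linarith

lemma convGain_le : N.convGain N.numConv ≤ N.inputDim := by
  refine (N.convGain_le_prod le_rfl).trans ?_
  have := N.prod_kernel_le
  exact_mod_cast this

lemma one_le_complexityConst : 1 ≤ N.complexityConst := by
  unfold complexityConst
  split_ifs with h
  · have := Real.sqrt_nonneg (2 * ((N.depth : ℝ) + 1) * Real.log 2)
    linarith
  · have hd : (1 : ℝ) ≤ N.inputDim := by exact_mod_cast N.width_pos 0 (Nat.zero_le _)
    have hlog := Real.log_nonneg hd
    have h0 : (0 : ℝ) ≤ N.depth := Nat.cast_nonneg _
    have : 1 ≤ √(((N.depth : ℝ) + 2 + Real.log N.inputDim) * N.inputDim) := by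
      rw [Real.one_le_sqrt]
      nlinarith
    linarith

/-- A bound for the total entropy of the network class in terms of `C_{L,d}`. -/
lemma exists_entropy_le : ∃ k₀ : ℕ, N.netDim N.numConv ≤ 2 ^ k₀ ∧
    (2 * ((N.depth : ℝ) + 1) + 2 * (k₀ + 3) * N.netDim N.numConv) * N.convGain N.numConv ≤
      100 * N.complexityConst ^ 2 := by
  have hdpos : 0 < N.inputDim := N.width_pos 0 (Nat.zero_le _)
  have hd : (1 : ℝ) ≤ N.inputDim := by exact_mod_cast hdpos
  have hlog := Real.log_nonneg hd
  have hL : (0 : ℝ) ≤ N.depth := Nat.cast_nonneg _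
  have hl2 : (0.69 : ℝ) < Real.log 2 := by have := Real.log_two_gt_d9; linarith
  have hP : (N.netDim N.numConv : ℝ) ≤ 8 * N.inputDim := by
    refine le_trans ?_ N.netDim_mul_convGain_le
    exact le_mul_of_one_le_right (Nat.cast_nonneg _) (N.one_le_convGain _)
  have hP' : N.netDim N.numConv ≤ 8 * N.inputDim := by exact_mod_cast hP
  -- Since the gain is at least one, `netDim ≤ 8 d`, so `k₀` of order `log d` is enough.
  refine ⟨Nat.log 2 (8 * N.inputDim) + 1, hP'.trans
    (Nat.lt_pow_succ_log_self (by norm_num) _).le, ?_⟩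
  set j := Nat.log 2 (8 * N.inputDim)
  by_cases h0 : N.numConv = 0
  · have e1 : N.netDim N.numConv = 0 := by simp [netDim, h0]
    have e2 : N.convGain N.numConv = 1 := by simp [convGain, h0]
    have e3 : N.complexityConst = √(2 * ((N.depth : ℝ) + 1) * Real.log 2) + 1 := by
      simp [complexityConst, h0]
    rw [e1, e2, e3, Nat.cast_zero, mul_zero, add_zero, mul_one]
    have hnn : 0 ≤ 2 * ((N.depth : ℝ) + 1) * Real.log 2 := by positivity
    have h1 := Real.sq_sqrt hnn
    have h2 := Real.sqrt_nonneg (2 * ((N.depth : ℝ) + 1) * Real.log 2)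
    nlinarith
  · have e3 : N.complexityConst ^ 2 = 4 * (((N.depth : ℝ) + 2 + Real.log N.inputDim) *
        N.inputDim) := by
      rw [complexityConst, if_neg h0, mul_pow, Real.sq_sqrt (by positivity)]
      norm_num
    have hj : (j : ℝ) ≤ 3 + 1.5 * Real.log N.inputDim := by
      have h1 : 2 ^ j ≤ 8 * N.inputDim := Nat.pow_log_le_self 2 (by omega)
      have h2 : (2 : ℝ) ^ j ≤ 8 * N.inputDim := by exact_mod_cast h1
      have h3 := Real.log_le_log (by positivity) h2
      rw [Real.log_pow, Real.log_mul (by norm_num) (by positivity)] at h3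
      have h8 : Real.log 8 = 3 * Real.log 2 := by
        rw [show (8 : ℝ) = 2 ^ 3 by norm_num, Real.log_pow]; norm_num
      rw [h8] at h3
      by_contra hcon
      push Not at hcon
      nlinarith
    have hB := N.convGain_le
    have hPB := N.netDim_mul_convGain_le
    rw [e3]
    push_cast
    set d : ℝ := (N.inputDim : ℝ)
    set P : ℝ := (N.netDim N.numConv : ℝ)
    set g := N.convGain N.numConv
    have i1 : 2 * ((N.depth : ℝ) + 1) * g ≤ 2 * ((N.depth : ℝ) + 1) * d := by gcongr
    have hPg : 0 ≤ P * g := mul_nonneg (Nat.cast_nonneg _) (N.convGain_pos _).le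
    have i2 : 2 * ((j : ℝ) + 1 + 3) * (P * g) ≤
        2 * (3 + 1.5 * Real.log d + 1 + 3) * (8 * d) := by gcongr
    have e : (2 * ((N.depth : ℝ) + 1) + 2 * ((j : ℝ) + 1 + 3) * P) * g =
        2 * ((N.depth : ℝ) + 1) * g + 2 * ((j : ℝ) + 1 + 3) * (P * g) := by ring
    rw [e]
    have hdn : 0 ≤ d := by linarith
    have i3 : 0 ≤ (N.depth : ℝ) * d := by positivity
    have i4 : 0 ≤ Real.log d * d := by positivity
    nlinarith

lemma outWidth_rpow_pos (p : ℝ) : 0 < (N.outWidth : ℝ) ^ p :=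
  Real.rpow_pos_of_pos (Nat.cast_pos.2 (N.width_pos _ le_rfl)) p

lemma sum_sign_mul_eval_le_norm {ι : Type*} [Fintype ι] (p : ℝ) (x : ι → N.Input) (ε : ι → Bool) {θ : N.Params}
    (hθ : ‖N.layerVec θ N.depth‖ ≤ 1) :
    (N.outWidth : ℝ) ^ p * ∑ i, boolSign (ε i) * N.eval p (x i) θ ≤
      ‖∑ i, boolSign (ε i) • N.signalVec θ (x i) N.depth‖ := by
  have hm := N.outWidth_rpow_pos p
  have e : (N.outWidth : ℝ) ^ p * ∑ i, boolSign (ε i) * N.eval p (x i) θ =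
      ∑ k ∈ Finset.range N.outWidth, N.coef θ N.depth k *
        ∑ i, boolSign (ε i) * N.signal θ (x i) N.depth k := by
    simp only [eval, Finset.mul_sum]
    rw [Finset.sum_comm]
    refine Finset.sum_congr rfl fun k _ => Finset.sum_congr rfl fun i _ => ?_
    field_simp
  have e2 : ∑ i, boolSign (ε i) • N.signalVec θ (x i) N.depth =
      truncVec N.outWidth fun k => ∑ i, boolSign (ε i) * N.signal θ (x i) N.depth k := by
    ext k
    simp only [signalVec, truncVec, WithLp.ofLp_sum, WithLp.ofLp_smul, Finset.sum_apply,
      Pi.smul_apply, smul_eq_mul]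
  rw [e, e2]
  refine (le_abs_self _).trans ((abs_sum_mul_le _ _ _).trans ?_)
  refine mul_le_of_le_one_left (norm_nonneg _) ?_
  rw [layerVec, N.paramCount_depth] at hθ
  exact hθ

section Signs

variable {ι : Type*} [Fintype ι] [DecidableEq ι]

lemma sum_exp_norm_signalVec_le {x : ι → N.Input} (hx : ∀ i, ‖x i‖ ≤ 1) {k₀ : ℕ}
    (hk₀ : N.netDim N.numConv ≤ 2 ^ k₀) {lam : ℝ} (hlam : 0 ≤ lam) (r : ℕ) (hr : r ≤ N.numFC)
    (θ : (ι → Bool) → N.Params) (hθ : ∀ ε, ∀ l ≤ N.depth, ‖N.layerVec (θ ε) l‖ ≤ 1) :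
    ∑ ε : ι → Bool, Real.exp (lam * ‖∑ i, boolSign (ε i) •
        N.signalVec (θ ε) (x i) (N.numConv + r)‖) ≤
      2 ^ r * ((Fintype.card (ι → Bool) : ℝ) * (2 * Real.exp (2 * N.numConv +
        2 * (k₀ + 3) * N.netDim N.numConv +
        18 * lam ^ 2 * Fintype.card ι * N.convGain N.numConv))) := by
  induction r generalizing θ with
  | zero =>
    rw [pow_zero, one_mul]
    exact N.sum_exp_norm_conv_le hx hk₀ hlam θ fun ε l hl =>
      hθ ε l (by unfold depth; omega)
  | succ r ih =>
    rw [pow_succ', mul_assoc]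
    exact N.sum_exp_norm_fullyConn_le x (Nat.le_add_right _ _) (by unfold depth; omega) hlam
      (fun θ hθ => ih (by omega) θ hθ) θ hθ

/-- The Rademacher complexity of networks with unit layers. -/
lemma sum_sign_mul_eval_le_of_unit [Nonempty ι] (p : ℝ) {x : ι → N.Input} (hx : ∀ i, ‖x i‖ ≤ 1)
    (θ : (ι → Bool) → N.Params) (hθ : ∀ ε, ∀ l ≤ N.depth, ‖N.layerVec (θ ε) l‖ ≤ 1) :
    ∑ ε : ι → Bool, ∑ i, boolSign (ε i) * N.eval p (x i) (θ ε) ≤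
      (Fintype.card (ι → Bool) : ℝ) *
        (190 * N.complexityConst * √(Fintype.card ι) / (N.outWidth : ℝ) ^ p) := by
  obtain ⟨k₀, hk₀, hent⟩ := N.exists_entropy_le
  have hm := N.outWidth_rpow_pos p
  set n : ℝ := ((Fintype.card ι : ℕ) : ℝ) with hn
  have hn0 : 0 < n := Nat.cast_pos.2 Fintype.card_pos
  set S : ℝ := ((Fintype.card (ι → Bool) : ℕ) : ℝ) with hS
  have hS0 : 0 < S := Nat.cast_pos.2 Fintype.card_pos
  set g := N.convGain N.numConv with hg
  have hg0 : 0 < g := N.convGain_pos _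
  set G : ℝ := 2 * ((N.depth : ℝ) + 1) + 2 * (k₀ + 3) * N.netDim N.numConv with hG
  have hG0 : 0 < G := by positivity
  -- This choice makes the quadratic term `λ² n g` equal to the entropy `G`.
  set lam := √(G / (n * g)) with hlam
  have hlam0 : 0 < lam := Real.sqrt_pos.2 (by positivity)
  have hlamsq : lam ^ 2 * n * g = G := by
    rw [hlam, Real.sq_sqrt (by positivity)]; field_simp
  have hexp := N.sum_exp_norm_signalVec_le hx hk₀ hlam0.le N.numFC le_rfl θ hθ
  have h2e : (2 : ℝ) ≤ Real.exp 1 := by have := Real.add_one_le_exp (1 : ℝ); linarith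
  -- `19 = 18 + 1`: the quadratic term is `18 G`, and the factors `2` of the peeled layers, the
  -- leading `2` and the chaining entropy together fit into one `G`.
  have hbd : ∑ ε : ι → Bool, Real.exp (lam * ‖∑ i, boolSign (ε i) •
      N.signalVec (θ ε) (x i) N.depth‖) ≤ S * Real.exp (19 * G) := by
    refine hexp.trans ?_
    have h1 : (2 : ℝ) ^ N.numFC * 2 ≤ Real.exp (N.numFC + 1) := by
      calc (2 : ℝ) ^ N.numFC * 2 = 2 ^ (N.numFC + 1) := (pow_succ _ _).symm
        _ ≤ Real.exp 1 ^ (N.numFC + 1) := by gcongr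
        _ = _ := by rw [← Real.exp_nat_mul]; push_cast; ring_nf
    have hdep : (N.depth : ℝ) = N.numConv + N.numFC := by unfold depth; push_cast; ring
    calc _ = S * (2 ^ N.numFC * 2 * Real.exp (2 * N.numConv +
          2 * (k₀ + 3) * N.netDim N.numConv + 18 * lam ^ 2 * n * g)) := by ring
      _ ≤ S * (Real.exp (N.numFC + 1) * Real.exp (2 * N.numConv +
          2 * (k₀ + 3) * N.netDim N.numConv + 18 * lam ^ 2 * n * g)) := by gcongr
      _ ≤ _ := by
          rw [← Real.exp_add]
          gcongr
          have : 18 * lam ^ 2 * n * g = 18 * G := by rw [← hlamsq]; ring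
          rw [this]
          have h3 : (0 : ℝ) ≤ N.numFC := Nat.cast_nonneg _
          have h4 : (0 : ℝ) ≤ N.numConv := Nat.cast_nonneg _
          have : G = 2 * ((N.numConv : ℝ) + N.numFC + 1) + 2 * (k₀ + 3) * N.netDim N.numConv := by
            rw [hG, hdep]
          linarith
  -- Jensen's inequality
  set X : (ι → Bool) → ℝ := fun ε => ∑ i, boolSign (ε i) * N.eval p (x i) (θ ε) with hX
  have hlin : lam * (N.outWidth : ℝ) ^ p * ∑ ε, X ε ≤ S * (19 * G) := by
    -- Passing from exponential moment to mean uses the tangent inequality `1 + z ≤ exp z` with `z`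
    -- centred at `19 G`, the logarithm of the moment bound.
    have h1 : ∀ ε, lam * ((N.outWidth : ℝ) ^ p * X ε) ≤ 19 * G - 1 +
        Real.exp (-(19 * G)) * Real.exp (lam * ‖∑ i, boolSign (ε i) •
          N.signalVec (θ ε) (x i) N.depth‖) := by
      intro ε
      have h2 := N.sum_sign_mul_eval_le_norm p x ε (hθ ε N.depth le_rfl)
      have h3 := mul_le_mul_of_nonneg_left h2 hlam0.le
      rw [← Real.exp_add]
      have h4 := Real.add_one_le_exp (-(19 * G) + lam * ‖∑ i, boolSign (ε i) •
          N.signalVec (θ ε) (x i) N.depth‖)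
      linarith
    calc lam * (N.outWidth : ℝ) ^ p * ∑ ε, X ε
        = ∑ ε, lam * ((N.outWidth : ℝ) ^ p * X ε) := by
          rw [Finset.mul_sum]; exact Finset.sum_congr rfl fun ε _ => mul_assoc _ _ _
      _ ≤ ∑ ε : ι → Bool, (19 * G - 1 + Real.exp (-(19 * G)) * Real.exp (lam *
          ‖∑ i, boolSign (ε i) • N.signalVec (θ ε) (x i) N.depth‖)) :=
          Finset.sum_le_sum fun ε _ => h1 ε
      _ = S * (19 * G - 1) + Real.exp (-(19 * G)) * ∑ ε : ι → Bool, Real.exp (lam *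
          ‖∑ i, boolSign (ε i) • N.signalVec (θ ε) (x i) N.depth‖) := by
          rw [Finset.sum_add_distrib, ← Finset.mul_sum, Finset.sum_const, nsmul_eq_mul,
            Finset.card_univ]
      _ ≤ S * (19 * G - 1) + Real.exp (-(19 * G)) * (S * Real.exp (19 * G)) := by gcongr
      _ = _ := by
          have : Real.exp (-(19 * G)) * Real.exp (19 * G) = 1 := by
            rw [← Real.exp_add]; simp
          linear_combination S * this
  have hC := N.one_le_complexityConst
  -- `190 = 19 · 10`, the `10` coming from `√(G g) ≤ 10 C_{L,d}`.
  have hkey : 19 * G ≤ lam * (190 * N.complexityConst * √n) := by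
    have h1 : lam * √(n * g) = √G := by
      rw [hlam, ← Real.sqrt_mul (by positivity)]
      congr 1
      field_simp
    have h2 : √G * √g ≤ 10 * N.complexityConst := by
      rw [← Real.sqrt_mul hG0.le, Real.sqrt_le_left (by positivity), mul_pow]
      norm_num
      exact hent
    have h3 : √G * √G = G := Real.mul_self_sqrt hG0.le
    have h4 : √G = lam * √n * √g := by
      rw [← h1, Real.sqrt_mul hn0.le, mul_assoc]
    have hgs : √g * √g = g := Real.mul_self_sqrt hg0.le
    calc 19 * G = 19 * (lam * √n) * (√G * √g) := by
          nth_rewrite 1 [← h3]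
          nth_rewrite 1 [h4]
          ring
      _ ≤ 19 * (lam * √n) * (10 * N.complexityConst) := by gcongr
      _ = _ := by ring
  have hfin : lam * (N.outWidth : ℝ) ^ p * ∑ ε, X ε ≤
      lam * (N.outWidth : ℝ) ^ p * (S * (190 * N.complexityConst * √n / (N.outWidth : ℝ) ^ p)) := by
    refine hlin.trans ((mul_le_mul_of_nonneg_left hkey hS0.le).trans (le_of_eq ?_))
    field_simp
  exact le_of_mul_le_mul_left hfin (by positivity)

/-- The Rademacher complexity of networks with layers of norm at most `ρ`. -/
theorem sum_sign_mul_eval_le [Nonempty ι] (p : ℝ) {x : ι → N.Input} (hx : ∀ i, ‖x i‖ ≤ 1)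
    {ρ : ℝ} (hρ : 0 ≤ ρ) (θ : (ι → Bool) → N.Params)
    (hθ : ∀ ε, ∀ l ≤ N.depth, ‖N.layerVec (θ ε) l‖ ≤ ρ) :
    ∑ ε : ι → Bool, ∑ i, boolSign (ε i) * N.eval p (x i) (θ ε) ≤
      (Fintype.card (ι → Bool) : ℝ) * (190 * N.complexityConst * √(Fintype.card ι) /
        (N.outWidth : ℝ) ^ p * ρ ^ (N.depth + 1)) := by
  set θ' : (ι → Bool) → N.Params := fun ε => N.ofCoef fun l i => ρ⁻¹ * N.coef (θ ε) l i with hθ'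
  have hc : ∀ ε l i, N.coef (θ' ε) l i = ρ⁻¹ * N.coef (θ ε) l i := fun ε l i =>
    N.coef_ofCoef_mul (θ ε) (fun _ => ρ⁻¹) l i
  have hnorm : ∀ ε l, ‖N.layerVec (θ' ε) l‖ = ρ⁻¹ * ‖N.layerVec (θ ε) l‖ := by
    intro ε l
    have : N.layerVec (θ' ε) l = ρ⁻¹ • N.layerVec (θ ε) l := by
      rw [layerVec, layerVec, ← truncVec_smul]
      congr 1
      funext i
      exact hc ε l i
    rw [this, norm_smul, norm_inv, Real.norm_of_nonneg hρ]
  have hunit : ∀ ε, ∀ l ≤ N.depth, ‖N.layerVec (θ' ε) l‖ ≤ 1 := by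
    intro ε l hl
    rw [hnorm]
    exact inv_mul_le_one_of_le₀ (hθ ε l hl) hρ
  have hback : ∀ ε l i, N.coef (θ ε) l i = ρ * N.coef (θ' ε) l i := by
    intro ε l i
    rw [hc]
    -- For `ρ = 0` the inverse is `0` by convention, and all parameters vanish.
    rcases hρ.eq_or_lt with h0 | hpos
    · by_cases h : l < N.depth + 1 ∧ i < N.paramCount l
      · have h1 := hθ ε l (by omega)
        have h2 : N.coef (θ ε) l i ^ 2 ≤ ‖N.layerVec (θ ε) l‖ ^ 2 := by
          rw [layerVec, norm_truncVec_sq]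
          exact Finset.single_le_sum (f := fun i => N.coef (θ ε) l i ^ 2)
            (fun _ _ => sq_nonneg _) (Finset.mem_range.2 h.2)
        have h3 : ‖N.layerVec (θ ε) l‖ = 0 := le_antisymm (by linarith) (norm_nonneg _)
        rw [h3] at h2
        have : N.coef (θ ε) l i = 0 := by nlinarith [sq_nonneg (N.coef (θ ε) l i)]
        simp [this]
      · simp [N.coef_eq_zero _ h]
    · rw [mul_inv_cancel_left₀ hpos.ne']
  have heval : ∀ ε i, N.eval p (x i) (θ ε) = ρ ^ (N.depth + 1) * N.eval p (x i) (θ' ε) := by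
    intro ε i
    rw [N.eval_of_coef_eq_mul (fun _ => ρ) (fun _ => hρ) (hback ε) p (x i), Finset.prod_const,
      Finset.card_range]
  have := N.sum_sign_mul_eval_le_of_unit p hx θ' hunit
  have h2 := mul_le_mul_of_nonneg_left this (pow_nonneg hρ (N.depth + 1))
  calc _ = ρ ^ (N.depth + 1) * ∑ ε : ι → Bool, ∑ i, boolSign (ε i) * N.eval p (x i) (θ' ε) := by
        simp only [Finset.mul_sum]
        exact Finset.sum_congr rfl fun ε _ => Finset.sum_congr rfl fun i _ => by
          rw [heval]; ring
    _ ≤ _ := h2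
    _ = _ := by ring

end Signs

end NetShape

end

/-! ### Concentration and symmetrisation -/

noncomputable section

lemma abs_empMean_le {X : Type*} {n : ℕ} {M : ℝ} {f : X → ℝ} (hf : ∀ x, f x ∈ Set.Icc 0 M)
    (S : Fin n → X) : |1 / (n : ℝ) * ∑ i, f (S i)| ≤ M ∨ n = 0 := by
  rcases Nat.eq_zero_or_pos n with h | hn
  · right; exact h
  left
  have hn' : (0 : ℝ) < n := Nat.cast_pos.2 hn
  have h0 : 0 ≤ ∑ i, f (S i) := Finset.sum_nonneg fun i _ => (hf _).1
  have h1 : ∑ i, f (S i) ≤ n * M := by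
    calc _ ≤ ∑ _i : Fin n, M := Finset.sum_le_sum fun i _ => (hf _).2
      _ = _ := by simp
  rw [abs_of_nonneg (by positivity), one_div, inv_mul_le_iff₀ hn']
  exact h1

section Statistics

variable {X : Type*} [MeasurableSpace X] {μ : Measure X}

/-! ### The bounded differences inequality -/

lemma integrable_of_measurable_of_abs_le {Y : Type*} [MeasurableSpace Y] {ν : Measure Y}
    [IsFiniteMeasure ν] {f : Y → ℝ} (hf : Measurable f) {C : ℝ} (hC : ∀ y, |f y| ≤ C) :
    Integrable f ν :=
  Integrable.of_bound hf.aestronglyMeasurable C (Eventually.of_forall hC)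

/-- **McDiarmid's inequality** for the moment generating function. -/
lemma integral_exp_le_of_bounded_differences [IsProbabilityMeasure μ] {c : ℝ} (hc : 0 ≤ c) {C lam : ℝ} (n : ℕ)
    (Z : (Fin n → X) → ℝ) (hZ : Measurable Z) (hC : ∀ S, |Z S| ≤ C)
    (hdiff : ∀ S i x, |Z S - Z (Function.update S i x)| ≤ c) :
    ∫ S, Real.exp (lam * (Z S - ∫ S', Z S' ∂Measure.pi fun _ => μ)) ∂(Measure.pi fun _ => μ) ≤
      Real.exp (n * (c / 2) ^ 2 * lam ^ 2 / 2) := by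
  induction n with
  | zero =>
    have h : ∀ f : (Fin 0 → X) → ℝ, ∫ S, f S ∂(Measure.pi fun _ : Fin 0 => μ) = f Fin.elim0 := by
      intro f
      have e : f = fun _ => f Fin.elim0 := by
        funext S; congr 1; exact Subsingleton.elim _ _
      rw [e]; simp
    rw [h, h]; simp
  | succ n ih =>
    set ν : Measure (Fin n → X) := Measure.pi fun _ => μ with hν
    set e := MeasurableEquiv.piFinSuccAbove (fun _ : Fin (n + 1) => X) 0 with he
    have hmp : MeasurePreserving e (Measure.pi fun _ => μ) (μ.prod ν) :=
      measurePreserving_piFinSuccAbove (fun _ : Fin (n + 1) => μ) 0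
    have htr : ∀ f : (Fin (n + 1) → X) → ℝ, ∫ S, f S ∂(Measure.pi fun _ => μ) =
        ∫ q, f (e.symm q) ∂(μ.prod ν) := fun f => by
      rw [← hmp.integral_comp e.measurableEmbedding]
      simp
    set Y : X → (Fin n → X) → ℝ := fun x S => Z (e.symm (x, S)) with hY
    have hYm : Measurable fun q : X × (Fin n → X) => Y q.1 q.2 :=
      hZ.comp e.symm.measurable
    have hYm' : ∀ x, Measurable (Y x) := fun x => hYm.comp measurable_prodMk_left
    have hYC : ∀ x S, |Y x S| ≤ C := fun x S => hC _
    set g : X → ℝ := fun x => ∫ S, Y x S ∂ν with hg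
    have hgm : Measurable g := hYm.stronglyMeasurable.integral_prod_right.measurable
    have hYint : ∀ x, Integrable (Y x) ν := fun x =>
      integrable_of_measurable_of_abs_le (hYm' x) (hYC x)
    have hgC : ∀ x, |g x| ≤ C := by
      intro x
      have := norm_integral_le_of_norm_le_const (μ := ν) (f := Y x) (C := C)
        (Eventually.of_forall (hYC x))
      simpa using this
    have hYint2 : Integrable (fun q : X × (Fin n → X) => Y q.1 q.2) (μ.prod ν) :=
      integrable_of_measurable_of_abs_le hYm fun q => hYC _ _
    have hmean : ∫ S, Z S ∂(Measure.pi fun _ => μ) = ∫ x, g x ∂μ := by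
      rw [htr]
      exact integral_prod _ hYint2
    have hgdiff : ∀ x x', g x - g x' ≤ c := by
      intro x x'
      have h1 : g x - g x' = ∫ S, (Y x S - Y x' S) ∂ν := (integral_sub (hYint x) (hYint x')).symm
      have h2 : ∀ S, Y x S - Y x' S ≤ c := by
        intro S
        have h3 := hdiff (e.symm (x, S)) 0 x'
        have h4 : Function.update (e.symm (x, S)) 0 x' = e.symm (x', S) := by
          simp only [he, MeasurableEquiv.piFinSuccAbove]
          simp only [Fin.insertNthEquiv_zero, MeasurableEquiv.symm_mk, MeasurableEquiv.coe_mk,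
            Equiv.symm_symm]
          exact Fin.update_cons_zero (α := fun _ => X) x S x'
        rw [h4] at h3
        exact (le_abs_self _).trans h3
      rw [h1]
      calc _ ≤ ∫ _S, c ∂ν := integral_mono ((hYint x).sub (hYint x')) (integrable_const _) h2
        _ = c := by simp
    -- conditional bound
    have hcond : ∀ x, ∫ S, Real.exp (lam * (Y x S - g x)) ∂ν ≤
        Real.exp (n * (c / 2) ^ 2 * lam ^ 2 / 2) := by
      intro x
      refine ih (Y x) (hYm' x) (hYC x) fun S i x' => ?_
      have h3 := hdiff (e.symm (x, S)) i.succ x'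
      have h4 : Function.update (e.symm (x, S)) i.succ x' =
          e.symm (x, Function.update S i x') := by
        simp only [he, MeasurableEquiv.piFinSuccAbove]
        simp only [Fin.insertNthEquiv_zero, MeasurableEquiv.symm_mk, MeasurableEquiv.coe_mk,
          Equiv.symm_symm]
        exact (Fin.cons_update (α := fun _ => X) x S i x').symm
      rw [h4] at h3
      exact h3
    -- Hoeffding's lemma for the first coordinate
    have hne : Nonempty X := by
      by_contra h
      rw [not_nonempty_iff] at h
      have := measure_univ (μ := μ)
      rw [Set.univ_eq_empty_iff.2 h, measure_empty] at this
      exact zero_ne_one this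
    have hbdd : BddBelow (Set.range g) := ⟨-C, by
      rintro _ ⟨x, rfl⟩; exact (abs_le.1 (hgC x)).1⟩
    -- The mean over the other coordinates still oscillates by at most `c`, so it lies in an
    -- interval of length `c`, and Hoeffding's lemma gives the variance proxy `(c / 2)²`.
    have hIcc : ∀ x, g x ∈ Set.Icc (⨅ x, g x) ((⨅ x, g x) + c) := by
      intro x
      refine ⟨ciInf_le hbdd x, ?_⟩
      have : g x - c ≤ ⨅ x, g x := le_ciInf fun x' => by linarith [hgdiff x x']
      linarith
    have hhoef := (hasSubgaussianMGF_of_mem_Icc (μ := μ) hgm.aemeasurable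
      (Eventually.of_forall hIcc)).mgf_le lam
    have hfirst : ∫ x, Real.exp (lam * (g x - ∫ x', g x' ∂μ)) ∂μ ≤
        Real.exp ((c / 2) ^ 2 * lam ^ 2 / 2) := by
      refine hhoef.trans (le_of_eq ?_)
      congr 3
      push_cast
      rw [add_sub_cancel_left, Real.norm_of_nonneg hc]
    have hC0 : 0 ≤ C := (abs_nonneg _).trans (hgC hne.some)
    have hgmean : |∫ x, g x ∂μ| ≤ C := by
      have := norm_integral_le_of_norm_le_const (μ := μ) (f := g) (C := C)
        (Eventually.of_forall hgC)
      simpa using this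
    have hexpbd : ∀ a b : ℝ, |a| ≤ C → |b| ≤ C →
        |Real.exp (lam * (a - b))| ≤ Real.exp (|lam| * (2 * C)) := by
      intro a b ha hb
      rw [abs_of_pos (Real.exp_pos _)]
      refine Real.exp_le_exp.2 ((le_abs_self _).trans ?_)
      rw [abs_mul]
      refine mul_le_mul_of_nonneg_left ?_ (abs_nonneg _)
      have := abs_sub a b
      linarith
    have hint1 : Integrable (fun x => Real.exp (lam * (g x - ∫ x', g x' ∂μ))) μ :=
      integrable_of_measurable_of_abs_le
        (Real.measurable_exp.comp ((hgm.sub_const _).const_mul lam))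
        fun x => hexpbd _ _ (hgC x) hgmean
    have hint2 : Integrable (fun q : X × (Fin n → X) =>
        Real.exp (lam * (Y q.1 q.2 - ∫ x', g x' ∂μ))) (μ.prod ν) :=
      integrable_of_measurable_of_abs_le
        (Real.measurable_exp.comp ((hYm.sub_const _).const_mul lam))
        fun q => hexpbd _ _ (hYC _ _) hgmean
    have hmain : ∫ x, ∫ S, Real.exp (lam * (Y x S - ∫ x', g x' ∂μ)) ∂ν ∂μ ≤
        ∫ x, Real.exp (n * (c / 2) ^ 2 * lam ^ 2 / 2) *
          Real.exp (lam * (g x - ∫ x', g x' ∂μ)) ∂μ := by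
      refine integral_mono hint2.integral_prod_left (hint1.const_mul _) fun x => ?_
      have h1 : ∀ S, Real.exp (lam * (Y x S - ∫ x', g x' ∂μ)) =
          Real.exp (lam * (Y x S - g x)) * Real.exp (lam * (g x - ∫ x', g x' ∂μ)) := by
        intro S
        rw [← Real.exp_add]; ring_nf
      calc ∫ S, Real.exp (lam * (Y x S - ∫ x', g x' ∂μ)) ∂ν
          = (∫ S, Real.exp (lam * (Y x S - g x)) ∂ν) *
            Real.exp (lam * (g x - ∫ x', g x' ∂μ)) := by
            rw [← integral_mul_const]
            exact integral_congr_ae (Eventually.of_forall h1)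
        _ ≤ _ := mul_le_mul_of_nonneg_right (hcond x) (Real.exp_pos _).le
    rw [htr, hmean]
    calc ∫ q, Real.exp (lam * (Z (e.symm q) - ∫ x', g x' ∂μ)) ∂(μ.prod ν)
        = ∫ x, ∫ S, Real.exp (lam * (Y x S - ∫ x', g x' ∂μ)) ∂ν ∂μ := integral_prod _ hint2
      _ ≤ _ := hmain
      _ = Real.exp (n * (c / 2) ^ 2 * lam ^ 2 / 2) *
          ∫ x, Real.exp (lam * (g x - ∫ x', g x' ∂μ)) ∂μ := integral_const_mul _ _
      _ ≤ Real.exp (n * (c / 2) ^ 2 * lam ^ 2 / 2) * Real.exp ((c / 2) ^ 2 * lam ^ 2 / 2) := by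
          gcongr
      _ = _ := by rw [← Real.exp_add]; push_cast; ring_nf

/-- **McDiarmid's inequality**. -/
lemma measure_ge_le_of_bounded_differences [IsProbabilityMeasure μ] {c : ℝ} (hc : 0 ≤ c) {C : ℝ} (n : ℕ)
    (Z : (Fin n → X) → ℝ) (hZ : Measurable Z) (hC : ∀ S, |Z S| ≤ C)
    (hdiff : ∀ S i x, |Z S - Z (Function.update S i x)| ≤ c) {t : ℝ} (ht : 0 ≤ t) :
    (Measure.pi fun _ : Fin n => μ).real
      {S | t ≤ Z S - ∫ S', Z S' ∂Measure.pi fun _ => μ} ≤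
      Real.exp (-t ^ 2 / (2 * (n * (c / 2) ^ 2))) := by
  have hmean : |∫ S', Z S' ∂Measure.pi fun _ : Fin n => μ| ≤ C := by
    have := norm_integral_le_of_norm_le_const (μ := Measure.pi fun _ : Fin n => μ) (f := Z)
      (C := C) (Eventually.of_forall hC)
    simpa using this
  have h : HasSubgaussianMGF (fun S => Z S - ∫ S', Z S' ∂Measure.pi fun _ => μ)
      (Real.toNNReal (n * (c / 2) ^ 2)) (Measure.pi fun _ : Fin n => μ) := by
    refine ⟨fun lam => ?_, fun lam => ?_⟩
    · refine integrable_of_measurable_of_abs_le (C := Real.exp (|lam| * (2 * C)))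
        (Real.measurable_exp.comp ((hZ.sub_const _).const_mul lam)) fun S => ?_
      rw [abs_of_pos (Real.exp_pos _)]
      refine Real.exp_le_exp.2 ((le_abs_self _).trans ?_)
      rw [abs_mul]
      refine mul_le_mul_of_nonneg_left ?_ (abs_nonneg _)
      have := abs_sub (Z S) (∫ S', Z S' ∂Measure.pi fun _ : Fin n => μ)
      have := hC S
      linarith
    · rw [Real.coe_toNNReal _ (by positivity)]
      exact integral_exp_le_of_bounded_differences hc n Z hZ hC hdiff
  have := h.measure_ge_le ht
  rwa [Real.coe_toNNReal _ (by positivity)] at this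

/-! ### Symmetrisation -/

variable {J : Type*} [Fintype J] [Nonempty J]

lemma measurable_sup'_univ {Y : Type*} [MeasurableSpace Y] {f : J → Y → ℝ}
    (hf : ∀ j, Measurable (f j)) :
    Measurable fun y => Finset.univ.sup' Finset.univ_nonempty fun j => f j y := by
  have := Finset.measurable_sup' (Finset.univ_nonempty (α := J)) fun j _ => hf j
  convert this using 1
  funext y
  rw [Finset.sup'_apply]

/-- The largest deviation of the mean from the empirical mean in a finite class. -/
def maxDeviation (μ : Measure X) {n : ℕ} (g : J → X → ℝ) (S : Fin n → X) : ℝ :=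
  Finset.univ.sup' Finset.univ_nonempty fun j => ∫ z, g j z ∂μ - 1 / (n : ℝ) * ∑ i, g j (S i)

lemma measurable_maxDeviation {n : ℕ} {g : J → X → ℝ} (hg : ∀ j, Measurable (g j)) :
    Measurable (maxDeviation μ g : (Fin n → X) → ℝ) := by
  unfold maxDeviation
  refine measurable_sup'_univ fun j => ?_
  exact measurable_const.sub ((Finset.measurable_fun_sum _ fun i _ =>
    (hg j).comp (measurable_pi_apply i)).const_mul _)

lemma abs_integral_le_of_mem_Icc [IsProbabilityMeasure μ] {M : ℝ} {f : X → ℝ} (hf : ∀ x, f x ∈ Set.Icc 0 M) :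
    |∫ x, f x ∂μ| ≤ M := by
  have := norm_integral_le_of_norm_le_const (μ := μ) (f := f) (C := M)
    (Eventually.of_forall fun x => by
      rw [Real.norm_of_nonneg (hf x).1]; exact (hf x).2)
  simpa using this

lemma abs_maxDeviation_le [IsProbabilityMeasure μ] {n : ℕ} (hn : 0 < n) {M : ℝ} {g : J → X → ℝ}
    (hg : ∀ j x, g j x ∈ Set.Icc 0 M) (S : Fin n → X) : |maxDeviation μ g S| ≤ 2 * M := by
  obtain ⟨j, -, hj⟩ := Finset.exists_mem_eq_sup' Finset.univ_nonempty
    fun j => ∫ z, g j z ∂μ - 1 / (n : ℝ) * ∑ i, g j (S i)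
  rw [maxDeviation, hj]
  have h1 := abs_integral_le_of_mem_Icc (μ := μ) (hg j)
  have h2 := (abs_empMean_le (hg j) S).resolve_right hn.ne'
  have := abs_sub (∫ z, g j z ∂μ) (1 / (n : ℝ) * ∑ i, g j (S i))
  linarith

lemma abs_sup'_sub_sup'_le {f g : J → ℝ} {c : ℝ} (h : ∀ j, |f j - g j| ≤ c) :
    |Finset.univ.sup' Finset.univ_nonempty f - Finset.univ.sup' Finset.univ_nonempty g| ≤ c := by
  have key : ∀ f g : J → ℝ, (∀ j, |f j - g j| ≤ c) →
      Finset.univ.sup' Finset.univ_nonempty f ≤ Finset.univ.sup' Finset.univ_nonempty g + c := by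
    intro f g h
    refine Finset.sup'_le _ _ fun j hj => ?_
    have h1 := (abs_le.1 (h j)).2
    have h2 := Finset.le_sup' g hj
    linarith
  have h1 := key f g h
  have h2 := key g f fun j => by rw [abs_sub_comm]; exact h j
  rw [abs_le]
  constructor <;> linarith

lemma abs_maxDeviation_update_le {n : ℕ} {M : ℝ} {g : J → X → ℝ}
    (hg : ∀ j x, g j x ∈ Set.Icc 0 M) (S : Fin n → X) (i : Fin n) (x : X) :
    |maxDeviation μ g S - maxDeviation μ g (Function.update S i x)| ≤ M / n := by
  refine abs_sup'_sub_sup'_le fun j => ?_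
  have e : ∑ k, g j (Function.update S i x k) - ∑ k, g j (S k) = g j x - g j (S i) := by
    rw [← Finset.sum_sub_distrib, Finset.sum_eq_single i]
    · simp
    · intro k _ hk
      rw [Function.update_of_ne hk, sub_self]
    · simp
  have e2 : ∫ z, g j z ∂μ - 1 / (n : ℝ) * ∑ k, g j (S k) -
      (∫ z, g j z ∂μ - 1 / (n : ℝ) * ∑ k, g j (Function.update S i x k)) =
      (g j x - g j (S i)) / n := by
    rw [← e]; ring
  rw [e2, abs_div, Nat.abs_cast]
  refine div_le_div_of_nonneg_right ?_ (Nat.cast_nonneg _)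
  have h1 := hg j x
  have h2 := hg j (S i)
  rw [abs_le]
  constructor <;> linarith [h1.1, h1.2, h2.1, h2.2]

/-- The mean is replaced by that of an independent second sample. Exchanging the two points of a
pair preserves the joint law, so arbitrary signs may be inserted and averaged over. Both samples
then contribute a Rademacher average, whence `2 * r`. The complexity bound is needed only for
samples in the full-measure set `G`. -/
lemma integral_maxDeviation_le [IsProbabilityMeasure μ] {n : ℕ} (hn : 0 < n) {M : ℝ} {g : J → X → ℝ}
    (hgm : ∀ j, Measurable (g j)) (hg : ∀ j x, g j x ∈ Set.Icc 0 M) {G : Set X}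
    (hG : ∀ᵐ x ∂μ, x ∈ G) {r : ℝ}
    (hr : ∀ S : Fin n → X, (∀ i, S i ∈ G) → ∀ t : (Fin n → Bool) → J,
      ∑ ε : Fin n → Bool, ∑ i, boolSign (ε i) * g (t ε) (S i) ≤
        (Fintype.card (Fin n → Bool) : ℝ) * (n * r)) :
    ∫ S, maxDeviation μ g S ∂(Measure.pi fun _ : Fin n => μ) ≤ 2 * r := by
  have hn' : (0 : ℝ) < n := Nat.cast_pos.2 hn
  set ν : Measure (Fin n → X) := Measure.pi fun _ => μ with hν
  set π : Measure (Fin n → X × X) := Measure.pi fun _ => μ.prod μ with hπ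
  -- the maximal signed sum
  set R : (Fin n → Bool) → (Fin n → X) → ℝ := fun ε S =>
    Finset.univ.sup' Finset.univ_nonempty fun j => 1 / (n : ℝ) * ∑ i, boolSign (ε i) * g j (S i)
    with hR
  set W : (Fin n → Bool) → (Fin n → X × X) → ℝ := fun ε ω =>
    Finset.univ.sup' Finset.univ_nonempty fun j =>
      1 / (n : ℝ) * ∑ i, boolSign (ε i) * (g j (ω i).2 - g j (ω i).1) with hW
  have hWm : ∀ ε, Measurable (W ε) := by
    intro ε
    refine measurable_sup'_univ fun j => ?_
    exact (Finset.measurable_fun_sum _ fun i _ => (((hgm j).comp (measurable_snd.comp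
      (measurable_pi_apply i))).sub ((hgm j).comp (measurable_fst.comp
      (measurable_pi_apply i)))).const_mul _).const_mul _
  have hWC : ∀ ε ω, |W ε ω| ≤ M := by
    intro ε ω
    obtain ⟨j, -, hj⟩ := Finset.exists_mem_eq_sup' Finset.univ_nonempty fun j =>
      1 / (n : ℝ) * ∑ i, boolSign (ε i) * (g j (ω i).2 - g j (ω i).1)
    simp only [hW]
    rw [hj, abs_mul, abs_of_pos (by positivity), one_div, inv_mul_le_iff₀ hn']
    refine (Finset.abs_sum_le_sum_abs _ _).trans ?_
    calc _ ≤ ∑ _i : Fin n, M := by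
          refine Finset.sum_le_sum fun i _ => ?_
          rw [abs_mul, abs_boolSign, one_mul, abs_le]
          have h1 := hg j (ω i).2
          have h2 := hg j (ω i).1
          constructor <;> linarith [h1.1, h1.2, h2.1, h2.2]
      _ = _ := by simp
  have hWint : ∀ ε, Integrable (W ε) π := fun ε =>
    integrable_of_measurable_of_abs_le (hWm ε) (hWC ε)
  -- all sign patterns have the same mean
  have hflip : ∀ ε, ∫ ω, W ε ω ∂π = ∫ ω, W (fun _ => true) ω ∂π := by
    intro ε
    set f : Fin n → X × X → X × X := fun i => if ε i then id else Prod.swap with hf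
    have hmp : MeasurePreserving (fun (a : Fin n → X × X) i => f i (a i)) π π := by
      refine measurePreserving_pi _ _ fun i => ?_
      simp only [hf]
      split_ifs
      · exact MeasurePreserving.id _
      · exact Measure.measurePreserving_swap
    have hcomp : ∀ ω, W ε ω = W (fun _ => true) (fun i => f i (ω i)) := by
      intro ω
      simp only [hW]
      congr 1
      funext j
      congr 1
      refine Finset.sum_congr rfl fun i _ => ?_
      simp only [hf]
      cases ε i <;> simp
    calc ∫ ω, W ε ω ∂π = ∫ ω, W (fun _ => true) (fun i => f i (ω i)) ∂π :=
          integral_congr_ae (Eventually.of_forall hcomp)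
      _ = ∫ ω, W (fun _ => true) ω ∂(π.map fun (a : Fin n → X × X) i => f i (a i)) :=
          (integral_map hmp.measurable.aemeasurable (hWm _).aestronglyMeasurable).symm
      _ = _ := by rw [hmp.map_eq]
  -- the deviation is dominated by the symmetrised one
  have hdom : ∫ S, maxDeviation μ g S ∂ν ≤ ∫ ω, W (fun _ => true) ω ∂π := by
    have hmp := measurePreserving_arrowProdEquivProdArrow X X (Fin n) (fun _ => μ) (fun _ => μ)
    set V : (Fin n → X) × (Fin n → X) → ℝ := fun q =>
      Finset.univ.sup' Finset.univ_nonempty fun j =>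
        1 / (n : ℝ) * ∑ i, (g j (q.2 i) - g j (q.1 i)) with hV
    have hVm : Measurable V := by
      refine measurable_sup'_univ fun j => ?_
      exact (Finset.measurable_fun_sum _ fun i _ => ((hgm j).comp
        ((measurable_pi_apply i).comp measurable_snd)).sub ((hgm j).comp
        ((measurable_pi_apply i).comp measurable_fst))).const_mul _
    have hWV : ∀ ω, W (fun _ => true) ω =
        V (MeasurableEquiv.arrowProdEquivProdArrow X X (Fin n) ω) := by
      intro ω
      simp only [hW, hV, boolSign_true, one_mul]
      rfl
    have hVW : ∀ q, V q = W (fun _ => true)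
        ((MeasurableEquiv.arrowProdEquivProdArrow X X (Fin n)).symm q) := by
      intro q
      rw [hWV, MeasurableEquiv.apply_symm_apply]
    have hVC : ∀ q, |V q| ≤ M := fun q => by rw [hVW]; exact hWC _ _
    have hVint : Integrable V (ν.prod ν) := integrable_of_measurable_of_abs_le hVm hVC
    have e : ∫ ω, W (fun _ => true) ω ∂π = ∫ S, ∫ S', V (S, S') ∂ν ∂ν := by
      rw [← integral_prod _ hVint]
      calc _ = ∫ ω, V (MeasurableEquiv.arrowProdEquivProdArrow X X (Fin n) ω) ∂π :=
            integral_congr_ae (Eventually.of_forall hWV)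
        _ = _ := hmp.integral_comp (MeasurableEquiv.measurableEmbedding _) V
    rw [e]
    refine integral_mono (integrable_of_measurable_of_abs_le (measurable_maxDeviation hgm)
      (abs_maxDeviation_le hn hg)) hVint.integral_prod_left fun S => ?_
    refine Finset.sup'_le _ _ fun j hj => ?_
    have hgint : Integrable (g j) μ := integrable_of_measurable_of_abs_le (hgm j)
      fun x => by rw [abs_of_nonneg (hg j x).1]; exact (hg j x).2
    have hgi : ∀ i : Fin n, Integrable (fun S' : Fin n → X => g j (S' i)) ν := fun i =>
      integrable_of_measurable_of_abs_le ((hgm j).comp (measurable_pi_apply i))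
        fun x => by rw [abs_of_nonneg (hg j _).1]; exact (hg j _).2
    have hgi' : ∀ i : Fin n, ∫ S' : Fin n → X, g j (S' i) ∂ν = ∫ z, g j z ∂μ := by
      intro i
      have hmp := measurePreserving_eval (fun _ : Fin n => μ) i
      calc ∫ S' : Fin n → X, g j (S' i) ∂ν = ∫ z, g j z ∂(ν.map (Function.eval i)) :=
            (integral_map hmp.measurable.aemeasurable (hgm j).aestronglyMeasurable).symm
        _ = _ := by rw [hmp.map_eq]
    have hsum : Integrable (fun S' : Fin n → X =>
        1 / (n : ℝ) * ∑ i, (g j (S' i) - g j (S i))) ν :=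
      (integrable_finsetSum _ fun i _ => (hgi i).sub (integrable_const _)).const_mul _
    have hval : ∫ S' : Fin n → X, 1 / (n : ℝ) * ∑ i, (g j (S' i) - g j (S i)) ∂ν =
        ∫ z, g j z ∂μ - 1 / (n : ℝ) * ∑ i, g j (S i) := by
      rw [integral_const_mul, integral_finsetSum Finset.univ
        (f := fun i (S' : Fin n → X) => g j (S' i) - g j (S i)) fun i _ =>
        (hgi i).sub (integrable_const _)]
      have : ∀ i ∈ Finset.univ, ∫ S' : Fin n → X, (g j (S' i) - g j (S i)) ∂ν =
          ∫ z, g j z ∂μ - g j (S i) := by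
        intro i _
        rw [integral_sub (hgi i) (integrable_const _), hgi']
        simp
      rw [Finset.sum_congr rfl this, Finset.sum_sub_distrib, Finset.sum_const, Finset.card_univ,
        Fintype.card_fin, nsmul_eq_mul]
      field_simp
    rw [← hval]
    refine integral_mono hsum ?_ fun S' => ?_
    · exact integrable_of_measurable_of_abs_le (hVm.comp measurable_prodMk_left)
        fun S' => hVC (S, S')
    · exact Finset.le_sup' (fun j => 1 / (n : ℝ) * ∑ i, (g j (S' i) - g j (S i))) hj
  -- the Rademacher bound
  set Q : ℝ := ((Fintype.card (Fin n → Bool) : ℕ) : ℝ) with hQ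
  have hQ0 : 0 < Q := Nat.cast_pos.2 Fintype.card_pos
  have hRle : ∀ S : Fin n → X, (∀ i, S i ∈ G) → ∑ ε, R ε S ≤ Q * r := by
    intro S hS
    choose t ht using fun ε : Fin n → Bool => Finset.exists_mem_eq_sup' Finset.univ_nonempty
      fun j => 1 / (n : ℝ) * ∑ i, boolSign (ε i) * g j (S i)
    have h1 := hr S hS t
    calc ∑ ε, R ε S = 1 / (n : ℝ) * ∑ ε, ∑ i, boolSign (ε i) * g (t ε) (S i) := by
          rw [Finset.mul_sum]
          exact Finset.sum_congr rfl fun ε _ => (ht ε).2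
      _ ≤ 1 / (n : ℝ) * (Q * (n * r)) := by gcongr
      _ = _ := by field_simp
  have hWR : ∀ ε ω, W ε ω ≤ R ε (fun i => (ω i).2) + R (fun i => !ε i) (fun i => (ω i).1) := by
    intro ε ω
    refine Finset.sup'_le _ _ fun j hj => ?_
    have h1 := Finset.le_sup' (fun j => 1 / (n : ℝ) * ∑ i, boolSign (ε i) * g j (ω i).2) hj
    have h2 := Finset.le_sup' (fun j => 1 / (n : ℝ) * ∑ i, boolSign (!ε i) * g j (ω i).1) hj
    refine le_trans (le_of_eq ?_) (add_le_add h1 h2)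
    rw [← mul_add, ← Finset.sum_add_distrib]
    congr 1
    refine Finset.sum_congr rfl fun i _ => ?_
    rw [boolSign_not]; ring
  have hae : ∀ᵐ ω ∂π, ∀ i, (ω i).1 ∈ G ∧ (ω i).2 ∈ G := by
    rw [ae_all_iff]
    intro i
    have h1 : ∀ᵐ q ∂(μ.prod μ), q.1 ∈ G ∧ q.2 ∈ G := by
      filter_upwards [Measure.quasiMeasurePreserving_fst.ae hG,
        Measure.quasiMeasurePreserving_snd.ae hG] with q h1 h2
      exact ⟨h1, h2⟩
    exact (measurePreserving_eval (fun _ : Fin n => μ.prod μ) i).quasiMeasurePreserving.ae h1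
  have hfinal : Q * ∫ ω, W (fun _ => true) ω ∂π ≤ Q * (2 * r) := by
    calc Q * ∫ ω, W (fun _ => true) ω ∂π = ∑ ε, ∫ ω, W ε ω ∂π := by
          rw [Finset.sum_congr rfl fun ε _ => hflip ε, Finset.sum_const, nsmul_eq_mul,
            Finset.card_univ]
      _ = ∫ ω, ∑ ε, W ε ω ∂π := (integral_finsetSum _ fun ε _ => hWint ε).symm
      _ ≤ ∫ _ω, Q * (2 * r) ∂π := by
          refine integral_mono_ae (integrable_finsetSum _ fun ε _ => hWint ε)
            (integrable_const _) ?_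
          filter_upwards [hae] with ω hω
          have h1 := hRle (fun i => (ω i).2) fun i => (hω i).2
          have h2 := hRle (fun i => (ω i).1) fun i => (hω i).1
          calc ∑ ε, W ε ω ≤ ∑ ε, (R ε (fun i => (ω i).2) +
                R (fun i => !ε i) (fun i => (ω i).1)) := Finset.sum_le_sum fun ε _ => hWR ε ω
            _ = ∑ ε, R ε (fun i => (ω i).2) + ∑ ε, R ε (fun i => (ω i).1) := by
                rw [Finset.sum_add_distrib, sum_signs_not fun ε => R ε (fun i => (ω i).1)]
            _ ≤ Q * (2 * r) := by linarith
      _ = _ := by simp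
  exact hdom.trans (le_of_mul_le_mul_left hfinal hQ0)

/-! ### Uniform deviations -/

lemma measure_maxDeviation_gt_le [IsProbabilityMeasure μ] {n : ℕ} (hn : 0 < n) {M : ℝ} (hM : 0 < M) {g : J → X → ℝ}
    (hgm : ∀ j, Measurable (g j)) (hg : ∀ j x, g j x ∈ Set.Icc 0 M) {G : Set X}
    (hG : ∀ᵐ x ∂μ, x ∈ G) {r : ℝ}
    (hr : ∀ S : Fin n → X, (∀ i, S i ∈ G) → ∀ t : (Fin n → Bool) → J,
      ∑ ε : Fin n → Bool, ∑ i, boolSign (ε i) * g (t ε) (S i) ≤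
        (Fintype.card (Fin n → Bool) : ℝ) * (n * r)) {δ : ℝ} (hδ : 0 < δ) (hδ1 : δ ≤ 1) :
    (Measure.pi fun _ : Fin n => μ) {S | ∃ j, 2 * r + M * √(Real.log (1 / δ) / n) <
      ∫ z, g j z ∂μ - 1 / (n : ℝ) * ∑ i, g j (S i)} ≤ ENNReal.ofReal δ := by
  have hn' : (0 : ℝ) < n := Nat.cast_pos.2 hn
  have hlog : 0 ≤ Real.log (1 / δ) := Real.log_nonneg (by rw [le_div_iff₀ hδ]; linarith)
  have hmc := measure_ge_le_of_bounded_differences (μ := μ) (c := M / n) (by positivity) n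
    (maxDeviation μ g) (measurable_maxDeviation hgm) (abs_maxDeviation_le hn hg)
    (fun S i x => by exact abs_maxDeviation_update_le hg S i x)
    (t := M * √(Real.log (1 / δ) / n)) (by positivity)
  have hsub : {S : Fin n → X | ∃ j, 2 * r + M * √(Real.log (1 / δ) / n) <
      ∫ z, g j z ∂μ - 1 / (n : ℝ) * ∑ i, g j (S i)} ⊆
      {S | M * √(Real.log (1 / δ) / n) ≤ maxDeviation μ g S -
        ∫ S', maxDeviation μ g S' ∂Measure.pi fun _ : Fin n => μ} := by
    rintro S ⟨j, hj⟩
    have h1 := integral_maxDeviation_le hn hgm hg hG hr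
    have h2 := Finset.le_sup' (fun j => ∫ z, g j z ∂μ - 1 / (n : ℝ) * ∑ i, g j (S i))
      (Finset.mem_univ j)
    simp only [Set.mem_ofPred_eq, maxDeviation] at h1 ⊢
    linarith
  refine (measure_mono hsub).trans ?_
  rw [← ENNReal.ofReal_toReal (measure_ne_top _ _)]
  refine ENNReal.ofReal_le_ofReal (hmc.trans ?_)
  -- McDiarmid gives `δ²` here, more than the `δ` that is needed.
  have e : -(M * √(Real.log (1 / δ) / n)) ^ 2 / (2 * (n * (M / n / 2) ^ 2)) =
      2 * Real.log δ := by
    rw [mul_pow, Real.sq_sqrt (by positivity), one_div, Real.log_inv]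
    field_simp
  rw [e]
  calc Real.exp (2 * Real.log δ) ≤ Real.exp (Real.log δ) := by
        refine Real.exp_le_exp.2 ?_
        have := Real.log_nonpos hδ.le hδ1
        linarith
    _ = δ := Real.exp_log hδ

end Statistics

/-- Uniform deviation bound for a class with a continuous parametrisation. -/
theorem measure_exists_deviation_gt_le {X : Type*} [MeasurableSpace X] {μ : Measure X}
    [IsProbabilityMeasure μ] {E : Type*} [TopologicalSpace E]
    [SecondCountableTopology E] (A : Set E) {n : ℕ} (hn : 0 < n) {M : ℝ} (hM : 0 < M)
    {g : E → X → ℝ} (hgm : ∀ θ, Measurable (g θ)) (hg : ∀ θ x, g θ x ∈ Set.Icc 0 M)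
    (hcont : ∀ S : Fin n → X,
      Continuous fun θ => ∫ z, g θ z ∂μ - 1 / (n : ℝ) * ∑ i, g θ (S i))
    {G : Set X} (hG : ∀ᵐ x ∂μ, x ∈ G) {r : ℝ}
    (hr : ∀ S : Fin n → X, (∀ i, S i ∈ G) → ∀ t : (Fin n → Bool) → E, (∀ ε, t ε ∈ A) →
      ∑ ε : Fin n → Bool, ∑ i, boolSign (ε i) * g (t ε) (S i) ≤
        (Fintype.card (Fin n → Bool) : ℝ) * (n * r)) {δ : ℝ} (hδ : 0 < δ) (hδ1 : δ ≤ 1) :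
    (Measure.pi fun _ : Fin n => μ) {S | ∃ θ ∈ A, 2 * r + M * √(Real.log (1 / δ) / n) <
      ∫ z, g θ z ∂μ - 1 / (n : ℝ) * ∑ i, g θ (S i)} ≤ ENNReal.ofReal δ := by
  rcases A.eq_empty_or_nonempty with rfl | hA
  · simp
  have : Nonempty A := hA.to_subtype
  -- The strict inequality is open in `θ`, so a violation in `A` is also seen at a point of a
  -- sequence dense in `A`. The finite-class events for its initial segments increase, and the bound
  -- does not depend on their length.
  set u := TopologicalSpace.denseSeq A with hu
  set D : ℕ → Set (Fin n → X) := fun k => {S | ∃ j : Fin (k + 1),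
    2 * r + M * √(Real.log (1 / δ) / n) <
      ∫ z, g (u j) z ∂μ - 1 / (n : ℝ) * ∑ i, g (u j) (S i)} with hD
  have hmono : Monotone D := by
    rintro k l hkl S ⟨j, hj⟩
    exact ⟨⟨j, by omega⟩, hj⟩
  have hsub : {S : Fin n → X | ∃ θ ∈ A, 2 * r + M * √(Real.log (1 / δ) / n) <
      ∫ z, g θ z ∂μ - 1 / (n : ℝ) * ∑ i, g θ (S i)} ⊆ ⋃ k, D k := by
    rintro S ⟨θ, hθ, hlt⟩
    have hopen : IsOpen {a : A | 2 * r + M * √(Real.log (1 / δ) / n) <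
        ∫ z, g a z ∂μ - 1 / (n : ℝ) * ∑ i, g a (S i)} :=
      isOpen_lt continuous_const ((hcont S).comp continuous_subtype_val)
    obtain ⟨k, hk⟩ := (TopologicalSpace.denseRange_denseSeq A).exists_mem_open hopen
      ⟨⟨θ, hθ⟩, hlt⟩
    exact Set.mem_iUnion.2 ⟨k, ⟨k, Nat.lt_succ_self k⟩, hk⟩
  refine (measure_mono hsub).trans ?_
  rw [hmono.measure_iUnion]
  refine iSup_le fun k => ?_
  exact measure_maxDeviation_gt_le hn hM (fun j : Fin (k + 1) => hgm (u j)) (fun j => hg (u j)) hG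
    (fun S hS t => hr S hS (fun ε => u (t ε)) fun ε => (u (t ε)).2) hδ hδ1

end

/-! ### Layer norms along the gradient flow -/

noncomputable section

/-- The square of an indefinite integral. -/
lemma sq_sub_sq_eq_integral {f v : ℝ → ℝ} {T : ℝ} (hT : 0 ≤ T)
    (hv : IntervalIntegrable v volume 0 T)
    (hf : ∀ t ∈ Set.Icc 0 T, f t = f 0 - ∫ s in (0 : ℝ)..t, v s) :
    IntervalIntegrable (fun t => v t * f t) volume 0 T ∧
      f T ^ 2 - f 0 ^ 2 = -2 * ∫ t in (0 : ℝ)..T, v t * f t := by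
  set F : ℝ → ℝ := fun t => ∫ s in (0 : ℝ)..t, v s with hF
  have hac : AbsolutelyContinuousOnInterval F 0 T :=
    hv.absolutelyContinuousOnInterval_intervalIntegral Set.left_mem_uIcc
  have hFT := hac.integral_deriv_mul_eq_sub hac
  have hder : ∀ᵐ t, t ∈ Set.uIcc 0 T → deriv F t = v t := by
    filter_upwards [hv.ae_hasDerivAt_integral] with t ht htm
    exact (ht htm 0 Set.left_mem_uIcc).deriv
  have hvF : IntervalIntegrable (fun t => v t * F t) volume 0 T :=
    hv.mul_continuousOn hac.continuousOn
  have hF0 : F 0 = 0 := intervalIntegral.integral_same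
  have h2 : F T ^ 2 = 2 * ∫ t in (0 : ℝ)..T, v t * F t := by
    rw [← intervalIntegral.integral_const_mul]
    have : ∫ t in (0 : ℝ)..T, (deriv F t * F t + F t * deriv F t) =
        ∫ t in (0 : ℝ)..T, 2 * (v t * F t) := by
      refine intervalIntegral.integral_congr_ae ?_
      filter_upwards [hder] with t ht htm
      rw [ht (Set.uIoc_subset_uIcc htm)]; ring
    rw [← this, hFT, hF0]; ring
  have heq : Set.EqOn (fun t => v t * (f 0 - F t)) (fun t => v t * f t) (Set.uIcc 0 T) := by
    intro t ht
    rw [Set.uIcc_of_le hT] at ht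
    simp only
    rw [hf t ht]
  have hint : IntervalIntegrable (fun t => v t * (f 0 - F t)) volume 0 T :=
    hv.mul_continuousOn (continuousOn_const.sub hac.continuousOn)
  refine ⟨hint.congr fun t ht => heq (Set.uIoc_subset_uIcc ht), ?_⟩
  have h3 : ∫ t in (0 : ℝ)..T, v t * f t = f 0 * F T - ∫ t in (0 : ℝ)..T, v t * F t := by
    rw [← intervalIntegral.integral_congr heq]
    have : (fun t => v t * (f 0 - F t)) = fun t => f 0 * v t - v t * F t := by
      funext t; ring
    rw [this, intervalIntegral.integral_sub (hv.const_mul _) hvF,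
      intervalIntegral.integral_const_mul]
  rw [h3, hf T ⟨hT, le_rfl⟩]
  linear_combination h2

namespace NetShape

variable (N : NetShape)

/-! ### Euler's identity for one layer -/

/-- The parameters with all layers but `l` deleted. -/
def layerPart (l : Fin (N.depth + 1)) (θ : N.Params) : N.Params :=
  WithLp.toLp 2 fun i => if i.1 = l then θ i else 0

lemma continuous_layerPart (l : Fin (N.depth + 1)) : Continuous (N.layerPart l) := by
  refine (PiLp.continuous_toLp 2 _).comp (continuous_pi fun i => ?_)
  split_ifs
  · exact (EuclideanSpace.proj (𝕜 := ℝ) i).continuous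
  · exact continuous_const

lemma inner_layerPart (l : Fin (N.depth + 1)) (v θ : N.Params) :
    inner ℝ v (N.layerPart l θ) = ∑ q : Fin (N.paramCount l), v ⟨l, q⟩ * θ ⟨l, q⟩ := by
  rw [PiLp.inner_apply, ← Finset.univ_sigma_univ, Finset.sum_sigma, Finset.sum_eq_single l]
  · refine Finset.sum_congr rfl fun q _ => ?_
    simp [layerPart, mul_comm]
  · intro l' _ hl'
    refine Finset.sum_eq_zero fun q _ => ?_
    simp [layerPart, hl']
  · simp

lemma norm_layerVec_sq (θ : N.Params) (l : Fin (N.depth + 1)) :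
    ‖N.layerVec θ l‖ ^ 2 = ∑ q : Fin (N.paramCount l), θ ⟨l, q⟩ ^ 2 := by
  rw [layerVec, norm_truncVec_sq, Finset.sum_range]
  refine Finset.sum_congr rfl fun q _ => ?_
  have : (l : ℕ) < N.depth + 1 ∧ (q : ℕ) < N.paramCount l := ⟨l.2, q.2⟩
  simp [coef, this]

lemma coef_add_smul_layerPart (l : Fin (N.depth + 1)) (c : ℝ) (θ : N.Params) (l' i : ℕ) :
    N.coef (θ + (c - 1) • N.layerPart l θ) l' i = (if l' = l then c else 1) * N.coef θ l' i := by
  unfold coef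
  by_cases h : l' < N.depth + 1 ∧ i < N.paramCount l'
  · rw [dif_pos h, dif_pos h]
    by_cases hl : l' = l
    · have : (⟨l', h.1⟩ : Fin (N.depth + 1)) = l := Fin.ext hl
      simp [layerPart, hl]
      ring
    · have : (⟨l', h.1⟩ : Fin (N.depth + 1)) ≠ l := fun e => hl (congrArg Fin.val e)
      simp [layerPart, this, hl]
  · rw [dif_neg h, dif_neg h, mul_zero]

lemma eval_add_smul_layerPart (l : Fin (N.depth + 1)) {c : ℝ} (hc : 0 ≤ c) (p : ℝ) (x : N.Input)
    (θ : N.Params) : N.eval p x (θ + (c - 1) • N.layerPart l θ) = c * N.eval p x θ := by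
  rw [N.eval_of_coef_eq_mul (fun l' => if l' = l then c else 1)
    (fun l' => by split_ifs <;> positivity) (fun l' i => N.coef_add_smul_layerPart l c θ l' i)]
  congr 1
  rw [Finset.prod_ite_eq', if_pos (Finset.mem_range.2 l.2)]

/-- The radial derivative of the empirical risk with respect to any layer. -/
def radialRisk (p : ℝ) {n : ℕ} (S : Fin n → N.Input × ℝ) (θ : N.Params) : ℝ :=
  1 / (n : ℝ) * ∑ i, (N.eval p (S i).1 θ - (S i).2) * N.eval p (S i).1 θ

lemma continuous_eval_right (p : ℝ) (x : N.Input) : Continuous fun θ : N.Params => N.eval p x θ :=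
  (N.continuous_eval p).comp (continuous_const.prodMk continuous_id)

lemma continuous_empRisk (p : ℝ) {n : ℕ} (S : Fin n → N.Input × ℝ) :
    Continuous (N.empRisk p S) := by
  unfold empRisk loss
  exact continuous_const.mul (continuous_finsetSum _ fun i _ => continuous_const.mul
    (((N.continuous_eval_right p _).sub continuous_const).pow 2))

lemma continuous_radialRisk (p : ℝ) {n : ℕ} (S : Fin n → N.Input × ℝ) :
    Continuous (N.radialRisk p S) := by
  unfold radialRisk
  exact continuous_const.mul (continuous_finsetSum _ fun i _ =>
    ((N.continuous_eval_right p _).sub continuous_const).mul (N.continuous_eval_right p _))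

/-- When only layer `l` is scaled by `c`, the outputs become `c f`. Along this ray the risk is an
explicit quadratic polynomial in `c`, whose derivative at `c = 1` does not depend on `l`. -/
lemma inner_gradient_layerPart (p : ℝ) {n : ℕ} (S : Fin n → N.Input × ℝ) {θ : N.Params}
    (hd : DifferentiableAt ℝ (N.empRisk p S) θ) (l : Fin (N.depth + 1)) :
    inner ℝ (gradient (N.empRisk p S) θ) (N.layerPart l θ) = N.radialRisk p S θ := by
  have hpath : HasDerivAt (fun c : ℝ => θ + (c - 1) • N.layerPart l θ) (N.layerPart l θ) 1 := by
    have := (((hasDerivAt_id (1 : ℝ)).sub_const 1).smul_const (N.layerPart l θ)).const_add θ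
    simpa using this
  have hbase : θ + ((1 : ℝ) - 1) • N.layerPart l θ = θ := by simp
  have hF := hd.hasGradientAt.hasFDerivAt
  have h1 : HasDerivAt (fun c : ℝ => N.empRisk p S (θ + (c - 1) • N.layerPart l θ))
      (inner ℝ (gradient (N.empRisk p S) θ) (N.layerPart l θ)) 1 := by
    have := HasFDerivAt.comp_hasDerivAt (1 : ℝ) (by rw [hbase]; exact hF) hpath
    exact this
  have h2 : HasDerivAt (fun c : ℝ => 1 / (n : ℝ) *
      ∑ i, 1 / 2 * (c * N.eval p (S i).1 θ - (S i).2) ^ 2) (N.radialRisk p S θ) 1 := by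
    unfold radialRisk
    refine HasDerivAt.const_mul _ (HasDerivAt.fun_sum fun i _ => ?_)
    have := ((((hasDerivAt_id (1 : ℝ)).mul_const (N.eval p (S i).1 θ)).sub_const
      (S i).2).pow 2).const_mul (1 / 2)
    refine (this.congr_deriv ?_).congr_of_eventuallyEq (Eventually.of_forall fun c => ?_)
    · simp
      ring
    · simp
  refine h1.unique (h2.congr_of_eventuallyEq ?_)
  -- Homogeneity holds for `c ≥ 0` only; near `c = 1` that is enough.
  filter_upwards [lt_mem_nhds (zero_lt_one (α := ℝ))] with c hc
  simp only [empRisk, loss]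
  congr 1
  refine Finset.sum_congr rfl fun i _ => ?_
  rw [N.eval_add_smul_layerPart l hc.le]

/-- Euler's identity is affine in the gradient and continuous in the point, so it survives limits of
gradients and convex combinations. No chain rule for the risk along the trajectory is involved. -/
lemma inner_clarke_layerPart (p : ℝ) {n : ℕ} (S : Fin n → N.Input × ℝ) {θ v : N.Params}
    (hv : v ∈ clarkeSubdifferential (N.empRisk p S) θ) (l : Fin (N.depth + 1)) :
    inner ℝ v (N.layerPart l θ) = N.radialRisk p S θ := by
  have hconv : Convex ℝ {v : N.Params | inner ℝ v (N.layerPart l θ) = N.radialRisk p S θ} := by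
    intro v hv w hw a b _ _ hab
    rw [Set.mem_ofPred_eq] at hv hw ⊢
    rw [inner_add_left, real_inner_smul_left, real_inner_smul_left, hv, hw, ← add_mul, hab,
      one_mul]
  refine convexHull_min ?_ hconv hv
  rintro g ⟨u, hu, hdiff, hg⟩
  have h1 : Tendsto (fun k => inner ℝ (gradient (N.empRisk p S) (u k)) (N.layerPart l (u k)))
      atTop (𝓝 (inner ℝ g (N.layerPart l θ))) :=
    hg.inner (((N.continuous_layerPart l).tendsto θ).comp hu)
  have h2 : Tendsto (fun k => N.radialRisk p S (u k)) atTop (𝓝 (N.radialRisk p S θ)) :=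
    ((N.continuous_radialRisk p S).tendsto θ).comp hu
  refine tendsto_nhds_unique h1 (h2.congr fun k => ?_)
  exact (N.inner_gradient_layerPart p S (hdiff k) l).symm

/-! ### Growth of the layers along the gradient flow -/

/-- With residuals `a = y - f`, the left side is `2 mean(a y) - 2 mean(a²)`. Here `mean(a²)` is
twice the risk, and `mean(a y) ≤ Cy √mean(a²)` by Cauchy–Schwarz. -/
lemma neg_two_mul_radialRisk_le (p : ℝ) {n : ℕ} (hn : 0 < n) {Cy : ℝ} {S : Fin n → N.Input × ℝ}
    (hS : ∀ i, |(S i).2| ≤ Cy) (θ : N.Params) :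
    -2 * N.radialRisk p S θ ≤ 2 * √(2 * N.empRisk p S θ) * (Cy - √(2 * N.empRisk p S θ)) := by
  have hn' : (0 : ℝ) < n := Nat.cast_pos.2 hn
  set a : Fin n → ℝ := fun i => (S i).2 - N.eval p (S i).1 θ with ha
  have hL : 2 * N.empRisk p S θ = 1 / (n : ℝ) * ∑ i, a i ^ 2 := by
    simp only [empRisk, loss, ha, Finset.mul_sum]
    exact Finset.sum_congr rfl fun i _ => by ring
  have hR : -2 * N.radialRisk p S θ = 2 * (1 / (n : ℝ) * ∑ i, a i * (S i).2) -
      2 * (1 / (n : ℝ) * ∑ i, a i ^ 2) := by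
    simp only [radialRisk, ha, Finset.mul_sum, ← Finset.sum_sub_distrib]
    exact Finset.sum_congr rfl fun i _ => by ring
  have hnn : 0 ≤ 1 / (n : ℝ) * ∑ i, a i ^ 2 :=
    mul_nonneg (by positivity) (Finset.sum_nonneg fun _ _ => sq_nonneg _)
  have hCy : 0 ≤ Cy := (abs_nonneg _).trans (hS ⟨0, hn⟩)
  have h1 : ∑ i, a i * (S i).2 ≤ Cy * ∑ i, |a i| := by
    rw [Finset.mul_sum]
    refine Finset.sum_le_sum fun i _ => (le_abs_self _).trans ?_
    rw [abs_mul, mul_comm]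
    exact mul_le_mul_of_nonneg_right (hS i) (abs_nonneg _)
  have h2 : 1 / (n : ℝ) * ∑ i, |a i| ≤ √(1 / (n : ℝ) * ∑ i, a i ^ 2) := by
    refine Real.le_sqrt_of_sq_le ?_
    have := sq_sum_le_card_mul_sum_sq (s := Finset.univ) (f := fun i => |a i|)
    simp only [sq_abs, Finset.card_univ, Fintype.card_fin] at this
    calc (1 / (n : ℝ) * ∑ i, |a i|) ^ 2 = 1 / (n : ℝ) ^ 2 * (∑ i, |a i|) ^ 2 := by ring
      _ ≤ 1 / (n : ℝ) ^ 2 * (n * ∑ i, a i ^ 2) := by gcongr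
      _ = _ := by field_simp
  rw [hR, hL]
  have h3 : 1 / (n : ℝ) * ∑ i, a i * (S i).2 ≤ Cy * √(1 / (n : ℝ) * ∑ i, a i ^ 2) := by
    calc _ ≤ 1 / (n : ℝ) * (Cy * ∑ i, |a i|) := by gcongr
      _ = Cy * (1 / (n : ℝ) * ∑ i, |a i|) := by ring
      _ ≤ _ := by gcongr
  have h4 := Real.mul_self_sqrt hnn
  nlinarith

/-- Along the gradient flow, the squared norm of every layer grows by at most the continuous
cumulative loss. -/
theorem norm_layerVec_sq_le_add_cumLoss (p : ℝ) {n : ℕ} (hn : 0 < n) {Cy : ℝ}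
    {S : Fin n → N.Input × ℝ} (hS : ∀ i, |(S i).2| ≤ Cy) {T : ℝ} (hT : 0 ≤ T)
    {Θ : ℝ → N.Params} (hΘ : IsGradientFlow (N.empRisk p S) T Θ) {l : ℕ} (hl : l ≤ N.depth) :
    ‖N.layerVec (Θ T) l‖ ^ 2 ≤ ‖N.layerVec (Θ 0) l‖ ^ 2 + N.cumLoss p Cy S Θ T := by
  obtain ⟨v, hv, hsub, hint⟩ := hΘ
  set l' : Fin (N.depth + 1) := ⟨l, Nat.lt_succ_of_le hl⟩ with hl'
  have hcoord : ∀ q : Fin (N.paramCount l'),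
      IntervalIntegrable (fun t => v t ⟨l', q⟩ * Θ t ⟨l', q⟩) volume 0 T ∧
      Θ T ⟨l', q⟩ ^ 2 - Θ 0 ⟨l', q⟩ ^ 2 =
        -2 * ∫ t in (0 : ℝ)..T, v t ⟨l', q⟩ * Θ t ⟨l', q⟩ := by
    intro q
    set P := EuclideanSpace.proj (𝕜 := ℝ)
      (⟨l', q⟩ : Σ l : Fin (N.depth + 1), Fin (N.paramCount l)) with hP
    have hvq : ∀ t ∈ Set.Icc 0 T, IntervalIntegrable v volume 0 t := fun t ht =>
      hv.mono_set (by
        rw [Set.uIcc_of_le ht.1, Set.uIcc_of_le hT]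
        exact Set.Icc_subset_Icc_right ht.2)
    refine sq_sub_sq_eq_integral (f := fun t => Θ t ⟨l', q⟩) (v := fun t => v t ⟨l', q⟩) hT
      ?_ fun t ht => ?_
    · exact ⟨P.integrable_comp hv.1, P.integrable_comp hv.2⟩
    · have h1 := P.intervalIntegral_comp_comm (hvq t ht)
      have h2 := congrArg P (hint t ht)
      rw [map_sub, ← h1] at h2
      exact h2
  have hcontΘ : ContinuousOn Θ (Set.Icc 0 T) := by
    have h1 : ContinuousOn (fun t => Θ 0 - ∫ s in (0 : ℝ)..t, v s) (Set.Icc 0 T) := by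
      refine continuousOn_const.sub ?_
      have := intervalIntegral.continuousOn_primitive_interval (μ := volume) (f := v)
        (a := 0) (b := T) (by
          rw [Set.uIcc_of_le hT]
          rw [← intervalIntegrable_iff_integrableOn_Icc_of_le hT]
          exact hv)
      rwa [Set.uIcc_of_le hT] at this
    exact h1.congr fun t ht => hint t ht
  have hh : ContinuousOn (fun t => N.radialRisk p S (Θ t)) (Set.uIcc 0 T) := by
    rw [Set.uIcc_of_le hT]
    exact (N.continuous_radialRisk p S).comp_continuousOn hcontΘ
  have hc : ContinuousOn (fun t => 2 * √(2 * N.empRisk p S (Θ t)) *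
      (Cy - √(2 * N.empRisk p S (Θ t)))) (Set.uIcc 0 T) := by
    rw [Set.uIcc_of_le hT]
    have h1 : ContinuousOn (fun t => √(2 * N.empRisk p S (Θ t))) (Set.Icc 0 T) :=
      (continuousOn_const.mul ((N.continuous_empRisk p S).comp_continuousOn hcontΘ)).sqrt
    exact (continuousOn_const.mul h1).mul (continuousOn_const.sub h1)
  have hsum : ‖N.layerVec (Θ T) l‖ ^ 2 - ‖N.layerVec (Θ 0) l‖ ^ 2 =
      ∫ t in (0 : ℝ)..T, -2 * N.radialRisk p S (Θ t) := by
    have e1 := N.norm_layerVec_sq (Θ T) l'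
    have e2 := N.norm_layerVec_sq (Θ 0) l'
    -- Summed over the coordinates of the layer, the coordinatewise identities produce the Euler
    -- pairing, known at almost every time.
    have e3 : ∫ t in (0 : ℝ)..T, N.radialRisk p S (Θ t) =
        ∫ t in (0 : ℝ)..T, ∑ q : Fin (N.paramCount l'), v t ⟨l', q⟩ * Θ t ⟨l', q⟩ := by
      refine intervalIntegral.integral_congr_ae ?_
      filter_upwards [hsub] with t ht htm
      rw [Set.uIoc_of_le hT] at htm
      rw [← N.inner_clarke_layerPart p S (ht ⟨htm.1.le, htm.2⟩) l', inner_layerPart]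
    change ‖N.layerVec (Θ T) l'‖ ^ 2 - ‖N.layerVec (Θ 0) l'‖ ^ 2 = _
    rw [e1, e2, ← Finset.sum_sub_distrib, Finset.sum_congr rfl fun q _ => (hcoord q).2,
      ← Finset.mul_sum, intervalIntegral.integral_const_mul, e3,
      intervalIntegral.integral_finsetSum fun q _ => (hcoord q).1]
  have hmono : ∫ t in (0 : ℝ)..T, -2 * N.radialRisk p S (Θ t) ≤ N.cumLoss p Cy S Θ T := by
    refine intervalIntegral.integral_mono_on hT (hh.intervalIntegrable.const_mul _)
      hc.intervalIntegrable fun t _ => ?_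
    exact N.neg_two_mul_radialRisk_le p hn hS (Θ t)
  linarith

end NetShape

end

noncomputable section

/-! ### The norms of the layers at the initialization -/

open scoped NNReal ENNReal

/-- The factor `exp (x² / 4v)` halves the Gaussian exponent: the product is `√2` times the density
of variance `2v`. -/
lemma lintegral_exp_sq_gaussianReal {v : ℝ≥0} (hv : v ≠ 0) :
    ∫⁻ x, ENNReal.ofReal (Real.exp (x ^ 2 / (4 * v))) ∂gaussianReal 0 v = ENNReal.ofReal √2 := by
  have hv' : (0 : ℝ) < v := NNReal.coe_pos.2 (pos_iff_ne_zero.2 hv)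
  have h2v : (2 * v : ℝ≥0) ≠ 0 := mul_ne_zero two_ne_zero hv
  rw [gaussianReal_of_var_ne_zero _ hv, lintegral_withDensity_eq_lintegral_mul _
    (measurable_gaussianPDF 0 v) (by fun_prop)]
  have : ∀ x, (gaussianPDF 0 v * fun x => ENNReal.ofReal (Real.exp (x ^ 2 / (4 * v)))) x =
      ENNReal.ofReal √2 * gaussianPDF 0 (2 * v) x := by
    intro x
    simp only [Pi.mul_apply, gaussianPDF]
    rw [← ENNReal.ofReal_mul (gaussianPDFReal_nonneg _ _ _),
      ← ENNReal.ofReal_mul (Real.sqrt_nonneg _)]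
    congr 1
    simp only [gaussianPDFReal, NNReal.coe_mul, NNReal.coe_ofNat, sub_zero]
    rw [mul_assoc, ← Real.exp_add, ← mul_assoc]
    have e1 : (√(2 * Real.pi * v))⁻¹ = √2 * (√(2 * Real.pi * (2 * v)))⁻¹ := by
      rw [show 2 * Real.pi * (2 * (v : ℝ)) = 2 * (2 * Real.pi * v) by ring,
        Real.sqrt_mul zero_le_two, mul_inv, ← mul_assoc, mul_inv_cancel₀ (by positivity), one_mul]
    rw [e1]
    congr 2
    field_simp
    ring
  rw [lintegral_congr this, lintegral_const_mul _ (measurable_gaussianPDF _ _),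
    lintegral_gaussianPDF_eq_one 0 h2v, mul_one]

namespace NetShape

variable (N : NetShape)

lemma paramCount_pos {l : ℕ} (hl : l ≤ N.depth) : 0 < N.paramCount l := by
  unfold paramCount
  split_ifs with h1 h2
  · exact N.kernel_pos l h1
  · exact Nat.mul_pos (N.width_pos l hl) (N.width_pos (l + 1) h2)
  · exact N.width_pos _ le_rfl

instance (κ : ℝ) : IsProbabilityMeasure (N.initLaw κ) := by
  unfold initLaw
  exact Measure.isProbabilityMeasure_map (by fun_prop)

/-- As the variance is `κ² / q(l)`, the exponent is the average over the layer of `x² / 4v`.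
Jensen's inequality reduces it to a single coordinate, uniformly in `q(l)`. -/
lemma lintegral_exp_norm_layerVec_sq_le {κ : ℝ} (hκ : κ ≠ 0) {l : ℕ} (hl : l ≤ N.depth) :
    ∫⁻ θ, ENNReal.ofReal (Real.exp (‖N.layerVec θ l‖ ^ 2 / (4 * κ ^ 2))) ∂N.initLaw κ ≤
      ENNReal.ofReal √2 := by
  set l' : Fin (N.depth + 1) := ⟨l, Nat.lt_succ_of_le hl⟩ with hl'
  have hq : (0 : ℝ) < N.paramCount l' := Nat.cast_pos.2 (N.paramCount_pos hl)
  have hκ2 : 0 < κ ^ 2 := by positivity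
  set v : ℝ≥0 := Real.toNNReal (κ ^ 2 / (N.paramCount l' : ℝ)) with hv
  have hvr : (v : ℝ) = κ ^ 2 / N.paramCount l' := Real.coe_toNNReal _ (by positivity)
  have hv0 : v ≠ 0 := by
    rw [← NNReal.coe_ne_zero, hvr]
    positivity
  have hjensen : ∀ θ : N.Params, Real.exp (‖N.layerVec θ l‖ ^ 2 / (4 * κ ^ 2)) ≤
      ∑ q : Fin (N.paramCount l'), 1 / (N.paramCount l' : ℝ) *
        Real.exp (θ ⟨l', q⟩ ^ 2 / (4 * v)) := by
    intro θ
    have h := convexOn_exp.map_sum_le (t := Finset.univ)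
      (w := fun _ : Fin (N.paramCount l') => 1 / (N.paramCount l' : ℝ))
      (p := fun q => θ ⟨l', q⟩ ^ 2 / (4 * v)) (fun _ _ => by positivity)
      (by simp [hq.ne']) (fun _ _ => Set.mem_univ _)
    simp only [smul_eq_mul] at h
    refine le_of_eq_of_le (congrArg Real.exp ?_) h
    change ‖N.layerVec θ l'‖ ^ 2 / (4 * κ ^ 2) = _
    rw [N.norm_layerVec_sq θ l', Finset.sum_div]
    refine Finset.sum_congr rfl fun q _ => ?_
    rw [hvr]
    field_simp
  have hmeas : ∀ q : Fin (N.paramCount l'), Measurable fun θ : N.Params =>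
      ENNReal.ofReal (1 / (N.paramCount l' : ℝ) * Real.exp (θ ⟨l', q⟩ ^ 2 / (4 * v))) := by
    intro q
    fun_prop
  have hcoord : ∀ q : Fin (N.paramCount l'),
      ∫⁻ θ : N.Params, ENNReal.ofReal (1 / (N.paramCount l' : ℝ) *
        Real.exp (θ ⟨l', q⟩ ^ 2 / (4 * v))) ∂N.initLaw κ =
      ENNReal.ofReal (1 / (N.paramCount l' : ℝ)) * ENNReal.ofReal √2 := by
    intro q
    have h1 : ∀ θ : N.Params, ENNReal.ofReal (1 / (N.paramCount l' : ℝ) *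
        Real.exp (θ ⟨l', q⟩ ^ 2 / (4 * v))) = ENNReal.ofReal (1 / (N.paramCount l' : ℝ)) *
        ENNReal.ofReal (Real.exp (θ ⟨l', q⟩ ^ 2 / (4 * v))) :=
      fun θ => ENNReal.ofReal_mul (by positivity)
    rw [lintegral_congr h1, lintegral_const_mul _ (by fun_prop), initLaw,
      lintegral_map (by fun_prop) (by fun_prop)]
    congr 1
    have hmp := measurePreserving_eval
      (fun i : Σ l : Fin (N.depth + 1), Fin (N.paramCount l) =>
        gaussianReal 0 (Real.toNNReal (κ ^ 2 / (N.paramCount i.1 : ℝ)))) ⟨l', q⟩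
    rw [← lintegral_exp_sq_gaussianReal hv0]
    exact hmp.lintegral_comp (f := fun x => ENNReal.ofReal (Real.exp (x ^ 2 / (4 * v))))
      (by fun_prop)
  calc _ ≤ ∫⁻ θ : N.Params, ∑ q : Fin (N.paramCount l'), ENNReal.ofReal
        (1 / (N.paramCount l' : ℝ) * Real.exp (θ ⟨l', q⟩ ^ 2 / (4 * v))) ∂N.initLaw κ := by
        refine lintegral_mono fun θ => ?_
        rw [← ENNReal.ofReal_sum_of_nonneg fun q _ => by positivity]
        exact ENNReal.ofReal_le_ofReal (hjensen θ)
    _ = ∑ q : Fin (N.paramCount l'), ENNReal.ofReal (1 / (N.paramCount l' : ℝ)) *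
        ENNReal.ofReal √2 := by
        rw [lintegral_finsetSum _ fun q _ => hmeas q]
        exact Finset.sum_congr rfl fun q _ => hcoord q
    _ = ENNReal.ofReal √2 := by
        rw [Finset.sum_const, Finset.card_univ, Fintype.card_fin, nsmul_eq_mul, ← mul_assoc,
          ← ENNReal.ofReal_natCast, ← ENNReal.ofReal_mul hq.le, mul_one_div_cancel hq.ne',
          ENNReal.ofReal_one, one_mul]

lemma initLaw_exists_norm_layerVec_sq_gt_le {κ : ℝ} (hκ : κ ≠ 0) (u : ℝ) :
    N.initLaw κ {θ | ∃ l ≤ N.depth, 4 * u * κ ^ 2 < ‖N.layerVec θ l‖ ^ 2} ≤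
      ENNReal.ofReal (2 * ((N.depth : ℝ) + 1) * Real.exp (-u)) := by
  have hκ2 : 0 < κ ^ 2 := by positivity
  have hlayer : ∀ l ∈ Finset.range (N.depth + 1),
      N.initLaw κ {θ | 4 * u * κ ^ 2 < ‖N.layerVec θ l‖ ^ 2} ≤
        ENNReal.ofReal (2 * Real.exp (-u)) := by
    intro l hl
    have hl' : l ≤ N.depth := Nat.lt_succ_iff.1 (Finset.mem_range.1 hl)
    have hsub : {θ | 4 * u * κ ^ 2 < ‖N.layerVec θ l‖ ^ 2} ⊆ {θ | ENNReal.ofReal (Real.exp u) ≤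
        ENNReal.ofReal (Real.exp (‖N.layerVec θ l‖ ^ 2 / (4 * κ ^ 2)))} := by
      intro θ hθ
      rw [Set.mem_ofPred_eq] at hθ ⊢
      refine ENNReal.ofReal_le_ofReal (Real.exp_le_exp.2 ?_)
      rw [le_div_iff₀ (by positivity)]
      nlinarith
    have hmeas : Measurable fun θ : N.Params =>
        ENNReal.ofReal (Real.exp (‖N.layerVec θ l‖ ^ 2 / (4 * κ ^ 2))) := by
      have : (fun θ : N.Params => ‖N.layerVec θ l‖ ^ 2) = fun θ : N.Params =>
          ∑ q : Fin (N.paramCount (⟨l, Finset.mem_range.1 hl⟩ : Fin (N.depth + 1))),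
            θ ⟨⟨l, Finset.mem_range.1 hl⟩, q⟩ ^ 2 :=
        funext fun θ => N.norm_layerVec_sq θ ⟨l, Finset.mem_range.1 hl⟩
      have h2 : Measurable fun θ : N.Params => ‖N.layerVec θ l‖ ^ 2 := by
        rw [this]
        fun_prop
      fun_prop
    calc _ ≤ _ := measure_mono hsub
      _ ≤ (∫⁻ θ, ENNReal.ofReal (Real.exp (‖N.layerVec θ l‖ ^ 2 / (4 * κ ^ 2))) ∂N.initLaw κ) /
          ENNReal.ofReal (Real.exp u) :=
        meas_ge_le_lintegral_div hmeas.aemeasurable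
          (ENNReal.ofReal_pos.2 (Real.exp_pos u)).ne' ENNReal.ofReal_ne_top
      _ ≤ ENNReal.ofReal √2 / ENNReal.ofReal (Real.exp u) :=
        ENNReal.div_le_div_right (N.lintegral_exp_norm_layerVec_sq_le hκ hl') _
      _ = ENNReal.ofReal (√2 * Real.exp (-u)) := by
        rw [← ENNReal.ofReal_div_of_pos (Real.exp_pos u), Real.exp_neg, div_eq_mul_inv]
      _ ≤ _ := by
        refine ENNReal.ofReal_le_ofReal (mul_le_mul_of_nonneg_right ?_ (Real.exp_pos _).le)
        exact Real.sqrt_le_iff.2 ⟨zero_le_two, by norm_num⟩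
  have hset : {θ : N.Params | ∃ l ≤ N.depth, 4 * u * κ ^ 2 < ‖N.layerVec θ l‖ ^ 2} =
      ⋃ l ∈ Finset.range (N.depth + 1), {θ | 4 * u * κ ^ 2 < ‖N.layerVec θ l‖ ^ 2} := by
    ext θ
    simp
  rw [hset]
  calc _ ≤ ∑ l ∈ Finset.range (N.depth + 1),
        N.initLaw κ {θ | 4 * u * κ ^ 2 < ‖N.layerVec θ l‖ ^ 2} := measure_biUnion_finset_le _ _
    _ ≤ ∑ l ∈ Finset.range (N.depth + 1), ENNReal.ofReal (2 * Real.exp (-u)) :=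
      Finset.sum_le_sum hlayer
    _ = _ := by
      rw [Finset.sum_const, Finset.card_range, nsmul_eq_mul, ← ENNReal.ofReal_natCast,
        ← ENNReal.ofReal_mul (Nat.cast_nonneg _)]
      congr 1
      push_cast
      ring

end NetShape

end

/-! ### Uniform generalization on one ball and on a sequence of balls -/

noncomputable section

/-! ### Clipping -/

/-- Projection of a real number to `[-c, c]`. -/
def clip (c x : ℝ) : ℝ := Max.max (-c) (Min.min c x)

lemma continuous_clip (c : ℝ) : Continuous (clip c) := by
  unfold clip
  fun_prop

lemma clip_eq_self {c x : ℝ} (h : |x| ≤ c) : clip c x = x := by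
  rw [clip, min_eq_right (abs_le.1 h).2, max_eq_right (abs_le.1 h).1]

lemma abs_clip_le {c : ℝ} (hc : 0 ≤ c) (x : ℝ) : |clip c x| ≤ c :=
  abs_le.2 ⟨le_max_left _ _, max_le (by linarith) (min_le_left _ _)⟩

lemma abs_clip_sub_clip_le (c x y : ℝ) : |clip c x - clip c y| ≤ |x - y| := by
  refine (abs_max_sub_max_le_max _ _ _ _).trans (max_le (by simp) ?_)
  exact (abs_min_sub_min_le_max _ _ _ _).trans (max_le (by simp) le_rfl)

namespace NetShape

variable (N : NetShape)

/-- The quadratic loss with network output clipped to `[-c, c]` and label clipped to `[-1, 1]`. -/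
def clipLoss (p c : ℝ) (θ : N.Params) (z : N.Input × ℝ) : ℝ :=
  1 / 2 * (clip c (N.eval p z.1 θ) - clip 1 z.2) ^ 2

lemma continuous_clipLoss_left (p c : ℝ) (z : N.Input × ℝ) :
    Continuous fun θ => N.clipLoss p c θ z :=
  continuous_const.mul ((((continuous_clip c).comp (N.continuous_eval_right p z.1)).sub
    continuous_const).pow 2)

lemma continuous_clipLoss (p c : ℝ) (θ : N.Params) : Continuous (N.clipLoss p c θ) := by
  have h : Continuous fun z : N.Input × ℝ => N.eval p z.1 θ :=
    (N.continuous_eval p).comp (continuous_fst.prodMk continuous_const)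
  exact continuous_const.mul ((((continuous_clip c).comp h).sub
    ((continuous_clip 1).comp continuous_snd)).pow 2)

lemma clipLoss_mem_Icc (p : ℝ) {c : ℝ} (hc : 0 ≤ c) (θ : N.Params) (z : N.Input × ℝ) :
    N.clipLoss p c θ z ∈ Set.Icc 0 (1 / 2 * (c + 1) ^ 2) := by
  refine ⟨by unfold clipLoss; positivity, ?_⟩
  have h : |clip c (N.eval p z.1 θ) - clip 1 z.2| ≤ c + 1 :=
    (abs_sub _ _).trans (add_le_add (abs_clip_le hc _) (abs_clip_le zero_le_one _))
  exact mul_le_mul_of_nonneg_left (sq_le_sq.2 (h.trans (le_abs_self _))) (by norm_num)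

lemma clipLoss_eq_loss {p c : ℝ} {θ : N.Params} {z : N.Input × ℝ} (h : |N.eval p z.1 θ| ≤ c)
    (hz : |z.2| ≤ 1) : N.clipLoss p c θ z = N.loss p z θ := by
  rw [clipLoss, loss, clip_eq_self h, clip_eq_self hz]

/-- A difference of squares, with both residuals at most `c + 1`. In this form the contraction
principle replaces the loss by `c + 1` times the network. -/
lemma abs_clipLoss_sub_clipLoss_le (p : ℝ) {c : ℝ} (hc : 0 ≤ c) (s t : N.Params)
    (z : N.Input × ℝ) : |N.clipLoss p c s z - N.clipLoss p c t z| ≤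
      |(c + 1) * N.eval p z.1 s - (c + 1) * N.eval p z.1 t| := by
  set a := clip c (N.eval p z.1 s) with ha
  set b := clip c (N.eval p z.1 t) with hb
  set y := clip 1 z.2 with hy
  have e : N.clipLoss p c s z - N.clipLoss p c t z = (1 / 2 * ((a - y) + (b - y))) * (a - b) := by
    simp only [clipLoss, ← ha, ← hb, ← hy]
    ring
  have h1 : |1 / 2 * ((a - y) + (b - y))| ≤ c + 1 := by
    have ha' := abs_le.1 (abs_clip_le hc (N.eval p z.1 s))
    have hb' := abs_le.1 (abs_clip_le hc (N.eval p z.1 t))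
    have hy' := abs_le.1 (abs_clip_le zero_le_one z.2)
    rw [← ha] at ha'
    rw [← hb] at hb'
    rw [← hy] at hy'
    refine abs_le.2 ⟨?_, ?_⟩ <;> linarith [ha'.1, ha'.2, hb'.1, hb'.2, hy'.1, hy'.2]
  rw [e, abs_mul, ← mul_sub, abs_mul (c + 1), abs_of_nonneg (by linarith : 0 ≤ c + 1)]
  exact mul_le_mul h1 (abs_clip_sub_clip_le _ _ _) (abs_nonneg _) (by linarith)

/-! ### Uniform generalization on balls -/

/-- The parameters whose layers have norm at most `ρ` and for which the network is bounded by `c`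
on the unit ball. -/
def boundedParams (p c ρ : ℝ) : Set N.Params :=
  {θ | (∀ l ≤ N.depth, ‖N.layerVec θ l‖ ≤ ρ) ∧ ∀ x : N.Input, ‖x‖ ≤ 1 → |N.eval p x θ| ≤ c}

lemma measure_exists_genError_gt_le (p : ℝ) {c : ℝ} (hc : 0 < c) {n : ℕ} (hn : 0 < n)
    {μ : Measure (N.Input × ℝ)} [IsProbabilityMeasure μ]
    (hμ : ∀ᵐ z ∂μ, ‖z.1‖ ≤ 1 ∧ |z.2| ≤ 1) {ρ : ℝ} (hρ : 0 ≤ ρ) {δ : ℝ} (hδ : 0 < δ)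
    (hδ1 : δ ≤ 1) :
    (Measure.pi fun _ : Fin n => μ) {S | (∀ i, ‖(S i).1‖ ≤ 1 ∧ |(S i).2| ≤ 1) ∧
        ∃ θ ∈ N.boundedParams p c ρ,
        2 * ((c + 1) * (190 * N.complexityConst / (N.outWidth : ℝ) ^ p * ρ ^ (N.depth + 1)) / √n)
          + 1 / 2 * (c + 1) ^ 2 * √(Real.log (1 / δ) / n) < N.genError p μ S θ} ≤
      ENNReal.ofReal δ := by
  have hn' : (0 : ℝ) < n := Nat.cast_pos.2 hn
  have : Nonempty (Fin n) := ⟨⟨0, hn⟩⟩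
  set r := (c + 1) * (190 * N.complexityConst / (N.outWidth : ℝ) ^ p * ρ ^ (N.depth + 1)) / √n
    with hr
  have hmain := measure_exists_deviation_gt_le (μ := μ) (N.boundedParams p c ρ) hn
    (M := 1 / 2 * (c + 1) ^ 2) (by positivity) (g := N.clipLoss p c)
    (fun θ => (N.continuous_clipLoss p c θ).measurable) (N.clipLoss_mem_Icc p hc.le) ?_ hμ
    (r := r) ?_ hδ hδ1
  · refine (measure_mono ?_).trans hmain
    rintro S ⟨hS, θ, hθ, hlt⟩
    -- Clipping changes neither risk here, since outputs are bounded by `c` on the unit ball and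
    -- labels by `1`. It only makes the loss bounded and Lipschitz for all parameters and data.
    refine ⟨θ, hθ, hlt.trans_eq ?_⟩
    unfold genError popRisk empRisk
    congr 1
    · refine integral_congr_ae ?_
      filter_upwards [hμ] with z hz
      exact (N.clipLoss_eq_loss (hθ.2 _ hz.1) hz.2).symm
    · congr 1
      exact Finset.sum_congr rfl fun i _ =>
        (N.clipLoss_eq_loss (hθ.2 _ (hS i).1) (hS i).2).symm
  · intro S
    refine Continuous.sub ?_ (continuous_const.mul (continuous_finsetSum _ fun i _ =>
      N.continuous_clipLoss_left p c (S i)))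
    refine continuous_of_dominated (bound := fun _ => 1 / 2 * (c + 1) ^ 2)
      (fun θ => (N.continuous_clipLoss p c θ).aestronglyMeasurable)
      (fun θ => Eventually.of_forall fun z => ?_) (integrable_const _)
      (Eventually.of_forall fun z => N.continuous_clipLoss_left p c z)
    have h := N.clipLoss_mem_Icc p hc.le θ z
    rw [Real.norm_eq_abs, abs_of_nonneg h.1]
    exact h.2
  · intro S hS t ht
    refine sum_lipschitz_le (N.boundedParams p c ρ) (fun θ i => N.clipLoss p c θ (S i))
      (fun θ i => (c + 1) * N.eval p (S i).1 θ)
      (fun i s _ t _ => N.abs_clipLoss_sub_clipLoss_le p hc.le s t (S i)) _ ?_ t ht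
    intro θ hθ
    have h := N.sum_sign_mul_eval_le p (fun i => (hS i).1) hρ θ fun ε => (hθ ε).1
    rw [Fintype.card_fin] at h
    calc _ = (c + 1) * ∑ ε, ∑ i, boolSign (ε i) * N.eval p (S i).1 (θ ε) := by
          simp only [Finset.mul_sum]
          exact Finset.sum_congr rfl fun ε _ => Finset.sum_congr rfl fun i _ => by ring
      _ ≤ (c + 1) * _ := mul_le_mul_of_nonneg_left h (by linarith)
      _ = _ := by
          have hs : (n : ℝ) / √n = √n := Real.div_sqrt
          rw [hr]
          nth_rewrite 1 [← hs]
          ring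

/-! ### All balls at once -/

/-- The radius of the `j`-th ball. -/
def levelRadius (p : ℝ) (j : ℕ) : ℝ :=
  (2 ^ j / (N.complexityConst / (N.outWidth : ℝ) ^ p)) ^ ((((N.depth + 1 : ℕ) : ℝ))⁻¹)

lemma complexityConst_div_pos (p : ℝ) : 0 < N.complexityConst / (N.outWidth : ℝ) ^ p :=
  div_pos (zero_lt_one.trans_le N.one_le_complexityConst) (N.outWidth_rpow_pos p)

lemma levelRadius_nonneg (p : ℝ) (j : ℕ) : 0 ≤ N.levelRadius p j := by
  have := N.complexityConst_div_pos p
  unfold levelRadius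
  positivity

/-- The levels are dyadic in complexity, not in norm. Choosing the nearest level then loses a factor
`2` rather than a power of the depth. -/
lemma complexityConst_div_mul_levelRadius_pow (p : ℝ) (j : ℕ) :
    N.complexityConst / (N.outWidth : ℝ) ^ p * N.levelRadius p j ^ (N.depth + 1) = 2 ^ j := by
  have := N.complexityConst_div_pos p
  rw [levelRadius, Real.rpow_inv_natCast_pow (by positivity) (Nat.succ_ne_zero _),
    mul_div_cancel₀ _ this.ne']

end NetShape

lemma exists_le_two_pow_le {X : ℝ} (hX : 0 ≤ X) : ∃ j : ℕ, X ≤ 2 ^ j ∧ (2 : ℝ) ^ j ≤ 2 * X + 1 := by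
  rcases le_total X 1 with h | h
  · refine ⟨0, by simpa using h, ?_⟩
    simp only [pow_zero]
    linarith
  · obtain ⟨j, h1, h2⟩ := exists_nat_pow_near h one_lt_two
    refine ⟨j + 1, h2.le, ?_⟩
    rw [pow_succ]
    linarith

/-- The cost of the confidence `δ 2^(-j-2)` at level `j` is dominated by the complexity `2^j` of
that level. -/
lemma sqrt_add_two_mul_log_two_le (j : ℕ) : √(((j : ℝ) + 2) * Real.log 2) ≤ 2 * 2 ^ j := by
  refine Real.sqrt_le_iff.2 ⟨by positivity, ?_⟩
  have h1 : (j : ℝ) + 1 ≤ 2 ^ j := by exact_mod_cast Nat.lt_two_pow_self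
  have h2 : Real.log 2 ≤ 1 := Real.log_two_lt_d9.le.trans (by norm_num)
  have h3 : 0 ≤ (j : ℝ) := Nat.cast_nonneg j
  calc ((j : ℝ) + 2) * Real.log 2 ≤ ((j : ℝ) + 2) * 1 := by gcongr
    _ ≤ (2 * ((j : ℝ) + 1)) ^ 2 := by nlinarith
    _ ≤ _ := by gcongr

lemma tsum_ofReal_mul_inv_two_pow (δ : ℝ) (hδ : 0 ≤ δ) :
    ∑' j : ℕ, ENNReal.ofReal (δ * (1 / 2) ^ (j + 2)) = ENNReal.ofReal (δ / 2) := by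
  have h : HasSum (fun j : ℕ => δ * (1 / 2 : ℝ) ^ (j + 2)) (δ / 2) := by
    have := (hasSum_geometric_two).mul_left (δ / 4)
    rw [show δ / 4 * 2 = δ / 2 by ring] at this
    refine this.congr_fun fun j => ?_
    ring
  rw [← ENNReal.ofReal_tsum_of_nonneg (fun j => by positivity) h.summable, h.tsum_eq]

end

/-! ### From the levels to the actual layer norms -/

noncomputable section

/-- The sum of the complexity and confidence terms of level `j`, for a parameter of complexity
`X` with `2 ^ j ≤ 2 * X + 1`. -/
lemma level_bound_le {c : ℝ} (hc : 0 < c) {δ₀ δ : ℝ} (hδ₀ : δ₀ < 1) (hδ : 0 < δ) (hle : δ ≤ δ₀)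
    {n : ℕ} (hn : 0 < n) {X : ℝ} (hX : 0 ≤ X) {j : ℕ} (hj : (2 : ℝ) ^ j ≤ 2 * X + 1) :
    2 * ((c + 1) * (190 * 2 ^ j) / √n) +
      1 / 2 * (c + 1) ^ 2 * √(Real.log (1 / (δ * (1 / 2) ^ (j + 2))) / n) ≤
    (380 * (c + 1) + (c + 1) ^ 2) * (2 + 1 / √(Real.log (1 / δ₀)) + 1) *
      (X / √n + √(Real.log (1 / δ) / n)) := by
  have hn' : (0 : ℝ) < √n := Real.sqrt_pos.2 (Nat.cast_pos.2 hn)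
  have hδ₀p : 0 < δ₀ := hδ.trans_le hle
  have hlog₀ : 0 < Real.log (1 / δ₀) := Real.log_pos (by rw [lt_div_iff₀ hδ₀p]; linarith)
  have hlog : Real.log (1 / δ₀) ≤ Real.log (1 / δ) :=
    Real.log_le_log (by positivity) (by gcongr)
  have hs₀ : 0 < √(Real.log (1 / δ₀)) := Real.sqrt_pos.2 hlog₀
  set s := √(Real.log (1 / δ)) with hs
  have hss : √(Real.log (1 / δ₀)) ≤ s := Real.sqrt_le_sqrt hlog
  have e1 : Real.log (1 / (δ * (1 / 2) ^ (j + 2))) =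
      Real.log (1 / δ) + ((j : ℝ) + 2) * Real.log 2 := by
    rw [show 1 / (δ * (1 / 2 : ℝ) ^ (j + 2)) = 1 / δ * 2 ^ (j + 2) by
      rw [one_div_pow]; field_simp, Real.log_mul (by positivity) (by positivity), Real.log_pow]
    push_cast
    ring
  have h1 : √(Real.log (1 / (δ * (1 / 2) ^ (j + 2))) / n) ≤ (s + 2 * 2 ^ j) / √n := by
    rw [e1, Real.sqrt_div' _ (Nat.cast_nonneg n)]
    gcongr
    have h := sqrt_add_two_mul_log_two_le j
    rw [Real.sqrt_le_left (by positivity)] at h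
    have hsq := Real.sq_sqrt (hlog₀.le.trans hlog)
    refine Real.sqrt_le_iff.2 ⟨by positivity, ?_⟩
    have : 0 ≤ s * 2 ^ j := by positivity
    nlinarith
  have h2 : √(Real.log (1 / δ) / n) = s / √n := Real.sqrt_div' _ (Nat.cast_nonneg n)
  rw [h2, ← add_div, mul_div_assoc' _ (X + s), le_div_iff₀ hn']
  -- The additive `1` in `2 * X + 1` must be paid by `√log(1/δ)`, which is bounded below since `δ ≤
  -- δ₀ < 1`. Here `K` acquires its dependence on `δ₀`.
  have h3 : (1 : ℝ) ≤ 1 / √(Real.log (1 / δ₀)) * s := by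
    rw [one_div, ← div_eq_inv_mul, le_div_iff₀ hs₀]
    linarith
  set a := 1 / √(Real.log (1 / δ₀)) with ha
  have ha0 : 0 < a := by positivity
  have h4 : (2 * ((c + 1) * (190 * 2 ^ j) / √n) +
      1 / 2 * (c + 1) ^ 2 * √(Real.log (1 / (δ * (1 / 2) ^ (j + 2))) / n)) * √n ≤
      380 * (c + 1) * 2 ^ j + 1 / 2 * (c + 1) ^ 2 * (s + 2 * 2 ^ j) := by
    rw [le_div_iff₀ hn'] at h1
    have : 2 * ((c + 1) * (190 * 2 ^ j) / √n) * √n = 380 * (c + 1) * 2 ^ j := by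
      field_simp
      ring
    rw [add_mul, this, mul_assoc (1 / 2 * (c + 1) ^ 2)]
    gcongr
  refine h4.trans ?_
  have hs0 : 0 ≤ s := Real.sqrt_nonneg _
  have h5 : (2 : ℝ) ^ j ≤ 2 * X + a * s := by linarith
  have h6 : 0 ≤ (2 : ℝ) ^ j := by positivity
  have h7 : (2 : ℝ) ^ j ≤ (2 + a) * (X + s) := by nlinarith [mul_nonneg ha0.le hX]
  have h8 : s ≤ X + s := by linarith
  have hc1 : 0 < 380 * (c + 1) + (c + 1) ^ 2 := by positivity
  calc 380 * (c + 1) * 2 ^ j + 1 / 2 * (c + 1) ^ 2 * (s + 2 * 2 ^ j)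
      = (380 * (c + 1) + (c + 1) ^ 2) * 2 ^ j + 1 / 2 * (c + 1) ^ 2 * s := by ring
    _ ≤ (380 * (c + 1) + (c + 1) ^ 2) * ((2 + a) * (X + s)) +
        (380 * (c + 1) + (c + 1) ^ 2) * (X + s) := by
      refine add_le_add (mul_le_mul_of_nonneg_left h7 hc1.le)
        (mul_le_mul ?_ h8 hs0 hc1.le)
      nlinarith
    _ = _ := by ring

namespace NetShape

variable (N : NetShape)

/-- The deterministic part: outside the bad events, the generalization bound holds. -/
lemma genError_le_of_good (p : ℝ) {c : ℝ} (hc : 0 < c) {δ₀ δ : ℝ} (hδ₀ : δ₀ < 1) (hδ : 0 < δ)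
    (hle : δ ≤ δ₀) {n : ℕ} (hn : 0 < n) {μ : Measure (N.Input × ℝ)} {S : Fin n → N.Input × ℝ}
    {θ : N.Params} {R : ℝ} (hθ : ∀ l ≤ N.depth, ‖N.layerVec θ l‖ ^ 2 ≤ R)
    (hc' : ∀ x : N.Input, ‖x‖ ≤ 1 → |N.eval p x θ| ≤ c)
    (hgood : ∀ j : ℕ, ∀ θ ∈ N.boundedParams p c (N.levelRadius p j), N.genError p μ S θ ≤
      2 * ((c + 1) * (190 * N.complexityConst / (N.outWidth : ℝ) ^ p *
          N.levelRadius p j ^ (N.depth + 1)) / √n) +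
        1 / 2 * (c + 1) ^ 2 * √(Real.log (1 / (δ * (1 / 2) ^ (j + 2))) / n)) :
    N.genError p μ S θ ≤
      (380 * (c + 1) + (c + 1) ^ 2) * (2 + 1 / √(Real.log (1 / δ₀)) + 1) *
        (N.complexityConst / ((N.outWidth : ℝ) ^ p * √n) * R ^ (((N.depth : ℝ) + 1) / 2) +
          √(Real.log (1 / δ) / n)) := by
  have hR : 0 ≤ R := (sq_nonneg _).trans (hθ 0 (Nat.zero_le _))
  have hB := N.complexityConst_div_pos p
  set B := N.complexityConst / (N.outWidth : ℝ) ^ p with hBdef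
  have hpow : √R ^ (N.depth + 1) = R ^ (((N.depth : ℝ) + 1) / 2) := by
    rw [Real.sqrt_eq_rpow, ← Real.rpow_natCast, ← Real.rpow_mul hR]
    congr 1
    push_cast
    ring
  have hX : 0 ≤ B * √R ^ (N.depth + 1) := by positivity
  obtain ⟨j, hj1, hj2⟩ := exists_le_two_pow_le hX
  have hmem : θ ∈ N.boundedParams p c (N.levelRadius p j) := by
    refine ⟨fun l hl => (Real.le_sqrt_of_sq_le (hθ l hl)).trans ?_, hc'⟩
    rw [← N.complexityConst_div_mul_levelRadius_pow p j] at hj1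
    exact le_of_pow_le_pow_left₀ (Nat.succ_ne_zero _) (N.levelRadius_nonneg p j)
      (le_of_mul_le_mul_left hj1 hB)
  refine (hgood j θ hmem).trans ?_
  have e1 : 190 * N.complexityConst / (N.outWidth : ℝ) ^ p *
      N.levelRadius p j ^ (N.depth + 1) = 190 * 2 ^ j := by
    rw [← N.complexityConst_div_mul_levelRadius_pow p j]
    ring
  have e2 : N.complexityConst / ((N.outWidth : ℝ) ^ p * √n) * R ^ (((N.depth : ℝ) + 1) / 2) =
      B * √R ^ (N.depth + 1) / √n := by
    rw [hpow, hBdef, ← div_div]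
    ring
  rw [e1, e2]
  exact level_bound_le hc hδ₀ hδ hle hn hX hj2

end NetShape

end

/-! ### Constants and the union of the bad events -/

noncomputable section

lemma NetShape.two_mul_exp_neg_log_eq (N : NetShape) {δ : ℝ} (hδ : 0 < δ) :
    2 * ((N.depth : ℝ) + 1) * Real.exp (-Real.log (4 * (((N.depth : ℝ) + 1) / δ))) = δ / 2 := by
  have hD : (0 : ℝ) < (N.depth : ℝ) + 1 := by positivity
  rw [Real.exp_neg, Real.exp_log (by positivity)]
  field_simp
  norm_num

lemma log_four_mul_le {x : ℝ} (hx : 1 ≤ x) : 4 * Real.log (4 * x) ≤ 8 * (1 + Real.log x) := by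
  have h4 : Real.log 4 ≤ 2 := by
    rw [show (4 : ℝ) = 2 ^ 2 by norm_num, Real.log_pow]
    have := Real.log_two_lt_d9
    push_cast
    linarith
  rw [Real.log_mul (by norm_num) (by linarith)]
  linarith [Real.log_nonneg hx]

end

theorem theorem1 :
    ∃ c₀ : ℝ, 0 < c₀ ∧
    ∀ Cf : ℝ, 0 < Cf → ∀ δ₀ : ℝ, 0 < δ₀ → δ₀ < 1 →
    ∃ K : ℝ, 0 < K ∧
    ∀ (N : NetShape) (p : ℝ), 0 ≤ p → ∀ κ : ℝ, κ ≠ 0 →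
    ∀ n : ℕ, 0 < n → ∀ Cy : ℝ, Cy ≤ 1 →
    ∀ (μ : Measure (N.Input × ℝ)) [IsProbabilityMeasure μ],
    (∀ᵐ z ∂μ, ‖z.1‖ ≤ 1 ∧ |z.2| ≤ Cy) →
    ∀ T : ℝ, 0 ≤ T → ∀ δ : ℝ, 0 < δ → δ ≤ δ₀ →
    ((Measure.pi fun _ : Fin n => μ).prod (N.initLaw κ))
      {ω | ∀ Θ : ℝ → N.Params,
        Θ 0 = ω.2 → IsGradientFlow (N.empRisk p ω.1) T Θ →
        (∀ t ∈ Set.Icc 0 T, ∀ x : N.Input, ‖x‖ ≤ 1 → |N.eval p x (Θ t)| ≤ Cf) →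
        0 ≤ c₀ * (1 + Real.log (((N.depth : ℝ) + 1) / δ)) * κ ^ 2 + N.cumLoss p Cy ω.1 Θ T ∧
        N.genError p μ ω.1 (Θ T) ≤
          K * (N.complexityConst / ((N.outWidth : ℝ) ^ p * Real.sqrt n) *
              (c₀ * (1 + Real.log (((N.depth : ℝ) + 1) / δ)) * κ ^ 2
                + N.cumLoss p Cy ω.1 Θ T) ^ (((N.depth : ℝ) + 1) / 2)
            + Real.sqrt (Real.log (1 / δ) / n))}ᶜ
      ≤ ENNReal.ofReal δ := by
  -- `8` comes from `log_four_mul_le`, which bounds the initial threshold `4 u`.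
  refine ⟨8, by norm_num, fun Cf hCf δ₀ hδ₀ hδ₀1 => ?_⟩
  refine ⟨(380 * (Cf + 1) + (Cf + 1) ^ 2) * (2 + 1 / √(Real.log (1 / δ₀)) + 1), by positivity,
    fun N p _ κ hκ n hn Cy hCy μ _ hμ T hT δ hδ hδle => ?_⟩
  have hδ1 : δ ≤ 1 := hδle.trans hδ₀1.le
  have hμ1 : ∀ᵐ z ∂μ, ‖z.1‖ ≤ 1 ∧ |z.2| ≤ 1 := hμ.mono fun z hz => ⟨hz.1, hz.2.trans hCy⟩
  set P : Measure (Fin n → N.Input × ℝ) := Measure.pi fun _ => μ with hP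
  set bound : ℕ → ℝ := fun j => 2 * ((Cf + 1) * (190 * N.complexityConst /
      (N.outWidth : ℝ) ^ p * N.levelRadius p j ^ (N.depth + 1)) / √n) +
    1 / 2 * (Cf + 1) ^ 2 * √(Real.log (1 / (δ * (1 / 2) ^ (j + 2))) / n) with hbound
  set dataBad : Set (Fin n → N.Input × ℝ) := {S | ¬ ∀ i, ‖(S i).1‖ ≤ 1 ∧ |(S i).2| ≤ Cy}
    with hdataBad
  set levelBad : ℕ → Set (Fin n → N.Input × ℝ) := fun j =>
    {S | (∀ i, ‖(S i).1‖ ≤ 1 ∧ |(S i).2| ≤ 1) ∧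
      ∃ θ ∈ N.boundedParams p Cf (N.levelRadius p j), bound j < N.genError p μ S θ}
    with hlevelBad
  -- The solution of `2 (L + 1) exp (-u) = δ / 2`: half of the failure probability goes to the
  -- initialization, the other half to the levels.
  set u := Real.log (4 * (((N.depth : ℝ) + 1) / δ)) with hu
  set initBad : Set N.Params := {θ | ∃ l ≤ N.depth, 4 * u * κ ^ 2 < ‖N.layerVec θ l‖ ^ 2}
    with hinitBad
  have hdata : P dataBad = 0 := by
    have h : ∀ᵐ S ∂P, ∀ i, ‖(S i).1‖ ≤ 1 ∧ |(S i).2| ≤ Cy :=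
      ae_all_iff.2 fun i =>
        (measurePreserving_eval (fun _ : Fin n => μ) i).quasiMeasurePreserving.ae hμ
    exact ae_iff.1 h
  have hlevel : ∀ j, P (levelBad j) ≤ ENNReal.ofReal (δ * (1 / 2) ^ (j + 2)) := fun j =>
    N.measure_exists_genError_gt_le p hCf hn hμ1 (N.levelRadius_nonneg p j) (by positivity)
      ((mul_le_of_le_one_right hδ.le (pow_le_one₀ (by norm_num) (by norm_num))).trans hδ1)
  have hinit : N.initLaw κ initBad ≤ ENNReal.ofReal (δ / 2) :=
    (N.initLaw_exists_norm_layerVec_sq_gt_le hκ u).trans_eq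
      (congrArg _ (N.two_mul_exp_neg_log_eq hδ))
  -- The bad events concern the sample alone or the initialization alone. Outside them the argument
  -- is deterministic and covers every trajectory simultaneously, so no measurability in `Θ` is
  -- needed.
  refine (measure_mono (t := (dataBad ∪ ⋃ j, levelBad j) ×ˢ Set.univ ∪ Set.univ ×ˢ initBad)
    ?_).trans ?_
  · rintro ⟨S, θ₀⟩ hω
    by_contra hgood
    refine hω fun Θ hΘ0 hflow hbdd => ?_
    simp only [Set.mem_union, Set.mem_prod, Set.mem_univ, and_true, true_and, Set.mem_iUnion,
      not_or, not_exists] at hgood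
    obtain ⟨⟨hgS, hgL⟩, hgI⟩ := hgood
    have hS : ∀ i, ‖(S i).1‖ ≤ 1 ∧ |(S i).2| ≤ Cy := not_not.1 hgS
    have hlayer : ∀ l ≤ N.depth, ‖N.layerVec (Θ T) l‖ ^ 2 ≤
        8 * (1 + Real.log (((N.depth : ℝ) + 1) / δ)) * κ ^ 2 + N.cumLoss p Cy S Θ T := by
      intro l hl
      refine (N.norm_layerVec_sq_le_add_cumLoss p hn (fun i => (hS i).2) hT hflow hl).trans
        (add_le_add ?_ le_rfl)
      have h1 : ‖N.layerVec (Θ 0) l‖ ^ 2 ≤ 4 * u * κ ^ 2 := by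
        rw [hΘ0]
        exact not_lt.1 fun h => hgI ⟨l, hl, h⟩
      refine h1.trans (mul_le_mul_of_nonneg_right (log_four_mul_le ?_) (sq_nonneg κ))
      rw [le_div_iff₀ hδ]
      have : (0 : ℝ) ≤ N.depth := Nat.cast_nonneg _
      linarith
    refine ⟨(sq_nonneg _).trans (hlayer 0 (Nat.zero_le _)), ?_⟩
    refine N.genError_le_of_good p hCf hδ₀1 hδ hδle hn hlayer (hbdd T ⟨hT, le_rfl⟩) ?_
    intro j θ hθ
    exact not_lt.1 fun h => hgL j ⟨fun i => ⟨(hS i).1, (hS i).2.trans hCy⟩, θ, hθ, h⟩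
  · calc _ ≤ (P.prod (N.initLaw κ)) ((dataBad ∪ ⋃ j, levelBad j) ×ˢ Set.univ) +
          (P.prod (N.initLaw κ)) (Set.univ ×ˢ initBad) := measure_union_le _ _
      _ = P (dataBad ∪ ⋃ j, levelBad j) + N.initLaw κ initBad := by
        rw [Measure.prod_prod, Measure.prod_prod, measure_univ, measure_univ, mul_one, one_mul]
      _ ≤ ENNReal.ofReal (δ / 2) + ENNReal.ofReal (δ / 2) := by
        refine add_le_add ?_ hinit
        calc _ ≤ P dataBad + P (⋃ j, levelBad j) := measure_union_le _ _
          _ ≤ 0 + ∑' j, ENNReal.ofReal (δ * (1 / 2) ^ (j + 2)) :=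
            add_le_add hdata.le ((measure_iUnion_le _).trans (ENNReal.tsum_le_tsum hlevel))
          _ = _ := by rw [zero_add, tsum_ofReal_mul_inv_two_pow δ hδ.le]
      _ = ENNReal.ofReal δ := by
        rw [← ENNReal.ofReal_add (by positivity) (by positivity), add_halves]
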